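/- \textbf{Model.} The input is a simple graph $G$ on the vertex set $\{0,\dots,n-1\}$, $n\ge 0$. An algorithm is a program for a randomized random-access machine with finitely many integer variables and integer arrays (initially $0$, except that one variable holds $n$), with assignments, conditionals, while-loops, and the operations $+$, truncated $-$, $\times$, integer division and comparison on nonnegative integers. It may draw a fresh uniformly random element of $\{0,\dots,m\}$ for any computed $m$, and it accesses $G$ only through pair queries ("is there an edge between $u$ and $v$?"). Time is measured by the logarithmic cost criterion: every operation, query and random draw costs one plus the bit lengths of the numbers (operands, array indices, results) it handles, up to constant factors. \textbf{Theorem.} There are constants $C$ and $k$ such that for every real $\varepsilon>0$ there is a randomized algorithm that uses pair queries and has the following properties for every $n$ and every graph $G$ on $n$ vertices. (1) For every outcome of its random choices it halts within time $$C\Bigl(\frac{n^{1.5}}{\varepsilon^{2}}+1\Bigr)\log^{k}(n+2),$$ that is, it runs in $\tilde O(n^{1.5}/\varepsilon^{2})$ time. (2) With probability at least $2/3$, its output $x$ is an estimate of the size of a maximal matching within additive error $\varepsilon n$: there is an inclusion-maximal matching $M$ of $G$ with $\bigl|x-|M|\bigr|\le\varepsilon n$. -/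

import Mathlib

/-!
Randomized random-access machines with pair queries, under the logarithmic cost criterion.

A program has finitely many integer variables and finitely many integer arrays, unbounded and
initially zero. The graph on the vertex set `{0, …, n - 1}` is reached only through the instruction
`query`, and random numbers only through the instruction `rand`. Every operation is charged the
bit length of all numbers it handles (operands, results, and array indices), plus one.
-/

namespace PairQuery

/-- Contents of the variables and of the arrays. -/
structure State where
  var : ℕ → ℕ
  arr : ℕ → ℕ → ℕ

/-- `sub` is truncated at zero, `div` rounds down (and gives `0` for the divisor `0`), `lt` gives
`1` or `0`. -/
inductive Op
  | add | sub | mul | div | lt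

def Op.eval : Op → ℕ → ℕ → ℕ
  | .add, a, b => a + b
  | .sub, a, b => a - b
  | .mul, a, b => a * b
  | .div, a, b => a / b
  | .lt, a, b => if a < b then 1 else 0

/-- Expressions: integer literals, variables, array cells, binary operations. -/
inductive Expr
  | lit (c : ℕ)
  | var (x : ℕ)
  | cell (a : ℕ) (i : Expr)
  | bin (o : Op) (e f : Expr)

def Expr.eval (s : State) : Expr → ℕ
  | .lit c => c
  | .var x => s.var x
  | .cell a i => s.arr a (i.eval s)
  | .bin o e f => o.eval (e.eval s) (f.eval s)

/-- Time to evaluate an expression: the cost of evaluating its subexpressions (an array index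
included), plus the bit length of the value, plus one. -/
def Expr.cost (s : State) : Expr → ℕ
  | .lit c => c.size + 1
  | .var x => (s.var x).size + 1
  | .cell a i => i.cost s + (s.arr a (i.eval s)).size + 1
  | .bin o e f => e.cost s + f.cost s + (o.eval (e.eval s) (f.eval s)).size + 1

/-- Programs. Conditions are true when nonzero. -/
inductive Prog
  /-- do nothing -/
  | skip
  /-- assign the value of `e` to the variable `x` -/
  | assign (x : ℕ) (e : Expr)
  /-- assign the value of `e` to the cell with index `i` of the array `a` -/
  | store (a : ℕ) (i e : Expr)
  /-- ask whether the vertices `e` and `f` are adjacent, and put the answer (`1` or `0`) into `x` -/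
  | query (x : ℕ) (e f : Expr)
  /-- put a fresh uniformly random element of `{0, 1, …, e}` into `x` -/
  | rand (x : ℕ) (e : Expr)
  | seq (c d : Prog)
  | ite (e : Expr) (c d : Prog)
  | loop (e : Expr) (c : Prog)

def State.setVar (s : State) (x v : ℕ) : State :=
  { s with var := Function.update s.var x v }

def State.setCell (s : State) (a i v : ℕ) : State :=
  { s with arr := Function.update s.arr a (Function.update (s.arr a) i v) }

/-- Result of a run: the final state together with the time used, or `none` for a run that was cut
off because some loop exceeded the permitted number of iterations. -/
abbrev Outcome := Option (State × ℕ)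

noncomputable section

/-- The run that takes time `t` and ends in the state `s`. -/
def finish (t : ℕ) (s : State) : PMF Outcome := PMF.pure (some (s, t))

/-- Run `μ` and then, from the state reached, `f`; the times add up. -/
def andThen (μ : PMF Outcome) (f : State → PMF Outcome) : PMF Outcome :=
  μ.bind fun r => match r with
    | none => PMF.pure none
    | some (s, t) => (f s).map (Option.map fun p => (p.1, t + p.2))

/-- `while e do body`, cut off when more than the given number of iterations is needed. -/
def iterate (e : Expr) (body : State → PMF Outcome) : ℕ → State → PMF Outcome
  | 0, s => if e.eval s = 0 then finish (e.cost s + 1) s else PMF.pure none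
  | k + 1, s =>
      if e.eval s = 0 then finish (e.cost s + 1) s
      else andThen (finish (e.cost s + 1) s) fun s₀ =>
        andThen (body s₀) fun s₁ => iterate e body k s₁

/-- Distribution of the outcome of a program that is started in a given state and whose pair
queries are answered by `q`. Every execution of a loop is cut off after `fuel` iterations. -/
def Prog.exec (q : ℕ → ℕ → Bool) (fuel : ℕ) : Prog → State → PMF Outcome
  | .skip, s => finish 1 s
  | .assign x e, s => finish (e.cost s + 1) (s.setVar x (e.eval s))
  | .store a i e, s => finish (i.cost s + e.cost s + 1) (s.setCell a (i.eval s) (e.eval s))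
  | .query x e f, s =>
      finish (e.cost s + f.cost s + 1) (s.setVar x (if q (e.eval s) (f.eval s) then 1 else 0))
  | .rand x e, s =>
      (PMF.uniformOfFinset (Finset.range (e.eval s + 1)) Finset.nonempty_range_add_one).bind
        fun v => finish (e.cost s + 1) (s.setVar x v)
  | .seq c d, s => andThen (c.exec q fuel s) fun s₁ => d.exec q fuel s₁
  | .ite e c d, s =>
      andThen (finish (e.cost s + 1) s) fun s₀ =>
        if e.eval s₀ ≠ 0 then c.exec q fuel s₀ else d.exec q fuel s₀
  | .loop e c, s => iterate e (fun s₀ => c.exec q fuel s₀) fuel s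

open Classical in
/-- The answer to a pair query. Numbers that are not vertices are adjacent to nothing. -/
def pairOracle {n : ℕ} (G : SimpleGraph (Fin n)) (u v : ℕ) : Bool :=
  decide (∃ (hu : u < n) (hv : v < n), G.Adj ⟨u, hu⟩ ⟨v, hv⟩)

/-- Initially variable `0` holds the number of vertices; everything else is zero. -/
def initial (n : ℕ) : State where
  var := fun x => if x = 0 then n else 0
  arr := fun _ _ => 0

/-- Distribution of the outcome of the program `P` on the graph `G`. -/
def Prog.run (P : Prog) {n : ℕ} (G : SimpleGraph (Fin n)) (fuel : ℕ) : PMF Outcome :=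
  P.exec (pairOracle G) fuel (initial n)

/-- The number returned by a run: the final content of variable `1`. -/
def State.output (s : State) : ℕ := s.var 1

/-- On the graph `G`, every run of `P` halts within time `T`, whatever the random numbers, and with
probability at least `p` the number returned satisfies `good`. As soon as no run is cut off, the
distribution of the outcome does not depend on `fuel` any more. -/
def Prog.Solves (P : Prog) {n : ℕ} (G : SimpleGraph (Fin n)) (T : ℝ) (p : ENNReal)
    (good : ℕ → Prop) : Prop :=
  ∃ fuel : ℕ,
    (∀ r ∈ (P.run G fuel).support, ∃ s t, r = some (s, t) ∧ (t : ℝ) ≤ T) ∧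
    p ≤ (P.run G fuel).toOuterMeasure {r | ∃ s t, r = some (s, t) ∧ good s.output}

end

/-- `M` is an inclusion-maximal matching of `G`. -/
def IsMaximalMatching {V : Type*} {G : SimpleGraph V} (M : G.Subgraph) : Prop :=
  Maximal (fun M' : G.Subgraph => M'.IsMatching) M

end PairQuery

/-!
Greedy matching over all pairs computes a maximal matching exactly in about `n ^ 2` steps. If `n`
is at most `L ^ 2`, where `L` is about `1 / ε ^ 2`, this is within the time bound, because
`n ^ 2 ≤ L * n ^ (3 / 2)`. If `ε ≥ 1 / 2`, then `0` is an estimate. In the remaining case the size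
of a maximal matching is estimated in two phases, with `r` about `√n`.

*Sparsification.* For each vertex `r` random partners are tried, and an edge that joins two
unmatched vertices is added to a matching. A vertex that has `d` unmatched neighbours afterwards
stayed unmatched in each of its trials with probability at most `1 - d / n`, which makes the
expected degree sum of the graph on the unmatched vertices, the residual graph, at most `n * r`
(`expect_residualDegree_le`).

*Sampling.* Edges of the residual graph get independent random ranks, and treating them by
increasing rank gives a greedy matching `M'`. Together with the matching from the first phase it
is a maximal matching of the whole graph (`Represents.exists_isMaximalMatching`). It suffices to
estimate the proportion of vertices that `M'` matches. For `N = 10 * L` random vertices the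
program finds out whether `M'` matches them: an edge belongs to `M'` if and only if no adjacent
edge of smaller rank does, so this is a depth-first search along walks of decreasing ranks
(`explore_ensures`). Chebyshev's inequality bounds the sampling error by `ε * n / 2`.

*Cost of a search.* The edges that the search from a vertex looks at correspond to its query
walks. Over all starting vertices their expected number is at most the degree sum of the residual
graph (`EdgeCode.sum_ncard_queryWalks_le`): cyclically shifting the ranks along a query walk turns
a pair of a ranking and a walk into a pair of a ranking and an oriented edge, namely the last one
of the walk, and this map is injective, since in the shifted ranking the walk can be traced back
edge by edge along edges that are selected (`EdgeCode.IsQueryWalk.eq_of_shift_eq`). By Markov's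
inequality a budget of `O(L * r)` search steps, each of cost `O(n)`, suffices with probability
`9 / 10`, and the program stops there in any case.

Two devices connect this to the machine model. Programs are written in a language whose loops have
a number of iterations known on entry and whose numbers are clamped at `n ^ 8`, so that the time
bound for every outcome can be read off from the text (`Stmt.Safe.implements`). Ranks are drawn
when they are first needed; drawing the undrawn ones afterwards commutes with the program, so that
the analysis may assume a table of ranks drawn in advance (`Stmt.Commutes.expect_eq`).
-/

namespace PairQuery

/-! ### Random greedy matching and query walks -/

/-- A graph on natural numbers whose edges carry codes in `E`: the code of an edge does not depend
on its orientation, and distinct edges have distinct codes. Edges are ranked by `key ∘ code`, for a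
function `key : E → ℕ`. -/
structure EdgeCode (E : Type*) where
  adj : ℕ → ℕ → Prop
  code : ℕ → ℕ → E
  symm : ∀ {a b}, adj a b → adj b a
  code_comm : ∀ a b, code a b = code b a
  code_inj : ∀ {a b c d}, adj a b → adj c d → code a b = code c d → a = c ∧ b = d ∨ a = d ∧ b = c

namespace EdgeCode

variable {E : Type*} (S : EdgeCode E)

/-- The edge `ab` belongs to the greedy matching that treats the edges by increasing key: no
adjacent edge with a smaller key does. -/
def Selected (key : E → ℕ) (a b : ℕ) : Prop :=
  ∀ y, (S.adj a y → ∀ _ : key (S.code a y) < key (S.code a b), ¬ Selected key a y) ∧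
    (S.adj b y → ∀ _ : key (S.code b y) < key (S.code a b), ¬ Selected key b y)
termination_by key (S.code a b)

/-- The codes of the edges of a walk. -/
def codes : List ℕ → List E
  | a :: b :: l => S.code a b :: codes (b :: l)
  | _ => []

/-- The walks along which the recursive exploration of the greedy matching proceeds, most recent
vertex first: keys decrease along the walk, and an edge is explored from a vertex only if no edge
at this vertex with a smaller key is selected. -/
def IsQueryWalk (key : E → ℕ) : List ℕ → Prop
  | [] => False
  | [_] => True
  | x :: w :: l => S.adj w x ∧ (∀ u ∈ l.head?, key (S.code w x) < key (S.code u w)) ∧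
      (∀ y, S.adj w y → key (S.code w y) < key (S.code w x) → ¬ S.Selected key w y) ∧
      IsQueryWalk key (w :: l)

open Classical in
/-- The cyclic shift of the edges of a walk. -/
noncomputable def walkPerm : List ℕ → Equiv.Perm E
  | a :: b :: c :: l => walkPerm (b :: c :: l) * Equiv.swap (S.code a b) (S.code b c)
  | _ => 1

/-- The codes that occur on edges. -/
def edgeCodes : Set E := {e | ∃ a b, S.adj a b ∧ S.code a b = e}

variable {S}

theorem code_mem_edgeCodes {a b : ℕ} (h : S.adj a b) : S.code a b ∈ S.edgeCodes := ⟨a, b, h, rfl⟩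

theorem selected_comm {key : E → ℕ} {a b : ℕ} : S.Selected key a b ↔ S.Selected key b a := by
  rw [Selected, Selected, S.code_comm b a]
  exact forall_congr' fun y => and_comm

theorem Selected.not_left {key : E → ℕ} {a b y : ℕ} (h : S.Selected key a b) (hy : S.adj a y)
    (hk : key (S.code a y) < key (S.code a b)) : ¬ S.Selected key a y := by
  rw [Selected] at h
  exact (h y).1 hy hk

theorem Selected.eq_of_adj {key : E → ℕ} (hkey : Set.InjOn key S.edgeCodes) {a b c : ℕ}
    (hab : S.adj a b) (hac : S.adj a c) (hb : S.Selected key a b) (hc : S.Selected key a c) :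
    b = c := by
  rcases lt_trichotomy (key (S.code a b)) (key (S.code a c)) with h | h | h
  · exact absurd hb (hc.not_left hab h)
  · have := S.code_inj hab hac (hkey (code_mem_edgeCodes hab) (code_mem_edgeCodes hac) h)
    omega
  · exact absurd hc (hb.not_left hac h)

/-- The greedy matching is maximal. -/
theorem exists_selected_of_adj (key : E → ℕ) {a b : ℕ} (hab : S.adj a b) :
    ∃ y, S.adj a y ∧ S.Selected key a y ∨ S.adj b y ∧ S.Selected key b y := by
  by_contra! h
  refine (h b).1 hab ?_
  rw [Selected]
  exact fun y => ⟨fun hy _ => (h y).1 hy, fun hy _ => (h y).2 hy⟩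

/-- Membership in the greedy matching depends on smaller keys only. -/
theorem selected_congr {key key' : E → ℕ} {t : ℕ} (h : ∀ e, key e < t → key' e = key e)
    (h' : ∀ e, key' e < t → key' e = key e) {a b : ℕ} (hab : key (S.code a b) < t) :
    S.Selected key a b ↔ S.Selected key' a b := by
  induction hk : key (S.code a b) using Nat.strong_induction_on generalizing a b with
  | _ k ih =>
    have main : ∀ c y : ℕ, (S.adj c y → ∀ _ : key (S.code c y) < key (S.code a b),
          ¬ S.Selected key c y) ↔
        (S.adj c y → ∀ _ : key' (S.code c y) < key' (S.code a b), ¬ S.Selected key' c y) := by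
      intro c y
      refine forall_congr' fun _ => ?_
      rw [h _ hab]
      constructor
      · intro H hlt
        have e := h' _ (hlt.trans hab)
        rw [e] at hlt
        rw [← ih _ (hk ▸ hlt) (hlt.trans hab) rfl]
        exact H hlt
      · intro H hlt
        rw [ih _ (hk ▸ hlt) (hlt.trans hab) rfl]
        exact H (by rwa [h _ (hlt.trans hab)])
    rw [Selected, Selected]
    exact forall_congr' fun y => and_congr (main a y) (main b y)

theorem IsQueryWalk.tail {key : E → ℕ} {a b : ℕ} {l : List ℕ}
    (h : S.IsQueryWalk key (a :: b :: l)) : S.IsQueryWalk key (b :: l) := h.2.2.2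

theorem IsQueryWalk.codes_lt {key : E → ℕ} {a b : ℕ} {l : List ℕ}
    (h : S.IsQueryWalk key (a :: b :: l)) :
    ∀ e ∈ S.codes (b :: l), key (S.code a b) < key e := by
  induction l generalizing a b with
  | nil => simp [codes]
  | cons c l ih =>
    have hlt : key (S.code a b) < key (S.code b c) := by
      have := h.2.1 c (by simp)
      rwa [S.code_comm b a, S.code_comm c b] at this
    intro e he
    rw [codes, List.mem_cons] at he
    rcases he with rfl | he
    · exact hlt
    · exact hlt.trans (ih h.tail e he)

theorem IsQueryWalk.codes_subset {key : E → ℕ} {l : List ℕ} (h : S.IsQueryWalk key l) :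
    ∀ e ∈ S.codes l, e ∈ S.edgeCodes := by
  induction l with
  | nil => simp [codes]
  | cons a l ih =>
    cases l with
    | nil => simp [codes]
    | cons b l =>
      intro e he
      rw [codes, List.mem_cons] at he
      rcases he with rfl | he
      · exact code_mem_edgeCodes (S.symm h.1)
      · exact ih h.tail e he

theorem walkPerm_apply_of_notMem {l : List ℕ} {e : E} (he : e ∉ S.codes l) :
    S.walkPerm l e = e := by
  classical
  induction l with
  | nil => rfl
  | cons a l ih =>
    match l with
    | [] => rfl
    | [_] => rfl
    | b :: c :: l =>
      simp only [codes, List.mem_cons, not_or] at he ih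
      rw [walkPerm, Equiv.Perm.mul_apply, Equiv.swap_apply_of_ne_of_ne he.1 he.2.1]
      exact ih he.2

theorem walkPerm_apply_mem {l : List ℕ} {e : E} (he : e ∈ S.codes l) :
    S.walkPerm l e ∈ S.codes l := by
  by_contra h
  have := walkPerm_apply_of_notMem h
  rw [(S.walkPerm l).injective this] at h
  exact h he

theorem walkPerm_mem_edgeCodes {key : E → ℕ} {l : List ℕ} (h : S.IsQueryWalk key l) {e : E}
    (he : e ∈ S.edgeCodes) : S.walkPerm l e ∈ S.edgeCodes := by
  by_cases hl : e ∈ S.codes l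
  · exact h.codes_subset _ (walkPerm_apply_mem hl)
  · rwa [walkPerm_apply_of_notMem hl]

theorem injOn_comp_walkPerm {key : E → ℕ} {l : List ℕ} (h : S.IsQueryWalk key l)
    (hkey : Set.InjOn key S.edgeCodes) : Set.InjOn (key ∘ S.walkPerm l) S.edgeCodes :=
  hkey.comp (S.walkPerm l).injective.injOn fun _ he => walkPerm_mem_edgeCodes h he

/-- After the shift the second edge of the walk, counted from its last vertex, has inherited the
smallest key; both its endpoints are free when its turn comes, so it is selected. Hence the walk
can be traced back from its last edge. -/
theorem IsQueryWalk.selected_shift {key : E → ℕ} {a b c : ℕ} {l : List ℕ}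
    (h : S.IsQueryWalk key (a :: b :: c :: l)) :
    S.Selected (key ∘ S.walkPerm (a :: b :: c :: l)) b c ∧
      (key ∘ S.walkPerm (a :: b :: c :: l)) (S.code b c) <
        (key ∘ S.walkPerm (a :: b :: c :: l)) (S.code a b) := by
  classical
  have hlt := h.codes_lt
  have hbc : S.walkPerm (a :: b :: c :: l) (S.code b c) = S.code a b := by
    rw [walkPerm, Equiv.Perm.mul_apply, Equiv.swap_apply_right]
    exact walkPerm_apply_of_notMem fun hm => lt_irrefl _ (hlt _ hm)
  have hab : S.walkPerm (a :: b :: c :: l) (S.code a b) ∈ S.codes (b :: c :: l) := by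
    rw [walkPerm, Equiv.Perm.mul_apply, Equiv.swap_apply_left]
    exact walkPerm_apply_mem (by simp [codes])
  have hge : ∀ e ∈ S.codes (a :: b :: c :: l), key (S.code a b) ≤ key e := by
    intro e he
    rw [codes, List.mem_cons] at he
    rcases he with rfl | he
    · exact le_rfl
    · exact (hlt e he).le
  have h1 : ∀ e, key e < key (S.code a b) →
      (key ∘ S.walkPerm (a :: b :: c :: l)) e = key e := by
    intro e he
    rw [Function.comp, walkPerm_apply_of_notMem fun hm => absurd (hge e hm) (by omega)]
  have h2 : ∀ e, (key ∘ S.walkPerm (a :: b :: c :: l)) e < key (S.code a b) →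
      (key ∘ S.walkPerm (a :: b :: c :: l)) e = key e := by
    intro e he
    rw [Function.comp, walkPerm_apply_of_notMem fun hm =>
      absurd (hge _ (walkPerm_apply_mem hm)) (by simpa using he)]
  have hbc' : (key ∘ S.walkPerm (a :: b :: c :: l)) (S.code b c) = key (S.code a b) := by
    rw [Function.comp, hbc]
  have hkab : key (S.code a b) < key (S.code b c) := hlt _ (by simp [codes])
  refine ⟨?_, ?_⟩
  · rw [Selected]
    intro y
    rw [hbc']
    constructor
    · intro hy hk
      rw [h2 _ hk] at hk
      rw [← selected_congr h1 h2 hk]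
      exact h.2.2.1 y hy (by rwa [S.code_comm b a])
    · intro hy hk
      rw [h2 _ hk] at hk
      rw [← selected_congr h1 h2 hk]
      exact h.tail.2.2.1 y hy (by rw [S.code_comm c b]; omega)
  · rw [hbc']
    exact hlt _ hab

/-- A ranking and a query walk can be recovered from the shifted ranking and the last edge. -/
theorem IsQueryWalk.eq_of_shift_eq {key₁ key₂ : E → ℕ} {a b : ℕ} {l₁ l₂ : List ℕ}
    (inj₁ : Set.InjOn key₁ S.edgeCodes)
    (h₁ : S.IsQueryWalk key₁ (a :: b :: l₁)) (h₂ : S.IsQueryWalk key₂ (a :: b :: l₂))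
    (h : key₁ ∘ S.walkPerm (a :: b :: l₁) = key₂ ∘ S.walkPerm (a :: b :: l₂)) :
    l₁ = l₂ := by
  classical
  induction l₁ generalizing a b l₂ with
  | nil =>
    cases l₂ with
    | nil => rfl
    | cons c l₂ =>
      exfalso
      have h3 := h₂.selected_shift
      rw [← h] at h3
      simp only [walkPerm, Equiv.Perm.coe_one, Function.comp_id] at h3
      exact h₁.2.2.1 c (S.symm h₂.tail.1) (by rw [S.code_comm b a]; exact h3.2) h3.1
  | cons c l₁ ih =>
    have h3 := h₁.selected_shift
    cases l₂ with
    | nil =>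
      exfalso
      rw [h] at h3
      simp only [walkPerm, Equiv.Perm.coe_one, Function.comp_id] at h3
      exact h₂.2.2.1 c (S.symm h₁.tail.1) (by rw [S.code_comm b a]; exact h3.2) h3.1
    | cons d l₂ =>
      have h4 := h₂.selected_shift
      have hcd : c = d := by
        rw [← h] at h4
        exact h3.1.eq_of_adj (injOn_comp_walkPerm h₁ inj₁) (S.symm h₁.tail.1)
          (S.symm h₂.tail.1) h4.1
      subst hcd
      refine congrArg (c :: ·) (ih h₁.tail h₂.tail ?_)
      funext e
      have := congrFun h ((Equiv.swap (S.code a b) (S.code b c)).symm e)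
      simpa [walkPerm] using this

theorem IsQueryWalk.eq_and_eq_of_shift_eq {key₁ key₂ : E → ℕ} {a b : ℕ} {l₁ l₂ : List ℕ}
    (inj₁ : Set.InjOn key₁ S.edgeCodes)
    (h₁ : S.IsQueryWalk key₁ (a :: b :: l₁)) (h₂ : S.IsQueryWalk key₂ (a :: b :: l₂))
    (h : key₁ ∘ S.walkPerm (a :: b :: l₁) = key₂ ∘ S.walkPerm (a :: b :: l₂)) :
    key₁ = key₂ ∧ l₁ = l₂ := by
  have hl := h₁.eq_of_shift_eq inj₁ h₂ h
  subst hl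
  exact ⟨(S.walkPerm (a :: b :: l₁)).surjective.injective_comp_right h, rfl⟩

/-- The query walks from `v` with at least one edge. Their number is the number of edges that the
exploration from `v` looks at. -/
def queryWalks (S : EdgeCode E) (key : E → ℕ) (v : ℕ) : Set (List ℕ) :=
  {l | S.IsQueryWalk key l ∧ 2 ≤ l.length ∧ l.getLast? = some v}

/-- The keys read off from a table: positive numbers. -/
def tableKey {M : ℕ} (f : E → Fin M) (e : E) : ℕ := f e + 1

open Classical in
/-- The oriented edges of a graph on the vertices below `n`. -/
noncomputable def darts (S : EdgeCode E) (n : ℕ) : Finset (ℕ × ℕ) :=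
  (Finset.range n ×ˢ Finset.range n).filter fun p => S.adj p.1 p.2

section Counting

variable [Fintype E] [DecidableEq E] {M n : ℕ}

/-- Injectivity of the shift, on all pairs of an injective table and a query walk at once. -/
theorem finite_queryWalk_pairs_and_ncard_le (hn : ∀ a b, S.adj a b → a < n ∧ b < n) :
    {p : (E → Fin M) × List ℕ | Set.InjOn (tableKey p.1) S.edgeCodes ∧
      S.IsQueryWalk (tableKey p.1) p.2 ∧ 2 ≤ p.2.length}.Finite ∧
    {p : (E → Fin M) × List ℕ | Set.InjOn (tableKey p.1) S.edgeCodes ∧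
      S.IsQueryWalk (tableKey p.1) p.2 ∧ 2 ≤ p.2.length}.ncard ≤
        Fintype.card (E → Fin M) * (S.darts n).card := by
  classical
  set T := {p : (E → Fin M) × List ℕ | Set.InjOn (tableKey p.1) S.edgeCodes ∧
      S.IsQueryWalk (tableKey p.1) p.2 ∧ 2 ≤ p.2.length} with hT
  let φ : (E → Fin M) × List ℕ → (E → Fin M) × (ℕ × ℕ) := fun p =>
    (p.1 ∘ S.walkPerm p.2, (p.2.headD 0, p.2.tail.headD 0))
  have hmaps : Set.MapsTo φ T
      (((Finset.univ : Finset (E → Fin M)) ×ˢ S.darts n : Finset _) : Set _) := by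
    rintro ⟨f, l⟩ ⟨-, hl, h2⟩
    match l with
    | [] => simp at h2
    | [_] => simp at h2
    | a :: b :: l =>
      have := S.symm hl.1
      simp [φ, darts, this, hn _ _ this]
  have hinj : Set.InjOn φ T := by
    rintro ⟨f, l⟩ ⟨hf, hl, h2⟩ ⟨g, l'⟩ ⟨-, hl', h2'⟩ h
    match l, l' with
    | [], _ => simp at h2
    | [_], _ => simp at h2
    | _, [] => simp at h2'
    | _, [_] => simp at h2'
    | a :: b :: l, a' :: b' :: l' =>
      simp only [φ, Prod.mk.injEq, List.headD_cons, List.tail_cons] at h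
      obtain ⟨h1, rfl, rfl⟩ := h
      obtain ⟨h3, rfl⟩ := hl.eq_and_eq_of_shift_eq hf hl' (by
        funext e
        have := congrFun h1 e
        simp only [Function.comp] at this
        simp [tableKey, this])
      refine Prod.ext (funext fun e => ?_) rfl
      have := congrFun h3 e
      simpa [tableKey, Fin.ext_iff] using this
  refine ⟨Set.Finite.of_injOn hmaps hinj (Finset.finite_toSet _), ?_⟩
  refine (Set.ncard_le_ncard_of_injOn φ hmaps hinj (Finset.finite_toSet _)).trans ?_
  rw [Set.ncard_coe_finset, Finset.card_product, Finset.card_univ]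

theorem finite_queryWalks (hn : ∀ a b, S.adj a b → a < n ∧ b < n) {f : E → Fin M}
    (hf : Set.InjOn (tableKey f) S.edgeCodes) (v : ℕ) : (S.queryWalks (tableKey f) v).Finite := by
  refine Set.Finite.of_injOn (f := fun l => (f, l)) ?_ ?_
    (finite_queryWalk_pairs_and_ncard_le (M := M) hn).1
  · exact fun l hl => ⟨hf, hl.1, hl.2.1⟩
  · exact fun l _ l' _ h => (Prod.mk.inj h).2

open Classical in
/-- On average over the rankings, the explorations from all vertices together look at no more edges
than there are oriented edges. -/
theorem sum_ncard_queryWalks_le (hn : ∀ a b, S.adj a b → a < n ∧ b < n) :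
    ∑ f : E → Fin M with Set.InjOn (tableKey f) S.edgeCodes,
      ∑ v ∈ Finset.range n, (S.queryWalks (tableKey f) v).ncard ≤
        Fintype.card (E → Fin M) * (S.darts n).card := by
  obtain ⟨hfin, hcard⟩ := finite_queryWalk_pairs_and_ncard_le (S := S) (M := M) hn
  refine le_trans ?_ hcard
  rw [Set.ncard_eq_toFinset_card _ hfin, ← Finset.sum_product']
  have key : ∀ p : (E → Fin M) × ℕ,
      p ∈ (Finset.univ.filter fun f : E → Fin M => Set.InjOn (tableKey f) S.edgeCodes) ×ˢ
        Finset.range n →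
      (S.queryWalks (tableKey p.1) p.2).ncard ≤
        (hfin.toFinset.filter fun r => (r.1, r.2.getLast?.getD n) = p).card := by
    rintro ⟨f, v⟩ hp
    simp only [Finset.mem_product, Finset.mem_filter, Finset.mem_univ, true_and,
      Finset.mem_range] at hp
    rw [← Set.ncard_coe_finset]
    refine Set.ncard_le_ncard_of_injOn (fun l => (f, l)) ?_ ?_ (Finset.finite_toSet _)
    · rintro l ⟨h1, h2, h3⟩
      simp [hp.1, h1, h2, h3]
    · exact fun l _ l' _ h => (Prod.mk.inj h).2
  refine (Finset.sum_le_sum key).trans ?_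
  rw [Finset.sum_card_fiberwise_eq_card_filter]
  exact Finset.card_filter_le _ _

end Counting

/-! ### Exploration of the greedy matching from a vertex -/

variable {E : Type*} {S : EdgeCode E} {key : E → ℕ} {v : ℕ}

/-- A depth-first exploration that stands at the walk `l` and has treated the edges at its last
vertex with keys up to `lo` has visited only walks that do not come later: a visited extension of an
initial part of `l` leaves it along an edge with a key that is at most the current one. -/
def VisitedBefore (S : EdgeCode E) (key : E → ℕ) (Vis : Finset (List ℕ)) : List ℕ → ℕ → Prop
  | [], _ => True
  | [x], lo => ∀ p ∈ Vis, ∀ y, [y, x] <:+ p → key (S.code x y) ≤ lo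
  | x :: w :: l, lo => (∀ p ∈ Vis, ∀ y, (y :: x :: w :: l) <:+ p → key (S.code x y) ≤ lo) ∧
      VisitedBefore S key Vis (w :: l) (key (S.code w x))

theorem VisitedBefore.le {Vis : Finset (List ℕ)} {x lo : ℕ} {l : List ℕ}
    (h : VisitedBefore S key Vis (x :: l) lo) :
    ∀ p ∈ Vis, ∀ y, (y :: x :: l) <:+ p → key (S.code x y) ≤ lo := by
  cases l with
  | nil => exact h
  | cons w l => exact h.1

theorem VisitedBefore.mono {Vis : Finset (List ℕ)} {lo lo' : ℕ} {l : List ℕ}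
    (h : VisitedBefore S key Vis l lo) (hlo : lo ≤ lo') : VisitedBefore S key Vis l lo' := by
  match l with
  | [] => trivial
  | [x] => exact fun p hp y hy => (h p hp y hy).trans hlo
  | x :: w :: l => exact ⟨fun p hp y hy => (h.1 p hp y hy).trans hlo, h.2⟩

theorem VisitedBefore.insert {Vis : Finset (List ℕ)} {lo : ℕ} {l : List ℕ}
    (h : VisitedBefore S key Vis l lo) {p₀ : List ℕ} (hp₀ : l <:+ p₀)
    (hlo : ∀ x ∈ l.head?, ∀ y, (y :: l) <:+ p₀ → key (S.code x y) ≤ lo) :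
    VisitedBefore S key (Insert.insert p₀ Vis) l lo := by
  induction l generalizing lo with
  | nil => trivial
  | cons x l ih =>
    have h1 : ∀ p ∈ Insert.insert p₀ Vis, ∀ y, (y :: x :: l) <:+ p → key (S.code x y) ≤ lo := by
      intro p hp y hy
      rcases Finset.mem_insert.1 hp with rfl | hp
      · exact hlo x (by simp) y hy
      · exact h.le p hp y hy
    cases l with
    | nil => exact h1
    | cons w l =>
      refine ⟨h1, ih h.2 ((List.suffix_cons _ _).trans hp₀) ?_⟩
      intro z hz y hy
      obtain rfl : w = z := by simpa using hz
      have := (List.suffix_of_suffix_length_le hy hp₀ (by simp)).eq_of_length (by simp)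
      obtain rfl : y = x := by simpa using this
      exact le_rfl

/-- The state of the exploration of the greedy matching from `v`: it stands at the query walk `l`,
the edges at the last vertex with keys up to `lo` are known not to be selected, and the query walks
in `Vis` have been visited. -/
structure Exploration (S : EdgeCode E) (key : E → ℕ) (v : ℕ) (Vis : Finset (List ℕ))
    (l : List ℕ) (lo : ℕ) : Prop where
  walk : S.IsQueryWalk key l
  last : l.getLast? = some v
  low : ∀ w ∈ l.head?, ∀ y, S.adj w y → key (S.code w y) ≤ lo → ¬ S.Selected key w y
  visited : ∀ p ∈ Vis, p ∈ S.queryWalks key v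
  order : VisitedBefore S key Vis l lo

theorem exploration_start (hpos : ∀ e, 0 < key e) : Exploration S key v ∅ [v] 0 where
  walk := trivial
  last := rfl
  low := fun w _ y _ hy => absurd hy (by simpa using (hpos _).ne')
  visited := by simp
  order := by simp [VisitedBefore]

variable {Vis : Finset (List ℕ)} {w lo : ℕ} {l : List ℕ}

/-- Extending the walk by the edge of smallest key that has not been treated gives a query walk that
has not been visited. -/
theorem Exploration.push (hpos : ∀ e, 0 < key e) (h : Exploration S key v Vis (w :: l) lo) {x : ℕ}
    (hx : S.adj w x) (hlo : lo < key (S.code w x))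
    (hhi : ∀ u ∈ l.head?, key (S.code w x) < key (S.code u w))
    (hmin : ∀ y, S.adj w y → key (S.code w y) < key (S.code w x) → key (S.code w y) ≤ lo) :
    x :: w :: l ∉ Vis ∧ Exploration S key v (insert (x :: w :: l) Vis) (x :: w :: l) 0 := by
  have hwalk : S.IsQueryWalk key (x :: w :: l) :=
    ⟨hx, hhi, fun y hy hlt => h.low w (by simp) y hy (hmin y hy hlt), h.walk⟩
  have hnot : ∀ p ∈ Vis, ¬ (x :: w :: l) <:+ p := fun p hp hs =>
    absurd (h.order.le p hp x hs) (by omega)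
  refine ⟨fun hm => hnot _ hm List.suffix_rfl, hwalk, ?_, ?_, ?_, ?_, ?_⟩
  · rw [List.getLast?_cons_cons]
    exact h.last
  · exact fun w _ y _ hy => absurd hy (by simpa using (hpos _).ne')
  · intro p hp
    rcases Finset.mem_insert.1 hp with rfl | hp
    · exact ⟨hwalk, by simp, by rw [List.getLast?_cons_cons]; exact h.last⟩
    · exact h.visited p hp
  · intro p hp y hy
    exfalso
    rcases Finset.mem_insert.1 hp with rfl | hp
    · have := hy.length_le
      simp at this
    · exact hnot p hp ((List.suffix_cons _ _).trans hy)
  · refine (h.order.mono hlo.le).insert (List.suffix_cons _ _) ?_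
    intro z hz y hy
    obtain rfl : w = z := by simpa using hz
    have := hy.eq_of_length (by simp)
    obtain rfl : y = x := by simpa using this
    exact le_rfl

theorem Exploration.not_selected (h : Exploration S key v Vis (w :: l) lo)
    (hfail : ∀ y, S.adj w y → (∀ u ∈ l.head?, key (S.code w y) < key (S.code u w)) →
      key (S.code w y) ≤ lo) {y : ℕ} (hy : S.adj w y)
    (hhi : ∀ u ∈ l.head?, key (S.code w y) < key (S.code u w)) : ¬ S.Selected key w y :=
  h.low w (by simp) y hy (hfail y hy hhi)

/-- If no edge is left to explore at the last vertex of the walk, then the last edge is selected. -/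
theorem Exploration.selected {u : ℕ} (h : Exploration S key v Vis (w :: u :: l) lo)
    (hfail : ∀ y, S.adj w y → key (S.code w y) < key (S.code u w) → key (S.code w y) ≤ lo) :
    S.adj u w ∧ S.Selected key u w := by
  refine ⟨h.walk.1, ?_⟩
  rw [Selected]
  refine fun y => ⟨fun hy hk => h.walk.2.2.1 y hy hk, fun hy hk => ?_⟩
  exact h.low w (by simp) y hy (hfail y hy hk)

/-- A selected last edge rules out the edge before it, so the exploration steps back by two. -/
theorem Exploration.pop (hkey : Set.InjOn key S.edgeCodes) {u t : ℕ}
    (h : Exploration S key v Vis (w :: u :: t :: l) lo)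
    (hfail : ∀ y, S.adj w y → key (S.code w y) < key (S.code u w) → key (S.code w y) ≤ lo) :
    Exploration S key v Vis (t :: l) (key (S.code t u)) := by
  obtain ⟨huw, hsel⟩ := h.selected hfail
  have hlt : key (S.code u w) < key (S.code t u) := h.walk.2.1 t (by simp)
  have htu : S.adj t u := h.walk.tail.1
  have hns : ¬ S.Selected key t u := fun hs =>
    (selected_comm.1 hs).not_left huw (by rwa [S.code_comm u t]) hsel
  refine ⟨h.walk.tail.tail, ?_, ?_, h.visited, h.order.2.2⟩
  · simpa [List.getLast?_cons_cons] using h.last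
  · intro z hz y hy hk
    obtain rfl : t = z := by simpa using hz
    rcases hk.lt_or_eq with hk | hk
    · exact h.walk.tail.2.2.1 y hy hk
    · have := S.code_inj hy htu (hkey (code_mem_edgeCodes hy) (code_mem_edgeCodes htu) hk)
      obtain rfl : y = u := by omega
      exact hns

/-- The vertex `v` is matched by the greedy matching. -/
def IsMatched (S : EdgeCode E) (key : E → ℕ) (v : ℕ) : Prop := ∃ y, S.adj v y ∧ S.Selected key v y

theorem Exploration.not_isMatched (h : Exploration S key v Vis [w] lo)
    (hfail : ∀ y, S.adj w y → key (S.code w y) ≤ lo) : ¬ S.IsMatched key v := by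
  obtain rfl : w = v := by simpa using h.last
  rintro ⟨y, hy, hs⟩
  exact h.not_selected (fun y hy _ => hfail y hy) hy (by simp) hs

theorem Exploration.isMatched {u : ℕ} (h : Exploration S key v Vis [w, u] lo)
    (hfail : ∀ y, S.adj w y → key (S.code w y) < key (S.code u w) → key (S.code w y) ≤ lo) :
    S.IsMatched key v := by
  obtain rfl : u = v := by simpa using h.last
  exact ⟨w, h.selected hfail⟩

theorem Exploration.card_le (h : Exploration S key v Vis l lo)
    (hfin : (S.queryWalks key v).Finite) : Vis.card ≤ (S.queryWalks key v).ncard := by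
  rw [← Set.ncard_coe_finset]
  exact Set.ncard_le_ncard (fun p hp => h.visited p hp) hfin

end EdgeCode

/-! ### A language with bounded loops -/

/-- Programs all of whose loops have a number of iterations that is known on entry. The loop
`rep c x d` runs `d` as often as the content of the variable `x` says, while `c` counts down. -/
inductive Stmt
  | skip
  | assign (x : ℕ) (e : Expr)
  | store (a : ℕ) (i e : Expr)
  | query (x : ℕ) (e f : Expr)
  | rand (x : ℕ) (e : Expr)
  | seq (c d : Stmt)
  | ite (e : Expr) (c d : Stmt)
  | rep (c x : ℕ) (d : Stmt)

/-- Sequential composition. -/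
infixr:60 ";;" => Stmt.seq

namespace Stmt

/-- Translation to a random-access machine program. -/
def compile : Stmt → Prog
  | skip => .skip
  | assign x e => .assign x e
  | store a i e => .store a i e
  | query x e f => .query x e f
  | rand x e => .rand x e
  | seq c d => .seq c.compile d.compile
  | ite e c d => .ite e c.compile d.compile
  | rep c x d => .seq (.assign c (.var x))
      (.loop (.var c) (.seq (.assign c (.bin .sub (.var c) (.lit 1))) d.compile))

/-- Run `g` with the counter `c` set to `k - 1`, …, `0`. -/
noncomputable def repeatSem (c : ℕ) (g : State → PMF State) : ℕ → State → PMF State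
  | 0, s => PMF.pure s
  | k + 1, s => (g (s.setVar c k)).bind (repeatSem c g k)

/-- Distribution of the final state. -/
noncomputable def sem (q : ℕ → ℕ → Bool) : Stmt → State → PMF State
  | skip, s => PMF.pure s
  | assign x e, s => PMF.pure (s.setVar x (e.eval s))
  | store a i e, s => PMF.pure (s.setCell a (i.eval s) (e.eval s))
  | query x e f, s => PMF.pure (s.setVar x (if q (e.eval s) (f.eval s) then 1 else 0))
  | rand x e, s =>
      (PMF.uniformOfFinset (Finset.range (e.eval s + 1)) Finset.nonempty_range_add_one).map
        fun v => s.setVar x v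
  | seq c d, s => (c.sem q s).bind (d.sem q)
  | ite e c d, s => if e.eval s ≠ 0 then c.sem q s else d.sem q s
  | rep c x d, s => repeatSem c (d.sem q) (s.var x) (s.setVar c (s.var x))

/-- The variable `x` is not written. -/
def Keeps (x : ℕ) : Stmt → Prop
  | skip => True
  | assign y _ => y ≠ x
  | store _ _ _ => True
  | query y _ _ => y ≠ x
  | rand y _ => y ≠ x
  | seq c d => c.Keeps x ∧ d.Keeps x
  | ite _ c d => c.Keeps x ∧ d.Keeps x
  | rep c _ d => c ≠ x ∧ d.Keeps x

/-- The array `a` is not written. -/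
def KeepsArr (a : ℕ) : Stmt → Prop
  | store b _ _ => b ≠ a
  | seq c d => c.KeepsArr a ∧ d.KeepsArr a
  | ite _ c d => c.KeepsArr a ∧ d.KeepsArr a
  | rep _ _ d => d.KeepsArr a
  | _ => True

/-- Every run that starts in `s` ends in a state with the property `Q`. -/
def Ensures (q : ℕ → ℕ → Bool) (P : Stmt) (s : State) (Q : State → Prop) : Prop :=
  ∀ s' ∈ (P.sem q s).support, Q s'

end Stmt

@[simp] theorem State.setVar_var (s : State) (x v y : ℕ) :
    (s.setVar x v).var y = if y = x then v else s.var y := by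
  simp [State.setVar, Function.update_apply]

@[simp] theorem State.setVar_arr (s : State) (x v : ℕ) : (s.setVar x v).arr = s.arr := rfl

@[simp] theorem State.setCell_var (s : State) (a i v : ℕ) : (s.setCell a i v).var = s.var := rfl

@[simp] theorem State.setCell_arr (s : State) (a i v b j : ℕ) :
    (s.setCell a i v).arr b j = if b = a ∧ j = i then v else s.arr b j := by
  by_cases hb : b = a
  · subst hb
    simp [State.setCell, Function.update_apply]
  · simp [State.setCell, hb]

namespace Stmt

variable {q : ℕ → ℕ → Bool} {s : State} {Q Q' : State → Prop} {c d : Stmt}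

theorem Ensures.mono (h : c.Ensures q s Q) (hQ : ∀ s', Q s' → Q' s') : c.Ensures q s Q' :=
  fun s' hs' => hQ s' (h s' hs')

@[simp] theorem ensures_skip : skip.Ensures q s Q ↔ Q s := by simp [Ensures, sem]

@[simp] theorem ensures_assign {x : ℕ} {e : Expr} :
    (assign x e).Ensures q s Q ↔ Q (s.setVar x (e.eval s)) := by simp [Ensures, sem]

@[simp] theorem ensures_store {a : ℕ} {i e : Expr} :
    (store a i e).Ensures q s Q ↔ Q (s.setCell a (i.eval s) (e.eval s)) := by simp [Ensures, sem]

@[simp] theorem ensures_query {x : ℕ} {e f : Expr} :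
    (query x e f).Ensures q s Q ↔
      Q (s.setVar x (if q (e.eval s) (f.eval s) then 1 else 0)) := by
  simp only [Ensures, sem, PMF.support_pure, Set.mem_singleton_iff, forall_eq]

@[simp] theorem ensures_rand {x : ℕ} {e : Expr} :
    (rand x e).Ensures q s Q ↔ ∀ v ≤ e.eval s, Q (s.setVar x v) := by
  simp [Ensures, sem]

@[simp] theorem ensures_seq :
    (seq c d).Ensures q s Q ↔ c.Ensures q s fun s' => d.Ensures q s' Q := by
  simp only [Ensures, sem, PMF.mem_support_bind_iff]
  constructor
  · exact fun h s' hs' s'' hs'' => h s'' ⟨s', hs', hs''⟩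
  · rintro h s'' ⟨s', hs', hs''⟩
    exact h s' hs' s'' hs''

@[simp] theorem ensures_ite {e : Expr} :
    (ite e c d).Ensures q s Q ↔ if e.eval s ≠ 0 then c.Ensures q s Q else d.Ensures q s Q := by
  by_cases h : e.eval s ≠ 0 <;> simp [Ensures, sem, h]

theorem ensures_repeatSem {c : ℕ} {g : State → PMF State} (J : ℕ → State → Prop) {k : ℕ}
    (hJ : ∀ i < k, ∀ s, J (i + 1) s → ∀ s' ∈ (g (s.setVar c i)).support, J i s') {s : State}
    (hs : J k s) : ∀ s' ∈ (repeatSem c g k s).support, J 0 s' := by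
  induction k generalizing s with
  | zero => simpa [repeatSem] using hs
  | succ k ih =>
    intro s' hs'
    rw [repeatSem, PMF.mem_support_bind_iff] at hs'
    obtain ⟨s₁, h₁, h₂⟩ := hs'
    exact ih (fun i hi => hJ i (by omega)) (hJ k (by omega) s hs s₁ h₁) s' h₂

/-- Loop rule; `J i` holds when `i` iterations are left. -/
theorem ensures_rep {x y : ℕ} (J : ℕ → State → Prop)
    (hJ : ∀ i < s.var y, ∀ s', J (i + 1) s' → d.Ensures q (s'.setVar x i) (J i))
    (hs : J (s.var y) (s.setVar x (s.var y))) (hQ : ∀ s', J 0 s' → Q s') :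
    (rep x y d).Ensures q s Q :=
  fun s' hs' => hQ s' (ensures_repeatSem J hJ hs s' hs')

theorem Keeps.ensures {x : ℕ} {P : Stmt} (h : P.Keeps x) (q : ℕ → ℕ → Bool) (s : State) :
    P.Ensures q s fun s' => s'.var x = s.var x := by
  induction P generalizing s with
  | skip => simp
  | assign y e => simp [Ne.symm (show y ≠ x from h)]
  | store a i e => simp
  | query y e f => simp [Ne.symm (show y ≠ x from h)]
  | rand y e => simp [Ne.symm (show y ≠ x from h)]
  | seq c d ihc ihd =>
    rw [ensures_seq]
    exact (ihc h.1 s).mono fun s' h' => (ihd h.2 s').mono fun s'' h'' => h''.trans h'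
  | ite e c d ihc ihd =>
    rw [ensures_ite]
    split
    · exact ihc h.1 s
    · exact ihd h.2 s
  | rep c y d ih =>
    have hc : x ≠ c := Ne.symm h.1
    refine ensures_rep (fun _ s' => s'.var x = s.var x) ?_ (by simp [hc]) fun _ h => h
    intro i _ s' hs'
    exact (ih h.2 _).mono fun s'' h'' => by rw [h'']; simp [hc, hs']

theorem KeepsArr.ensures {a : ℕ} {P : Stmt} (h : P.KeepsArr a) (q : ℕ → ℕ → Bool) (s : State) :
    P.Ensures q s fun s' => s'.arr a = s.arr a := by
  induction P generalizing s with
  | skip => simp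
  | assign y e => simp
  | store b i e =>
    rw [ensures_store]
    funext j
    simp [Ne.symm (show b ≠ a from h)]
  | query y e f => simp
  | rand y e => simp
  | seq c d ihc ihd =>
    rw [ensures_seq]
    exact (ihc h.1 s).mono fun s' h' => (ihd h.2 s').mono fun s'' h'' => h''.trans h'
  | ite e c d ihc ihd =>
    rw [ensures_ite]
    split
    · exact ihc h.1 s
    · exact ihd h.2 s
  | rep c y d ih =>
    refine ensures_rep (fun _ s' => s'.arr a = s.arr a) ?_ (by simp) fun _ h => h
    intro i _ s' hs'
    exact (ih h _).mono fun s'' h'' => by rw [h'']; simp [hs']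

end Stmt

/-! ### Bounded numbers and running time -/

/-- The variable that holds the largest number that may be stored. -/
@[simp] abbrev capVar : ℕ := 3

/-- The minimum of `e` and the cap. -/
def Expr.clamp (e : Expr) : Expr := .bin .sub e (.bin .sub e (.var capVar))

@[simp] theorem Expr.eval_clamp (s : State) (e : Expr) :
    e.clamp.eval s = min (e.eval s) (s.var capVar) := by
  simp only [clamp, Expr.eval, Op.eval]
  omega

/-- All numbers in the state are at most `cap`, which is stored in the variable `capVar`, and the
variables in the domain of `κ` have the values given by `κ`. -/
structure Within (cap : ℕ) (κ : ℕ → Option ℕ) (s : State) : Prop where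
  var_le : ∀ x, s.var x ≤ cap
  arr_le : ∀ a i, s.arr a i ≤ cap
  const : ∀ x k, κ x = some k → s.var x = k
  var_cap : s.var capVar = cap

/-- The literals in an expression are at most `cap`. -/
def Expr.LitsLe (cap : ℕ) : Expr → Prop
  | .lit c => c ≤ cap
  | .var _ => True
  | .cell _ i => i.LitsLe cap
  | .bin _ e f => e.LitsLe cap ∧ f.LitsLe cap

/-- A syntactic condition that keeps the value of an expression below the cap. -/
def Expr.Capped (cap : ℕ) : Expr → Prop
  | .lit c => c ≤ cap
  | .var _ => True
  | .cell _ i => i.LitsLe cap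
  | .bin .sub e f => (e.Capped cap ∨ f = .bin .sub e (.var capVar)) ∧ e.LitsLe cap ∧ f.LitsLe cap
  | .bin .div e f => e.Capped cap ∧ f.LitsLe cap
  | .bin .lt e f => e.LitsLe cap ∧ f.LitsLe cap ∧ 1 ≤ cap
  | .bin _ _ _ => False

@[simp] theorem Expr.capped_clamp {cap : ℕ} {e : Expr} : e.clamp.Capped cap ↔ e.LitsLe cap := by
  simp [clamp, Capped, LitsLe]

theorem Expr.Capped.litsLe {cap : ℕ} {e : Expr} (h : e.Capped cap) : e.LitsLe cap := by
  induction e with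
  | lit c => exact h
  | var x => trivial
  | cell a i => exact h
  | bin o e f ihe ihf =>
    cases o with
    | add => exact h.elim
    | sub => exact h.2
    | mul => exact h.elim
    | div => exact ⟨ihe h.1, h.2⟩
    | lt => exact ⟨h.1, h.2.1⟩

theorem Expr.Capped.eval_le {cap : ℕ} {κ : ℕ → Option ℕ} {e : Expr} (h : e.Capped cap) {s : State}
    (hs : Within cap κ s) : e.eval s ≤ cap := by
  induction e with
  | lit c => exact h
  | var x => exact hs.var_le x
  | cell a i => exact hs.arr_le _ _
  | bin o e f ihe ihf =>
    cases o with
    | add => exact h.elim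
    | sub =>
      rcases h.1 with h | rfl
      · exact (Nat.sub_le _ _).trans (ihe h)
      · change (clamp e).eval s ≤ cap
        rw [eval_clamp, hs.var_cap]
        exact min_le_right _ _
    | mul => exact h.elim
    | div => exact (Nat.div_le_self _ _).trans (ihe h.1)
    | lt =>
      have := h.2.2
      simp only [eval, Op.eval]
      split <;> omega

/-- The number of leaves of an expression that are evaluated by themselves. -/
def Expr.leaves : Expr → ℕ
  | .bin _ e f => e.leaves + f.leaves
  | _ => 1

/-- A bound for the time to evaluate an expression, in multiples of the largest bit length. -/
def Expr.weight : Expr → ℕ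
  | .lit _ => 1
  | .var _ => 1
  | .cell _ i => i.weight + 1
  | .bin _ e f => e.weight + f.weight + (e.leaves + f.leaves)

theorem Expr.one_le_leaves (e : Expr) : 1 ≤ e.leaves := by
  induction e with
  | bin o e f ihe ihf => simp only [leaves]; omega
  | _ => exact le_rfl

theorem Op.size_eval_le (o : Op) {a b A B : ℕ} (hA : 1 ≤ A) (hB : 1 ≤ B) (ha : a.size ≤ A)
    (hb : b.size ≤ B) : (o.eval a b).size ≤ A + B := by
  rw [Nat.size_le] at *
  have h2A : 2 ≤ 2 ^ A := by simpa using Nat.pow_le_pow_right (n := 2) (by norm_num) hA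
  have h2B : 2 ≤ 2 ^ B := by simpa using Nat.pow_le_pow_right (n := 2) (by norm_num) hB
  have hmul : 2 ^ (A + B) = 2 ^ A * 2 ^ B := pow_add _ _ _
  have hle : a < 2 ^ (A + B) := by rw [hmul]; nlinarith
  cases o with
  | add => simp only [Op.eval]; rw [hmul]; nlinarith
  | sub => exact (Nat.sub_le _ _).trans_lt hle
  | mul => simp only [Op.eval]; rw [hmul]; exact Nat.mul_lt_mul'' ha hb
  | div => exact (Nat.div_le_self _ _).trans_lt hle
  | lt => simp only [Op.eval]; rw [hmul]; split <;> nlinarith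

section Cost

variable {cap : ℕ} {κ : ℕ → Option ℕ} {s : State}

theorem Expr.size_eval_le (hcap : 1 ≤ cap) {e : Expr} (he : e.LitsLe cap) (hs : Within cap κ s) :
    (e.eval s).size ≤ e.leaves * cap.size := by
  have h1 : 1 ≤ cap.size := Nat.size_pos.2 hcap
  induction e with
  | lit c => simpa [leaves, eval] using Nat.size_le_size he
  | var x => simpa [leaves, eval] using Nat.size_le_size (hs.var_le x)
  | cell a i => simpa [leaves, eval] using Nat.size_le_size (hs.arr_le _ _)
  | bin o e f ihe ihf =>
    rw [leaves, add_mul]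
    exact o.size_eval_le (Nat.mul_pos e.one_le_leaves h1) (Nat.mul_pos f.one_le_leaves h1)
      (ihe he.1) (ihf he.2)

theorem Expr.cost_le (hcap : 1 ≤ cap) {e : Expr} (he : e.LitsLe cap) (hs : Within cap κ s) :
    e.cost s ≤ e.weight * (cap.size + 1) := by
  induction e with
  | lit c => simpa [cost, weight] using Nat.size_le_size he
  | var x => simpa [cost, weight] using Nat.size_le_size (hs.var_le x)
  | cell a i ih =>
    have := ih he
    have := Nat.size_le_size (hs.arr_le a (i.eval s))
    simp only [cost, weight]
    linarith
  | bin o e f ihe ihf =>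
    have h := size_eval_le hcap (e := .bin o e f) he hs
    have := ihe he.1
    have := ihf he.2
    have := e.one_le_leaves
    simp only [cost, weight, leaves, eval] at *
    nlinarith

end Cost

namespace Stmt

/-- A syntactic condition under which numbers stay below the cap, the variables in the domain of `κ`
are not written, and the numbers of iterations are given by `κ`. -/
def Safe (cap : ℕ) (κ : ℕ → Option ℕ) : Stmt → Prop
  | skip => True
  | assign x e => x ≠ capVar ∧ κ x = none ∧ e.Capped cap
  | store _ i e => i.LitsLe cap ∧ e.Capped cap
  | query x e f => x ≠ capVar ∧ κ x = none ∧ e.LitsLe cap ∧ f.LitsLe cap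
  | rand x e => x ≠ capVar ∧ κ x = none ∧ e.Capped cap
  | seq c d => c.Safe cap κ ∧ d.Safe cap κ
  | ite e c d => e.LitsLe cap ∧ c.Safe cap κ ∧ d.Safe cap κ
  | rep c x d => c ≠ capVar ∧ κ c = none ∧ (κ x).isSome ∧ d.Keeps c ∧ d.Safe cap κ

/-- A bound for the running time, in multiples of the largest bit length. -/
def time (κ : ℕ → Option ℕ) : Stmt → ℕ
  | skip => 1
  | assign _ e => e.weight + 1
  | store _ i e => i.weight + e.weight + 1
  | query _ e f => e.weight + f.weight + 1
  | rand _ e => e.weight + 1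
  | seq c d => c.time κ + d.time κ
  | ite e c d => e.weight + 1 + c.time κ + d.time κ
  | rep _ x d => 4 + (κ x).getD 0 * (7 + d.time κ)

variable {cap : ℕ} {κ : ℕ → Option ℕ} {q : ℕ → ℕ → Bool} {s : State}

theorem _root_.PairQuery.Within.setVar (hs : Within cap κ s) {x v : ℕ} (hx : x ≠ capVar)
    (hκ : κ x = none) (hv : v ≤ cap) : Within cap κ (s.setVar x v) where
  var_le := fun y => by
    rw [State.setVar_var]
    split
    · exact hv
    · exact hs.var_le y
  arr_le := hs.arr_le
  const := fun y k hk => by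
    rw [State.setVar_var, if_neg (by rintro rfl; simp [hκ] at hk)]
    exact hs.const y k hk
  var_cap := by rw [State.setVar_var, if_neg (Ne.symm hx), hs.var_cap]

theorem _root_.PairQuery.Within.setCell (hs : Within cap κ s) {a i v : ℕ} (hv : v ≤ cap) :
    Within cap κ (s.setCell a i v) where
  var_le := hs.var_le
  arr_le := fun b j => by
    rw [State.setCell_arr]
    split
    · exact hv
    · exact hs.arr_le b j
  const := hs.const
  var_cap := hs.var_cap

theorem Safe.ensures {P : Stmt} (h : P.Safe cap κ) (hcap : 1 ≤ cap) (hs : Within cap κ s) :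
    P.Ensures q s (Within cap κ) := by
  induction P generalizing s with
  | skip => simpa
  | assign x e => exact ensures_assign.2 (hs.setVar h.1 h.2.1 (h.2.2.eval_le hs))
  | store a i e => exact ensures_store.2 (hs.setCell (h.2.eval_le hs))
  | query x e f =>
    refine ensures_query.2 (hs.setVar h.1 h.2.1 ?_)
    split <;> omega
  | rand x e =>
    exact ensures_rand.2 fun v hv => hs.setVar h.1 h.2.1 (hv.trans (h.2.2.eval_le hs))
  | seq c d ihc ihd => exact ensures_seq.2 ((ihc h.1 hs).mono fun s' hs' => ihd h.2 hs')
  | ite e c d ihc ihd =>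
    rw [ensures_ite]
    split
    · exact ihc h.2.1 hs
    · exact ihd h.2.2 hs
  | rep c x d ih =>
    refine ensures_rep (fun _ => Within cap κ) ?_ (hs.setVar h.1 h.2.1 (hs.var_le x)) fun _ h => h
    intro i hi s' hs'
    exact ih h.2.2.2.2 (hs'.setVar h.1 h.2.1 (hi.le.trans (hs.var_le x)))

end Stmt

/-- The outcome distribution `μ` is that of runs that all end within time `T`, with `ν` the
distribution of the final state. -/
def Implements (μ : PMF Outcome) (ν : PMF State) (T : ℕ) : Prop :=
  μ.map (Option.map Prod.fst) = ν.map some ∧ ∀ r ∈ μ.support, ∃ s t, r = some (s, t) ∧ t ≤ T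

theorem implements_finish {t T : ℕ} (h : t ≤ T) (s : State) :
    Implements (finish t s) (PMF.pure s) T := by
  simp [Implements, finish, PMF.pure_map, h]

theorem Implements.mono {μ : PMF Outcome} {ν : PMF State} {T T' : ℕ} (h : Implements μ ν T)
    (hT : T ≤ T') : Implements μ ν T' :=
  ⟨h.1, fun r hr => let ⟨s, t, hst, ht⟩ := h.2 r hr; ⟨s, t, hst, ht.trans hT⟩⟩

theorem Implements.mem_support {μ : PMF Outcome} {ν : PMF State} {T : ℕ} (h : Implements μ ν T)
    {s : State} {t : ℕ} (hst : some (s, t) ∈ μ.support) : s ∈ ν.support := by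
  have : some s ∈ (μ.map (Option.map Prod.fst)).support :=
    (PMF.mem_support_map_iff _ _ _).2 ⟨_, hst, rfl⟩
  rw [h.1, PMF.mem_support_map_iff] at this
  obtain ⟨s', hs', he⟩ := this
  rwa [← Option.some.inj he]

theorem bind_congr_support {α β : Type*} {μ : PMF α} {f g : α → PMF β}
    (h : ∀ a ∈ μ.support, f a = g a) : μ.bind f = μ.bind g := by
  ext b
  simp only [PMF.bind_apply]
  refine tsum_congr fun a => ?_
  by_cases ha : a ∈ μ.support
  · rw [h a ha]
  · rw [(PMF.apply_eq_zero_iff _ _).2 ha, zero_mul, zero_mul]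

theorem Implements.andThen {μ : PMF Outcome} {ν : PMF State} {f : State → PMF Outcome}
    {g : State → PMF State} {T T' : ℕ} (h : Implements μ ν T)
    (h' : ∀ s ∈ ν.support, Implements (f s) (g s) T') :
    Implements (andThen μ f) (ν.bind g) (T + T') := by
  constructor
  · let H : Option State → PMF (Option State) := fun r => match r with
      | none => PMF.pure none
      | some s => (g s).map some
    have h1 : (PairQuery.andThen μ f).map (Option.map Prod.fst) =
        (μ.map (Option.map Prod.fst)).bind H := by
      rw [PairQuery.andThen, PMF.map_bind, PMF.bind_map]
      refine bind_congr_support fun r hr => ?_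
      obtain ⟨s, t, rfl, -⟩ := h.2 r hr
      simp only [PMF.map_comp, Function.comp, Option.map_some, H]
      rw [← (h' s (h.mem_support hr)).1]
      congr 1
      funext r
      cases r <;> rfl
    rw [h1, h.1, PMF.bind_map, PMF.map_bind]
    rfl
  · intro r hr
    rw [PairQuery.andThen, PMF.mem_support_bind_iff] at hr
    obtain ⟨r₁, hr₁, hr⟩ := hr
    obtain ⟨s, t, rfl, ht⟩ := h.2 r₁ hr₁
    simp only [PMF.mem_support_map_iff] at hr
    obtain ⟨r₂, hr₂, rfl⟩ := hr
    obtain ⟨s', t', rfl, ht'⟩ := (h' s (h.mem_support hr₁)).2 r₂ hr₂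
    exact ⟨s', t + t', rfl, by omega⟩

namespace Stmt

variable {cap : ℕ} {κ : ℕ → Option ℕ} {q : ℕ → ℕ → Bool} {s : State}

theorem implements_iterate (hcap : 1 ≤ cap) {c : ℕ} {d : Stmt} {T : ℕ} {g : State → PMF Outcome}
    (hc : c ≠ capVar) (hκ : κ c = none) (hkeep : d.Keeps c) (hsafe : d.Safe cap κ)
    (hd : ∀ s, Within cap κ s → Implements (g s) (d.sem q s) T) (k fuel : ℕ) (hk : k ≤ fuel)
    {s : State} (hs : Within cap κ s) (hsc : s.var c = k) :
    Implements (iterate (.var c)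
      (fun s₀ => andThen (finish (Expr.cost s₀ (.bin .sub (.var c) (.lit 1)) + 1)
        (s₀.setVar c (Expr.eval s₀ (.bin .sub (.var c) (.lit 1))))) g) fuel s)
      (repeatSem c (d.sem q) k s) (k * (7 * (cap.size + 1) + T) + 2 * (cap.size + 1)) := by
  have h1 : 1 ≤ cap.size := Nat.size_pos.2 hcap
  have hcost : Expr.cost s (.var c) + 1 ≤ 2 * (cap.size + 1) := by
    have := Expr.cost_le hcap (e := .var c) trivial hs
    simp only [Expr.weight] at this
    omega
  induction k generalizing s fuel with
  | zero =>
    have h0 : Expr.eval s (.var c) = 0 := hsc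
    cases fuel with
    | zero =>
      rw [iterate, if_pos h0, repeatSem]
      exact implements_finish (by omega) s
    | succ fuel =>
      rw [iterate, if_pos h0, repeatSem]
      exact implements_finish (by omega) s
  | succ k ih =>
    obtain ⟨fuel, rfl⟩ : ∃ m, fuel = m + 1 := ⟨fuel - 1, by omega⟩
    have h0 : Expr.eval s (.var c) ≠ 0 := by rw [Expr.eval, hsc]; omega
    have hle : k ≤ cap := by have := hs.var_le c; omega
    rw [iterate, if_neg h0, repeatSem]
    have hev : Expr.eval s (.bin .sub (.var c) (.lit 1)) = k := by
      simp [Expr.eval, Op.eval, hsc]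
    have hcost' : Expr.cost s (.bin .sub (.var c) (.lit 1)) + 1 ≤ 5 * (cap.size + 1) := by
      have := Expr.cost_le hcap (e := .bin .sub (.var c) (.lit 1)) ⟨trivial, hcap⟩ hs
      simp only [Expr.weight, Expr.leaves] at this
      omega
    have hstep : Implements (andThen (finish (Expr.cost s (.bin .sub (.var c) (.lit 1)) + 1)
        (s.setVar c (Expr.eval s (.bin .sub (.var c) (.lit 1))))) g)
        (d.sem q (s.setVar c k)) (5 * (cap.size + 1) + T) := by
      have := (implements_finish hcost' (s.setVar c k)).andThen (f := g) (g := d.sem q) (T' := T)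
        (by simpa using hd _ (hs.setVar hc hκ hle))
      rw [PMF.pure_bind] at this
      rw [hev]
      exact this
    have := (implements_finish hcost s).andThen
      (g := fun _ => (d.sem q (s.setVar c k)).bind (repeatSem c (d.sem q) k))
      (f := fun s₀ => andThen (andThen (finish
        (Expr.cost s₀ (.bin .sub (.var c) (.lit 1)) + 1)
        (s₀.setVar c (Expr.eval s₀ (.bin .sub (.var c) (.lit 1))))) g)
          fun s₁ => iterate (.var c) (fun s₀ => andThen (finish
            (Expr.cost s₀ (.bin .sub (.var c) (.lit 1)) + 1)
            (s₀.setVar c (Expr.eval s₀ (.bin .sub (.var c) (.lit 1))))) g) fuel s₁)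
      (T' := (5 * (cap.size + 1) + T) + (k * (7 * (cap.size + 1) + T) + 2 * (cap.size + 1))) (by
        simp only [PMF.support_pure, Set.mem_singleton_iff, forall_eq]
        refine hstep.andThen fun s₁ hs₁ => ?_
        have hw := hsafe.ensures hcap (hs.setVar hc hκ hle) s₁ hs₁
        refine ih fuel (by omega) hw ?_ ?_
        · rw [hkeep.ensures q _ s₁ hs₁]
          simp
        · have := Expr.cost_le hcap (e := .var c) trivial hw
          simp only [Expr.weight] at this
          omega)
    rw [PMF.pure_bind] at this
    exact this.mono (by ring_nf; omega)

/-- A safe program runs as its semantics says, within the time bound. -/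
theorem Safe.implements {P : Stmt} (h : P.Safe cap κ) (hcap : 1 ≤ cap) {fuel : ℕ}
    (hfuel : cap ≤ fuel) (hs : Within cap κ s) :
    Implements (P.compile.exec q fuel s) (P.sem q s) (P.time κ * (cap.size + 1)) := by
  induction P generalizing s with
  | skip => exact implements_finish (by simp [time]) s
  | assign x e =>
    refine implements_finish ?_ _
    have := e.cost_le hcap h.2.2.litsLe hs
    simp only [time]
    nlinarith
  | store a i e =>
    refine implements_finish ?_ _
    have := e.cost_le hcap h.2.litsLe hs
    have := i.cost_le hcap h.1 hs
    simp only [time]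
    nlinarith
  | query x e f =>
    refine implements_finish ?_ _
    have := e.cost_le hcap h.2.2.1 hs
    have := f.cost_le hcap h.2.2.2 hs
    simp only [time]
    nlinarith
  | rand x e =>
    have hc : e.cost s + 1 ≤ (e.weight + 1) * (cap.size + 1) := by
      have := e.cost_le hcap h.2.2.litsLe hs
      nlinarith
    constructor
    · simp only [compile, Prog.exec, sem, PMF.map_bind, finish, PMF.pure_map, PMF.map_comp]
      rfl
    · intro r hr
      simp only [compile, Prog.exec, PMF.mem_support_bind_iff, finish, PMF.support_pure,
        Set.mem_singleton_iff] at hr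
      obtain ⟨v, -, rfl⟩ := hr
      exact ⟨_, _, rfl, hc⟩
  | seq c d ihc ihd =>
    refine ((ihc h.1 hs).andThen fun s' hs' => ihd h.2 (h.1.ensures hcap hs s' hs')).mono ?_
    simp [time, add_mul]
  | ite e c d ihc ihd =>
    have hc : e.cost s + 1 ≤ (e.weight + 1) * (cap.size + 1) := by
      have := e.cost_le hcap h.1 hs
      nlinarith
    have := (implements_finish hc s).andThen
      (f := fun s₀ => if e.eval s₀ ≠ 0 then c.compile.exec q fuel s₀ else d.compile.exec q fuel s₀)
      (g := (Stmt.ite e c d).sem q) (T' := (c.time κ + d.time κ) * (cap.size + 1)) (by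
        simp only [PMF.support_pure, Set.mem_singleton_iff, forall_eq, sem]
        split
        · exact (ihc h.2.1 hs).mono (by nlinarith)
        · exact (ihd h.2.2 hs).mono (by nlinarith))
    rw [PMF.pure_bind] at this
    exact this.mono (by simp only [time]; nlinarith)
  | rep c x d ih =>
    obtain ⟨hc, hκ, hx, hkeep, hsafe⟩ := h
    obtain ⟨k, hk⟩ := Option.isSome_iff_exists.1 hx
    have hcost : Expr.cost s (.var x) + 1 ≤ 2 * (cap.size + 1) := by
      have := Expr.cost_le hcap (e := .var x) trivial hs
      simp only [Expr.weight] at this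
      omega
    have hxk := hs.const x k hk
    have := (implements_finish hcost (s.setVar c (s.var x))).andThen
      (f := fun s₁ => iterate (.var c) (fun s₀ => andThen (finish
            (Expr.cost s₀ (.bin .sub (.var c) (.lit 1)) + 1)
            (s₀.setVar c (Expr.eval s₀ (.bin .sub (.var c) (.lit 1)))))
              (d.compile.exec q fuel)) fuel s₁)
      (g := repeatSem c (d.sem q) (s.var x))
      (T' := s.var x * (7 * (cap.size + 1) + d.time κ * (cap.size + 1)) + 2 * (cap.size + 1)) (by
        simp only [PMF.support_pure, Set.mem_singleton_iff, forall_eq]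
        exact implements_iterate hcap hc hκ hkeep hsafe (fun s hs => ih hsafe hs) _ fuel
          ((hs.var_le x).trans hfuel) (hs.setVar hc hκ (hs.var_le x)) (by simp))
    rw [PMF.pure_bind] at this
    refine this.mono ?_
    simp only [time, hk, Option.getD_some, hxk]
    ring_nf
    omega

end Stmt

open scoped ENNReal

/-! ### Expectations -/

/-- The expectation of a function with values in `[0, ∞]`. -/
noncomputable def expect {α : Type*} (μ : PMF α) (g : α → ℝ≥0∞) : ℝ≥0∞ := ∑' a, μ a * g a

section Expect

variable {α β : Type*}

@[simp] theorem expect_pure (a : α) (g : α → ℝ≥0∞) : expect (PMF.pure a) g = g a := by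
  rw [expect, tsum_eq_single a fun b hb => by simp [PMF.pure_apply, hb]]
  simp

theorem expect_bind (μ : PMF α) (f : α → PMF β) (g : β → ℝ≥0∞) :
    expect (μ.bind f) g = expect μ fun a => expect (f a) g := by
  simp only [expect, PMF.bind_apply, ← ENNReal.tsum_mul_right, ← ENNReal.tsum_mul_left]
  rw [ENNReal.tsum_comm]
  simp only [mul_assoc]

theorem expect_map (μ : PMF α) (f : α → β) (g : β → ℝ≥0∞) :
    expect (μ.map f) g = expect μ (g ∘ f) := by
  rw [← PMF.bind_pure_comp, expect_bind]
  simp [Function.comp_def]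

theorem expect_mono {μ : PMF α} {g h : α → ℝ≥0∞} (hgh : ∀ a ∈ μ.support, g a ≤ h a) :
    expect μ g ≤ expect μ h := by
  refine ENNReal.tsum_le_tsum fun a => ?_
  by_cases ha : a ∈ μ.support
  · exact mul_le_mul_right (hgh a ha) _
  · rw [(PMF.apply_eq_zero_iff _ _).2 ha, zero_mul, zero_mul]

theorem expect_congr {μ : PMF α} {g h : α → ℝ≥0∞} (hgh : ∀ a ∈ μ.support, g a = h a) :
    expect μ g = expect μ h :=
  le_antisymm (expect_mono fun a ha => (hgh a ha).le) (expect_mono fun a ha => (hgh a ha).ge)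

@[simp] theorem expect_const (μ : PMF α) (c : ℝ≥0∞) : expect μ (fun _ => c) = c := by
  rw [expect, ENNReal.tsum_mul_right, PMF.tsum_coe, one_mul]

theorem expect_add (μ : PMF α) (g h : α → ℝ≥0∞) :
    expect μ (fun a => g a + h a) = expect μ g + expect μ h := by
  simp only [expect, mul_add, ENNReal.tsum_add]

theorem expect_const_mul (μ : PMF α) (c : ℝ≥0∞) (g : α → ℝ≥0∞) :
    expect μ (fun a => c * g a) = c * expect μ g := by
  simp only [expect, ← ENNReal.tsum_mul_left, mul_left_comm]

theorem expect_le_of_le {μ : PMF α} {g : α → ℝ≥0∞} {c : ℝ≥0∞} (h : ∀ a ∈ μ.support, g a ≤ c) :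
    expect μ g ≤ c :=
  (expect_mono h).trans (expect_const μ c).le

theorem expect_uniformOfFinset (t : Finset α) (ht : t.Nonempty) (g : α → ℝ≥0∞) :
    expect (PMF.uniformOfFinset t ht) g = (∑ a ∈ t, g a) / t.card := by
  rw [expect, tsum_eq_sum (s := t) fun a ha => by simp [PMF.uniformOfFinset_apply, ha],
    ENNReal.div_eq_inv_mul, Finset.mul_sum]
  exact Finset.sum_congr rfl fun a ha => by simp [PMF.uniformOfFinset_apply, ha]

theorem expect_uniformOfFintype [Fintype α] [Nonempty α] (g : α → ℝ≥0∞) :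
    expect (PMF.uniformOfFintype α) g = (∑ a, g a) / Fintype.card α := by
  rw [PMF.uniformOfFintype, expect_uniformOfFinset, Finset.card_univ]

theorem toOuterMeasure_eq_expect (μ : PMF α) (A : Set α) :
    μ.toOuterMeasure A = expect μ (A.indicator 1) := by
  rw [PMF.toOuterMeasure_apply, expect]
  refine tsum_congr fun a => ?_
  by_cases ha : a ∈ A <;> simp [ha]

open Classical in
/-- Equality of distributions can be tested on expectations. -/
theorem eq_of_expect_eq {μ ν : PMF α} (h : ∀ g, expect μ g = expect ν g) : μ = ν := by
  ext a
  have := h (Pi.single a 1)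
  rw [expect, expect, tsum_eq_single a fun b hb => by simp [Pi.single_eq_of_ne hb],
    tsum_eq_single a fun b hb => by simp [Pi.single_eq_of_ne hb]] at this
  simpa using this

end Expect

/-- Overwriting one entry of a uniformly random table by a fresh uniformly random value gives a
uniformly random table. -/
theorem uniform_update {J m : ℕ} (i : Fin J) :
    ((PMF.uniformOfFintype (Fin (m + 1))).bind fun v =>
      (PMF.uniformOfFintype (Fin J → Fin (m + 1))).map fun f => Function.update f i v) =
      PMF.uniformOfFintype (Fin J → Fin (m + 1)) := by
  refine eq_of_expect_eq fun g => ?_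
  -- exchanging the fresh value with the old entry is an involution
  let e : (Fin (m + 1)) × (Fin J → Fin (m + 1)) ≃ (Fin (m + 1)) × (Fin J → Fin (m + 1)) :=
    Function.Involutive.toPerm (fun p => (p.2 i, Function.update p.2 i p.1)) fun p => by
      simp
  have hsum : ∑ v, ∑ f : Fin J → Fin (m + 1), g (Function.update f i v) =
      (m + 1 : ℕ) * ∑ f, g f := by
    have he := Equiv.sum_comp e fun p => g p.2
    rw [Fintype.sum_prod_type, Fintype.sum_prod_type] at he
    exact he.trans (by simp)
  rw [expect_bind]
  simp only [expect_map, expect_uniformOfFintype, Function.comp_def, div_eq_mul_inv]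
  rw [← Finset.sum_mul, hsum, Fintype.card_fin, mul_right_comm, mul_comm ((m + 1 : ℕ) : ℝ≥0∞),
    mul_assoc (∑ f, g f), mul_right_comm, mul_assoc,
    ENNReal.mul_inv_cancel (by simp) (ENNReal.natCast_ne_top _), mul_one]

theorem uniformOfFinset_range (m : ℕ) :
    PMF.uniformOfFinset (Finset.range (m + 1)) Finset.nonempty_range_add_one =
      (PMF.uniformOfFintype (Fin (m + 1))).map Fin.val := by
  refine eq_of_expect_eq fun g => ?_
  rw [expect_map, expect_uniformOfFinset, expect_uniformOfFintype, Finset.sum_range]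
  simp

/-! ### Lazy sampling -/

/-- Fill the zero entries of the array `R` with indices below `J` from the table `f`, whose entries
are increased by one. -/
def fillTable (R : ℕ) {J m : ℕ} (f : Fin J → Fin (m + 1)) (s : State) : State where
  var := s.var
  arr := Function.update s.arr R fun i =>
    if s.arr R i = 0 then (if h : i < J then (f ⟨i, h⟩ : ℕ) + 1 else 0) else s.arr R i

@[simp] theorem fillTable_var (R : ℕ) {J m : ℕ} (f : Fin J → Fin (m + 1)) (s : State) :
    (fillTable R f s).var = s.var := rfl

theorem fillTable_arr_of_ne {R a : ℕ} (h : a ≠ R) {J m : ℕ} (f : Fin J → Fin (m + 1)) (s : State) :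
    (fillTable R f s).arr a = s.arr a := by
  simp [fillTable, h]

theorem fillTable_arr_self (R : ℕ) {J m : ℕ} (f : Fin J → Fin (m + 1)) (s : State) (i : ℕ) :
    (fillTable R f s).arr R i =
      if s.arr R i = 0 then (if h : i < J then (f ⟨i, h⟩ : ℕ) + 1 else 0) else s.arr R i := by
  simp [fillTable]

theorem fillTable_setVar (R : ℕ) {J m : ℕ} (f : Fin J → Fin (m + 1)) (s : State) (x v : ℕ) :
    fillTable R f (s.setVar x v) = (fillTable R f s).setVar x v := rfl

theorem fillTable_setCell {R a : ℕ} (h : a ≠ R) {J m : ℕ} (f : Fin J → Fin (m + 1)) (s : State)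
    (i v : ℕ) : fillTable R f (s.setCell a i v) = (fillTable R f s).setCell a i v := by
  simp only [fillTable, State.setCell, State.mk.injEq, true_and]
  rw [Function.update_comm h]
  simp [Function.update_of_ne (Ne.symm h), Function.update_of_ne h]

/-- All undrawn entries of the array `R` are drawn. -/
noncomputable def completion (R J m : ℕ) (s : State) : PMF State :=
  (PMF.uniformOfFintype (Fin J → Fin (m + 1))).map fun f => fillTable R f s

/-- The array `R` is not read. -/
def Expr.Avoids (R : ℕ) : Expr → Prop
  | .lit _ => True
  | .var _ => True
  | .cell a i => a ≠ R ∧ i.Avoids R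
  | .bin _ e f => e.Avoids R ∧ f.Avoids R

theorem Expr.Avoids.eval {R : ℕ} {e : Expr} (h : e.Avoids R) {J m : ℕ} (f : Fin J → Fin (m + 1))
    (s : State) : e.eval (fillTable R f s) = e.eval s := by
  induction e with
  | lit c => rfl
  | var x => rfl
  | cell a i ih => simp only [Expr.eval, ih h.2, fillTable_arr_of_ne h.1]
  | bin o e f ihe ihf => simp only [Expr.eval, ihe h.1, ihf h.2]

@[simp] theorem Expr.avoids_clamp {R : ℕ} {e : Expr} : e.clamp.Avoids R ↔ e.Avoids R := by
  simp [clamp, Avoids]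

namespace Stmt

/-- The array `R` is neither read nor written. -/
def Avoids (R : ℕ) : Stmt → Prop
  | skip => True
  | assign _ e => e.Avoids R
  | store a i e => a ≠ R ∧ i.Avoids R ∧ e.Avoids R
  | query _ e f => e.Avoids R ∧ f.Avoids R
  | rand _ e => e.Avoids R
  | seq c d => c.Avoids R ∧ d.Avoids R
  | ite e c d => e.Avoids R ∧ c.Avoids R ∧ d.Avoids R
  | rep _ _ d => d.Avoids R

variable {q : ℕ → ℕ → Bool} {R J m : ℕ}

theorem Avoids.sem_fillTable {P : Stmt} (h : P.Avoids R) (f : Fin J → Fin (m + 1)) (s : State) :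
    P.sem q (fillTable R f s) = (P.sem q s).map (fillTable R f) := by
  induction P generalizing s with
  | skip => simp [sem, PMF.pure_map]
  | assign x e => simp [sem, PMF.pure_map, Expr.Avoids.eval h, fillTable_setVar]
  | store a i e =>
    simp [sem, PMF.pure_map, Expr.Avoids.eval h.2.1, Expr.Avoids.eval h.2.2,
      fillTable_setCell h.1]
  | query x e g =>
    simp only [sem, PMF.pure_map, Expr.Avoids.eval h.1, Expr.Avoids.eval h.2, fillTable_setVar]
  | rand x e =>
    simp only [sem, Expr.Avoids.eval h, PMF.map_comp]
    rfl
  | seq c d ihc ihd =>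
    simp only [sem, ihc h.1, PMF.bind_map, PMF.map_bind, Function.comp_def, ihd h.2]
  | ite e c d ihc ihd =>
    simp only [sem, Expr.Avoids.eval h.1]
    split
    · exact ihc h.2.1 s
    · exact ihd h.2.2 s
  | rep c x d ih =>
    simp only [sem, fillTable_var, ← fillTable_setVar]
    generalize s.setVar c (s.var x) = s'
    induction s.var x generalizing s' with
    | zero => simp [repeatSem, PMF.pure_map]
    | succ k ihk =>
      simp only [repeatSem, ← fillTable_setVar, ih h, PMF.bind_map, PMF.map_bind,
        Function.comp_def, ihk]

/-- Drawing the undrawn entries of the array `R` after running `P` has the same effect as drawing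
them before. -/
def Commutes (q : ℕ → ℕ → Bool) (R J m : ℕ) (P : Stmt) (s : State) : Prop :=
  (P.sem q s).bind (completion R J m) = (completion R J m s).bind (P.sem q)

/-- A program that treats a table drawn in advance like undrawn entries commutes with drawing. -/
theorem commutes_of_sem_fillTable {P : Stmt} {s : State}
    (h : ∀ f : Fin J → Fin (m + 1), P.sem q (fillTable R f s) = (P.sem q s).map (fillTable R f)) :
    P.Commutes q R J m s := by
  have hc : completion R J m = fun s' =>
      (PMF.uniformOfFintype (Fin J → Fin (m + 1))).bind fun f => PMF.pure (fillTable R f s') :=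
    funext fun s' => (PMF.bind_pure_comp _ _).symm
  simp only [Commutes, hc, PMF.bind_bind, PMF.pure_bind, h]
  rw [PMF.bind_comm]
  simp only [← PMF.bind_pure_comp, Function.comp_def]

theorem Avoids.commutes {P : Stmt} (h : P.Avoids R) (s : State) : P.Commutes q R J m s :=
  commutes_of_sem_fillTable fun f => h.sem_fillTable f s

theorem commutes_seq {c d : Stmt} {s : State} (hc : c.Commutes q R J m s)
    (hd : c.Ensures q s fun s' => d.Commutes q R J m s') : (c;;d).Commutes q R J m s := by
  simp only [Commutes, sem, PMF.bind_bind] at *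
  rw [bind_congr_support hd, ← PMF.bind_bind, hc, PMF.bind_bind]

theorem commutes_ite {e : Expr} {c d : Stmt} {s : State} (he : e.Avoids R)
    (hc : e.eval s ≠ 0 → c.Commutes q R J m s) (hd : e.eval s = 0 → d.Commutes q R J m s) :
    (ite e c d).Commutes q R J m s := by
  by_cases h : e.eval s = 0
  · have := hd h
    simp only [Commutes, sem, completion, PMF.bind_map, Function.comp_def, he.eval, h] at *
    simpa using this
  · have := hc h
    simp only [Commutes, sem, completion, PMF.bind_map, Function.comp_def, he.eval] at *
    simpa [h] using this

theorem commutes_rep {cap : ℕ} {κ : ℕ → Option ℕ} (hcap : 1 ≤ cap) {c x : ℕ} {d : Stmt}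
    (hsafe : (rep c x d).Safe cap κ) (hd : ∀ s, Within cap κ s → d.Commutes q R J m s)
    {s : State} (hs : Within cap κ s) : (rep c x d).Commutes q R J m s := by
  have key : ∀ k ≤ cap, ∀ s, Within cap κ s →
      (repeatSem c (d.sem q) k s).bind (completion R J m) =
        (completion R J m s).bind (repeatSem c (d.sem q) k) := by
    intro k hk
    induction k with
    | zero =>
      intro s _
      rw [repeatSem, PMF.pure_bind]
      exact (PMF.bind_pure _).symm
    | succ k ih =>
      intro s hs
      have hs' := hs.setVar (v := k) hsafe.1 hsafe.2.1 (by omega)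
      rw [repeatSem, PMF.bind_bind, bind_congr_support fun s₁ hs₁ =>
        ih (by omega) s₁ (hsafe.2.2.2.2.ensures hcap hs' s₁ hs₁), ← PMF.bind_bind, hd _ hs',
        PMF.bind_bind]
      simp only [completion, PMF.bind_map, Function.comp_def, fillTable_setVar, repeatSem]
  have := key _ (hs.var_le x) _ (hs.setVar hsafe.1 hsafe.2.1 (hs.var_le x))
  simp only [Commutes, sem]
  rw [this]
  simp only [completion, PMF.bind_map, Function.comp_def, fillTable_setVar, fillTable_var]

/-- Put the entry of the array `R` whose index is in `ix` into `rk`; if this entry is zero, it is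
first drawn from `{1, …, m + 1}`, where `m` is in `mv`. The variable `t` is scratch. -/
def lookup (R ix mv t rk : ℕ) : Stmt :=
  ite (.cell R (.var ix)) skip
    (rand t (.var mv);; store R (.var ix) (.clamp (.bin .add (.var t) (.lit 1))));;
  assign t (.lit 0);;
  assign rk (.cell R (.var ix))

theorem lookup_commutes {cap : ℕ} {κ : ℕ → Option ℕ} {ix mv t rk : ℕ} (hit : ix ≠ t)
    (htc : t ≠ capVar) {s : State} (hs : Within cap κ s)
    (hJ : cap < J) (hm : s.var mv = m) (hmcap : m + 1 ≤ cap) :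
    (lookup R ix mv t rk).Commutes q R J m s := by
  have hixJ : s.var ix < J := (hs.var_le ix).trans_lt hJ
  by_cases h0 : s.arr R (s.var ix) = 0
  · set i : Fin J := ⟨s.var ix, hixJ⟩ with hi
    let G : (Fin J → Fin (m + 1)) → State := fun f =>
      ((fillTable R f s).setVar t 0).setVar rk (f i + 1)
    have hL : (lookup R ix mv t rk).sem q s =
        (PMF.uniformOfFintype (Fin (m + 1))).map fun v : Fin (m + 1) =>
          ((s.setCell R (s.var ix) (v + 1)).setVar t 0).setVar rk (v + 1) := by
      simp only [lookup, sem, Expr.eval, h0, ne_eq, not_true_eq_false, if_false, hm,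
        uniformOfFinset_range, PMF.bind_map, PMF.bind_bind, PMF.pure_bind, Function.comp_def,
        PMF.map_comp]
      rw [← PMF.bind_pure_comp]
      refine bind_congr_support fun v _ => ?_
      have hv : min ((v : ℕ) + 1) cap = v + 1 := by omega
      simp only [Function.comp, Expr.eval_clamp, Expr.eval, Op.eval, State.setVar_var, if_true,
        if_neg hit, Ne.symm htc, if_false, hs.var_cap, hv, State.setCell_var, State.setVar_arr,
        State.setCell_arr, and_self]
      congr 2
      simp only [State.setVar, State.setCell, Function.update_idem]
    have hR : ∀ f : Fin J → Fin (m + 1),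
        (lookup R ix mv t rk).sem q (fillTable R f s) = PMF.pure (G f) := by
      intro f
      simp only [lookup, sem, Expr.eval, fillTable_var, fillTable_arr_self, h0, if_true, hixJ,
        dif_pos, ne_eq, Nat.add_eq_zero_iff, one_ne_zero, and_false, not_false_eq_true,
        PMF.pure_bind, State.setVar_var, if_neg hit, State.setVar_arr, G, hi]
    have hF : ∀ (f : Fin J → Fin (m + 1)) (v : Fin (m + 1)),
        fillTable R f (((s.setCell R (s.var ix) (v + 1)).setVar t 0).setVar rk (v + 1)) =
          G (Function.update f i v) := by
      intro f v
      have : fillTable R f (s.setCell R (s.var ix) (v + 1)) =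
          fillTable R (Function.update f i v) s := by
        simp only [fillTable, State.setCell, State.mk.injEq, Function.update_idem, true_and,
          Function.update_self]
        congr 1
        funext j
        by_cases hj : j = s.var ix
        · subst hj
          simp [h0, hixJ, hi]
        · have hne : ∀ h : j < J, (⟨j, h⟩ : Fin J) ≠ i := fun h => by simp [hi, Fin.ext_iff, hj]
          simp only [Function.update_of_ne hj]
          split
          · split
            · rename_i h
              rw [Function.update_of_ne (hne h)]
            · rfl
          · rfl
      simp only [fillTable_setVar, this, G, Function.update_self]
    have hu := uniform_update (m := m) i
    rw [Commutes, hL]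
    simp only [completion, PMF.bind_map, Function.comp_def, hR, hF]
    conv_rhs => rw [← hu]
    rw [PMF.bind_bind]
    refine bind_congr_support fun v _ => ?_
    rw [PMF.bind_map, ← PMF.bind_pure_comp]
    rfl
  · have hF : ∀ f : Fin J → Fin (m + 1), (lookup R ix mv t rk).sem q (fillTable R f s) =
        ((lookup R ix mv t rk).sem q s).map (fillTable R f) := by
      intro f
      simp only [lookup, sem, Expr.eval, fillTable_var, fillTable_arr_self, h0, if_false, ne_eq,
        not_false_eq_true, if_true, PMF.pure_bind, State.setVar_var, if_neg hit,
        State.setVar_arr, PMF.pure_map, fillTable_setVar]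
    exact commutes_of_sem_fillTable hF

/-- Expectations of functions that do not depend on the array `R` may be computed with a table that
is drawn in advance. -/
theorem Commutes.expect_eq {P : Stmt} {s : State} (h : P.Commutes q R J m s) {g : State → ℝ≥0∞}
    (hg : ∀ (f : Fin J → Fin (m + 1)) s', g (fillTable R f s') = g s') :
    expect (P.sem q s) g =
      (∑ f : Fin J → Fin (m + 1), expect (P.sem q (fillTable R f s)) g) /
        Fintype.card (Fin J → Fin (m + 1)) := by
  have h1 : expect ((P.sem q s).bind (completion R J m)) g = expect (P.sem q s) g := by
    rw [expect_bind]
    refine expect_congr fun s' _ => ?_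
    rw [completion, expect_map]
    simp [Function.comp_def, hg]
  rw [← h1, h, expect_bind, completion, expect_map, expect_uniformOfFintype]
  rfl

end Stmt

/-! ### Matchings as subgraphs -/

section Matching

variable {V : Type*} {G : SimpleGraph V}

open SimpleGraph

theorem _root_.SimpleGraph.Subgraph.IsMatching.two_mul_ncard_edgeSet [Finite V] {M : G.Subgraph}
    (h : M.IsMatching) : 2 * M.edgeSet.ncard = M.verts.ncard := by
  classical
  have := Fintype.ofFinite V
  have h1 := M.spanningCoe.sum_degrees_eq_twice_card_edges
  have h2 : ∀ v, M.spanningCoe.degree v = if v ∈ M.verts then 1 else 0 := by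
    intro v
    rw [Subgraph.degree_spanningCoe]
    split
    · rename_i hv
      exact Subgraph.degree_eq_one_iff_existsUnique_adj.2 (h hv)
    · rename_i hv
      exact Subgraph.degree_of_notMem_verts hv
  simp only [h2] at h1
  rw [Finset.sum_boole] at h1
  rw [← M.edgeSet_spanningCoe, Set.ncard_eq_toFinset_card', Set.ncard_eq_toFinset_card']
  simp only [Nat.cast_id] at h1
  have h3 : M.verts.toFinset = Finset.univ.filter fun v => v ∈ M.verts := by ext; simp
  rw [h3, h1]
  rfl

/-- A matching is maximal if every edge has a matched endpoint. -/
theorem isMaximalMatching_of_forall_adj {M : G.Subgraph} (h : M.IsMatching)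
    (hcov : ∀ a b, G.Adj a b → a ∈ M.verts ∨ b ∈ M.verts) : IsMaximalMatching M := by
  refine ⟨h, fun M' hM' hle => ?_⟩
  have hadj : ∀ a b, M'.Adj a b → a ∈ M.verts → M.Adj a b := by
    intro a b hab ha
    obtain ⟨c, hc, -⟩ := h ha
    rwa [(hM' (hle.1 ha)).unique hab (hle.2 hc)]
  have hadj' : ∀ a b, M'.Adj a b → M.Adj a b := by
    intro a b hab
    rcases hcov a b hab.adj_sub with ha | hb
    · exact hadj a b hab ha
    · exact (hadj b a hab.symm hb).symm
  refine ⟨fun a ha => ?_, fun a b hab => hadj' a b hab⟩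
  obtain ⟨b, hb, -⟩ := hM' ha
  exact (hadj' a b hb).fst_mem

theorem exists_isMaximalMatching [Finite V] (G : SimpleGraph V) :
    ∃ M : G.Subgraph, IsMaximalMatching M := by
  obtain ⟨M, hM⟩ := (Set.toFinite {M : G.Subgraph | M.IsMatching}).exists_maximal
    ⟨⊥, fun v hv => by simp at hv⟩
  exact ⟨M, hM⟩

theorem _root_.SimpleGraph.Subgraph.IsMatching.two_mul_ncard_edgeSet_le {n : ℕ}
    {G : SimpleGraph (Fin n)} {M : G.Subgraph} (h : M.IsMatching) :
    2 * M.edgeSet.ncard ≤ n := by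
  rw [h.two_mul_ncard_edgeSet]
  exact (Set.ncard_le_ncard (Set.subset_univ _)).trans (by simp [Set.ncard_univ])

theorem _root_.SimpleGraph.Subgraph.IsMatching.sup_of_disjoint [Finite V] {M N : G.Subgraph}
    (hM : M.IsMatching) (hN : N.IsMatching) (hd : Disjoint M.verts N.verts) :
    (M ⊔ N).IsMatching ∧ (M ⊔ N).edgeSet.ncard = M.edgeSet.ncard + N.edgeSet.ncard := by
  refine ⟨hM.sup hN (by rwa [hM.support_eq_verts, hN.support_eq_verts]), ?_⟩
  rw [Subgraph.edgeSet_sup, Set.ncard_union_eq ?_ (Set.toFinite _) (Set.toFinite _)]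
  rw [Set.disjoint_left]
  intro e
  induction e with
  | h a b =>
    intro h1 h2
    exact Set.disjoint_left.1 hd (M.edge_vert h1) (N.edge_vert h2)

end Matching

open Stmt

/-! ### Greedy matching of chosen pairs -/

namespace Reg
/-! Names of the variables. The number of vertices is in variable `0`, the output in variable `1`,
and variable `3` is `capVar`. -/

@[simp] abbrev vertices : ℕ := 0
@[simp] abbrev size : ℕ := 1
@[simp] abbrev root : ℕ := 2
@[simp] abbrev samples : ℕ := 4
@[simp] abbrev budget : ℕ := 5
@[simp] abbrev maxRank : ℕ := 6
@[simp] abbrev outer : ℕ := 7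
@[simp] abbrev inner : ℕ := 8
@[simp] abbrev choice : ℕ := 9
@[simp] abbrev answer : ℕ := 10
@[simp] abbrev clock : ℕ := 11
@[simp] abbrev scanned : ℕ := 12
@[simp] abbrev top : ℕ := 13
@[simp] abbrev low : ℕ := 14
@[simp] abbrev high : ℕ := 15
@[simp] abbrev found : ℕ := 16
@[simp] abbrev best : ℕ := 17
@[simp] abbrev index : ℕ := 18
@[simp] abbrev scratch : ℕ := 19
@[simp] abbrev rank : ℕ := 20
@[simp] abbrev depth : ℕ := 21
@[simp] abbrev sample : ℕ := 22
@[simp] abbrev count : ℕ := 23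

end Reg

namespace Arr
/-! Names of the arrays. -/

@[simp] abbrev matched : ℕ := 0
@[simp] abbrev ranks : ℕ := 1
@[simp] abbrev starts : ℕ := 2
@[simp] abbrev walk : ℕ := 3
@[simp] abbrev high : ℕ := 4
@[simp] abbrev low : ℕ := 5

end Arr

/-- Match the vertices in the variables `x` and `y` if they are adjacent and both unmatched. -/
def tryMatch (x y : ℕ) : Stmt :=
  query Reg.answer (.var x) (.var y);;
  ite (.bin .lt (.bin .add (.cell Arr.matched (.var x)) (.cell Arr.matched (.var y)))
      (.var Reg.answer))
    (store Arr.matched (.var x) (.lit 1);;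
      store Arr.matched (.var y) (.lit 1);;
      assign Reg.size (.clamp (.bin .add (.var Reg.size) (.lit 1))))
    skip

/-- Greedy matching over all pairs. -/
def greedyAll : Stmt :=
  rep Reg.outer Reg.vertices (rep Reg.inner Reg.vertices (tryMatch Reg.outer Reg.inner))

/-- Greedy matching over random pairs: the same number of random partners is tried for each
vertex. -/
def greedyRandom : Stmt :=
  rep Reg.outer Reg.vertices (rep Reg.inner Reg.root
    (rand Reg.choice (.bin .sub (.var Reg.vertices) (.lit 1));;
      tryMatch Reg.outer Reg.choice))

/-- The effect of `tryMatch`. -/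
def matchState (q : ℕ → ℕ → Bool) (v u : ℕ) (s : State) : State :=
  let s₁ := s.setVar Reg.answer (if q v u then 1 else 0)
  if q v u = true ∧ s.arr Arr.matched v = 0 ∧ s.arr Arr.matched u = 0 then
    ((s₁.setCell Arr.matched v 1).setCell Arr.matched u 1).setVar Reg.size
      (min (s.var Reg.size + 1) (s.var capVar))
  else s₁

section Greedy

variable {q : ℕ → ℕ → Bool} {s : State}

theorem tryMatch_sem {x y : ℕ} (hx : x ≠ Reg.answer) (hy : y ≠ Reg.answer) :
    (tryMatch x y).sem q s = PMF.pure (matchState q (s.var x) (s.var y) s) := by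
  have hx' : ¬ x = 10 := hx
  have hy' : ¬ y = 10 := hy
  simp only [tryMatch, sem, PMF.pure_bind, Expr.eval, Op.eval, State.setVar_var, Reg.answer, hx',
    hy', if_false, if_true, State.setVar_arr, matchState, Expr.eval_clamp, State.setCell_var]
  by_cases hq : q (s.var x) (s.var y) = true
  · by_cases h : s.arr Arr.matched (s.var x) = 0 ∧ s.arr Arr.matched (s.var y) = 0
    · simp [hq, h.1, h.2]
    · have : ¬ (s.arr Arr.matched (s.var x) + s.arr Arr.matched (s.var y) < 1) := by omega
      simp only [Arr.matched] at this h
      simp [hq, h, this]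
  · simp [hq]

@[simp] theorem matchState_var {v u x : ℕ} (hx : x ≠ Reg.answer) (hx' : x ≠ Reg.size) :
    (matchState q v u s).var x = s.var x := by
  simp only [Reg.answer, Reg.size] at hx hx'
  simp only [matchState]
  split <;> simp [hx, hx']

theorem matchState_matched {v u i : ℕ} : (matchState q v u s).arr Arr.matched i =
    if (q v u = true ∧ s.arr Arr.matched v = 0 ∧ s.arr Arr.matched u = 0) ∧ (i = v ∨ i = u) then 1
    else s.arr Arr.matched i := by
  simp only [matchState]
  by_cases h : q v u = true ∧ s.arr Arr.matched v = 0 ∧ s.arr Arr.matched u = 0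
  · by_cases hv : i = v <;> by_cases hu : i = u <;> simp_all
  · simp only [h, if_false, false_and, State.setVar_arr]

theorem matchState_matched_ne_zero {v u i : ℕ} (h : s.arr Arr.matched i ≠ 0) :
    (matchState q v u s).arr Arr.matched i ≠ 0 := by
  rw [matchState_matched]
  split <;> omega

theorem matchState_covers {v u : ℕ} (h : q v u = true) :
    (matchState q v u s).arr Arr.matched v ≠ 0 ∨ (matchState q v u s).arr Arr.matched u ≠ 0 := by
  rw [matchState_matched, matchState_matched]
  by_cases h' : s.arr Arr.matched v = 0 ∧ s.arr Arr.matched u = 0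
  · simp only [Arr.matched] at h'
    simp [h, h']
  · simp only [h, h']
    simp only [true_and, false_and, if_false, ne_eq]
    omega

/-- The array of matched vertices and the variable `Reg.size` describe a matching. -/
def Represents {n : ℕ} (s : State) (G : SimpleGraph (Fin n)) : Prop :=
  ∃ M : G.Subgraph, M.IsMatching ∧ (∀ v : Fin n, v ∈ M.verts ↔ s.arr Arr.matched v ≠ 0) ∧
    s.var Reg.size = M.edgeSet.ncard

theorem pairOracle_eq_true {n : ℕ} {G : SimpleGraph (Fin n)} {u v : ℕ} :
    pairOracle G u v = true ↔ ∃ (hu : u < n) (hv : v < n), G.Adj ⟨u, hu⟩ ⟨v, hv⟩ := by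
  simp [pairOracle]

theorem pairOracle_comm {n : ℕ} {G : SimpleGraph (Fin n)} {u v : ℕ}
    (h : pairOracle G u v = true) : pairOracle G v u = true := by
  rw [pairOracle_eq_true] at *
  obtain ⟨hu, hv, h⟩ := h
  exact ⟨hv, hu, h.symm⟩

theorem Represents.matchState {n : ℕ} {G : SimpleGraph (Fin n)} {v u : ℕ} (h : Represents s G)
    (hcap : n ≤ s.var capVar) : Represents (matchState (pairOracle G) v u s) G := by
  obtain ⟨M, hM, hverts, hsize⟩ := h
  by_cases hc : pairOracle G v u = true ∧ s.arr Arr.matched v = 0 ∧ s.arr Arr.matched u = 0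
  · obtain ⟨hq, hv, hu⟩ := hc
    obtain ⟨hvn, hun, hadj⟩ := pairOracle_eq_true.1 hq
    have hdisj : Disjoint M.verts (G.subgraphOfAdj hadj).verts := by
      rw [Set.disjoint_left]
      intro w hw hw'
      rw [hverts] at hw
      simp only [SimpleGraph.subgraphOfAdj_verts, Set.mem_insert_iff,
        Set.mem_singleton_iff] at hw'
      rcases hw' with rfl | rfl
      · exact hw hv
      · exact hw hu
    obtain ⟨h1, h2⟩ := hM.sup_of_disjoint (SimpleGraph.Subgraph.IsMatching.subgraphOfAdj hadj) hdisj
    refine ⟨_, h1, ?_, ?_⟩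
    · intro w
      rw [matchState_matched]
      simp only [SimpleGraph.Subgraph.verts_sup, Set.mem_union, hverts,
        SimpleGraph.subgraphOfAdj_verts, Set.mem_insert_iff, Set.mem_singleton_iff, Fin.ext_iff]
      by_cases hw : (w : ℕ) = v ∨ (w : ℕ) = u
      · simp only [Arr.matched] at hv hu
        simp [hq, hv, hu, hw]
      · simp [hw]
    · have h3 := h1.two_mul_ncard_edgeSet_le
      rw [h2] at h3 ⊢
      simp only [Arr.matched] at hv hu
      simp only [Reg.size, capVar] at hsize hcap
      simp only [SimpleGraph.edgeSet_subgraphOfAdj, Set.ncard_singleton] at h3 ⊢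
      simp [PairQuery.matchState, hq, hv, hu, hsize]
      omega
  · refine ⟨M, hM, ?_, ?_⟩
    · intro w
      rw [matchState_matched, hverts]
      simp only [hc, false_and, if_false]
    · simp only [PairQuery.matchState, hc, if_false]
      simpa using hsize

/-- The pairs treated by `greedyAll` are all pairs, so the matching is maximal. -/
theorem greedyAll_ensures {n : ℕ} {G : SimpleGraph (Fin n)} (h : Represents s G)
    (hn : s.var Reg.vertices = n) (hcap : n ≤ s.var capVar) :
    greedyAll.Ensures (pairOracle G) s fun s' => Represents s' G ∧
      ∀ v u, pairOracle G v u = true →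
        s'.arr Arr.matched v ≠ 0 ∨ s'.arr Arr.matched u ≠ 0 := by
  refine ensures_rep (fun i s' => (Represents s' G ∧ n ≤ s'.var capVar ∧
      s'.var Reg.vertices = n) ∧ ∀ v u, i ≤ v → pairOracle G v u = true →
        s'.arr Arr.matched v ≠ 0 ∨ s'.arr Arr.matched u ≠ 0) ?_ ?_ ?_
  · rintro i hi s₁ ⟨⟨h1, h2, h3⟩, h4⟩
    refine ensures_rep (fun j s' => ((Represents s' G ∧ n ≤ s'.var capVar ∧
      s'.var Reg.vertices = n) ∧ s'.var Reg.outer = i) ∧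
        ∀ v u, (i + 1 ≤ v ∨ v = i ∧ j ≤ u) → pairOracle G v u = true →
        s'.arr Arr.matched v ≠ 0 ∨ s'.arr Arr.matched u ≠ 0) ?_ ?_ ?_
    · rintro j hj s₂ ⟨⟨⟨h5, h6, h7⟩, h8⟩, h9⟩
      rw [Ensures, tryMatch_sem (by simp) (by simp)]
      simp only [PMF.support_pure, Set.mem_singleton_iff, forall_eq]
      have e1 : (s₂.setVar Reg.inner j).var Reg.outer = i := by simpa using h8
      have e2 : (s₂.setVar Reg.inner j).var Reg.inner = j := by simp
      rw [e1, e2]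
      refine ⟨⟨⟨Represents.matchState ?_ (by simpa using h6), by simpa using h6,
        by simpa using h7⟩, by simpa using h8⟩, ?_⟩
      · obtain ⟨M, hM⟩ := h5
        exact ⟨M, by simpa using hM⟩
      · intro v u hvu hq
        by_cases hnew : v = i ∧ u = j
        · obtain ⟨rfl, rfl⟩ := hnew
          exact matchState_covers hq
        · exact (h9 v u (by omega) hq).imp
            (fun h => matchState_matched_ne_zero h) (fun h => matchState_matched_ne_zero h)
    · refine ⟨⟨⟨?_, by simpa using h2, by simpa using h3⟩, by simp⟩, ?_⟩
      · obtain ⟨M, hM⟩ := h1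
        exact ⟨M, by simpa using hM⟩
      · intro v u hvu hq
        rcases hvu with hvu | ⟨rfl, hvu⟩
        · exact h4 v u hvu hq
        · obtain ⟨-, hun, -⟩ := pairOracle_eq_true.1 hq
          simp at hvu h3
          omega
    · rintro s₂ ⟨⟨h5, -⟩, h6⟩
      refine ⟨h5, fun v u hvu hq => h6 v u (by omega) hq⟩
  · refine ⟨⟨?_, by simpa using hcap, by simpa using hn⟩, ?_⟩
    · obtain ⟨M, hM⟩ := h
      exact ⟨M, by simpa using hM⟩
    · intro v u hvu hq
      obtain ⟨hvn, -, -⟩ := pairOracle_eq_true.1 hq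
      omega
  · rintro s' ⟨⟨h1, -⟩, h2⟩
    exact ⟨h1, fun v u => h2 v u (Nat.zero_le _)⟩

theorem Represents.setVar {n : ℕ} {G : SimpleGraph (Fin n)} (h : Represents s G) {x v : ℕ}
    (hx : x ≠ Reg.size) : Represents (s.setVar x v) G := by
  obtain ⟨M, hM⟩ := h
  refine ⟨M, ?_⟩
  simpa [Ne.symm (show x ≠ 1 from hx)] using hM

theorem greedyRandom_ensures {n : ℕ} {G : SimpleGraph (Fin n)} (h : Represents s G)
    (hcap : n ≤ s.var capVar) :
    greedyRandom.Ensures (pairOracle G) s fun s' => Represents s' G := by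
  refine ensures_rep (fun i s' => Represents s' G ∧ n ≤ s'.var capVar) ?_ ?_ ?_
  · rintro i hi s₁ ⟨h1, h2⟩
    refine ensures_rep (fun j s' => Represents s' G ∧ n ≤ s'.var capVar) ?_ ?_ ?_
    · rintro j hj s₂ ⟨h3, h4⟩
      rw [ensures_seq, ensures_rand]
      intro v _
      rw [Ensures, tryMatch_sem (by simp) (by simp)]
      simp only [PMF.support_pure, Set.mem_singleton_iff, forall_eq]
      refine ⟨Represents.matchState ((h3.setVar (by simp)).setVar (by simp)) (by simpa using h4),
        by simpa using h4⟩
    · exact ⟨(h1.setVar (by simp)).setVar (by simp), by simpa using h2⟩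
    · exact fun _ h => h
  · exact ⟨h.setVar (by simp), by simpa using hcap⟩
  · exact fun _ h => h.1

end Greedy

/-! ### The residual graph of the random greedy matching is sparse -/

/-- A potential that does not increase on average in any iteration, `Φ i` being its form when `i`
iterations are left, bounds the expectation at the end. -/
theorem expect_repeatSem_le {c k : ℕ} {g : State → PMF State} (I : State → Prop)
    (Φ : ℕ → State → ℝ≥0∞)
    (hI : ∀ i < k, ∀ s, I s → ∀ s' ∈ (g (s.setVar c i)).support, I s')
    (hΦ : ∀ i < k, ∀ s, I s → expect (g (s.setVar c i)) (Φ i) ≤ Φ (i + 1) s) {s : State}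
    (hs : I s) : expect (repeatSem c g k s) (Φ 0) ≤ Φ k s := by
  induction k generalizing s with
  | zero => simp [repeatSem]
  | succ k ih =>
    rw [repeatSem, expect_bind]
    refine (expect_mono fun s' hs' => ?_).trans (hΦ k (by omega) s hs)
    exact ih (fun i hi => hI i (by omega)) (fun i hi => hΦ i (by omega))
      (hI k (by omega) s hs s' hs')

theorem expect_rand {q : ℕ → ℕ → Bool} {x : ℕ} {e : Expr} {s : State} {n : ℕ} (hn : 0 < n)
    (he : e.eval s = n - 1) (g : State → ℝ≥0∞) :
    expect ((rand x e).sem q s) g = (∑ v ∈ Finset.range n, g (s.setVar x v)) / n := by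
  have h : n - 1 + 1 = n := by omega
  simp only [sem, expect_map, expect_uniformOfFinset, he, h, Finset.card_range, Function.comp]

/-- The number of unmatched neighbours of a vertex. -/
def openNeighbors (q : ℕ → ℕ → Bool) (n : ℕ) (s : State) (v : ℕ) : ℕ :=
  ((Finset.range n).filter fun u => q v u = true ∧ s.arr Arr.matched u = 0).card

/-- The sum of the degrees of the vertices from `k` on in the graph induced by the unmatched
vertices. -/
def residualDegree (q : ℕ → ℕ → Bool) (n k : ℕ) (s : State) : ℕ :=
  ∑ v ∈ (Finset.range n).filter fun v => k ≤ v ∧ s.arr Arr.matched v = 0, openNeighbors q n s v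

section Residual

variable {q : ℕ → ℕ → Bool} {n r : ℕ}

theorem openNeighbors_congr {s s' : State} (h : s'.arr Arr.matched = s.arr Arr.matched) (v : ℕ) :
    openNeighbors q n s' v = openNeighbors q n s v := by
  simp [openNeighbors, h]

theorem openNeighbors_mono {s s' : State}
    (h : ∀ u, s'.arr Arr.matched u = 0 → s.arr Arr.matched u = 0) (v : ℕ) :
    openNeighbors q n s' v ≤ openNeighbors q n s v := by
  refine Finset.card_le_card fun u hu => ?_
  simp only [Finset.mem_filter] at *
  exact ⟨hu.1, hu.2.1, h u hu.2.2⟩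

/-- One random trial for the vertex in `Reg.outer`. -/
def trial : Stmt :=
  rand Reg.choice (.bin .sub (.var Reg.vertices) (.lit 1));; tryMatch Reg.outer Reg.choice

theorem trial_sem (s : State) : trial.sem q s =
    ((rand Reg.choice (.bin .sub (.var Reg.vertices) (.lit 1))).sem q s).map fun s' =>
      matchState q (s'.var Reg.outer) (s'.var Reg.choice) s' := by
  rw [← PMF.bind_pure_comp]
  exact congrArg (PMF.bind _) (funext fun s' => tryMatch_sem (by simp) (by simp))

/-- A vertex with `d` unmatched neighbours stays unmatched in a trial with probability at most
`1 - d / n`. -/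
theorem expect_trial_le (hn : 0 < n) {s : State} {v : ℕ} (hv : s.var Reg.outer = v)
    (hs : s.var Reg.vertices = n) (F : ℕ → ℝ≥0∞) :
    expect (trial.sem q s) (fun s' =>
        if s'.arr Arr.matched v = 0 then F (openNeighbors q n s' v) else 0) ≤
      if s.arr Arr.matched v = 0 then
        ((n - openNeighbors q n s v : ℕ) : ℝ≥0∞) / n * F (openNeighbors q n s v) else 0 := by
  rw [trial_sem, expect_map, expect_rand hn (by
    simp only [Reg.vertices] at hs
    simp [Expr.eval, Op.eval, hs])]
  simp only [Function.comp, State.setVar_var, Reg.outer, Reg.choice, if_true,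
    show ¬ (7 : ℕ) = 9 by decide, if_false]
  simp only [Reg.outer] at hv
  rw [hv]
  set s₁ : ℕ → State := fun u => s.setVar 9 u with hs₁
  have harr : ∀ u, (s₁ u).arr = s.arr := fun u => rfl
  have hterm : ∀ u, (if (matchState q v u (s₁ u)).arr 0 v = 0 then
      F (openNeighbors q n (matchState q v u (s₁ u)) v) else 0) ≤
      if s.arr 0 v = 0 ∧ ¬ (q v u = true ∧ s.arr Arr.matched u = 0) then
        F (openNeighbors q n s v) else 0 := by
    intro u
    have hm : ∀ i, (matchState q v u (s₁ u)).arr 0 i = _ := fun i =>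
      matchState_matched (q := q) (s := s₁ u) (v := v) (u := u) (i := i)
    by_cases hc : q v u = true ∧ s.arr Arr.matched v = 0 ∧ s.arr Arr.matched u = 0
    · have : (matchState q v u (s₁ u)).arr 0 v ≠ 0 := by
        rw [hm, if_pos ⟨by simpa [harr] using hc, Or.inl rfl⟩]
        exact one_ne_zero
      simp [this]
    · have : (matchState q v u (s₁ u)).arr Arr.matched = s.arr Arr.matched := by
        funext i
        refine (hm i).trans ?_
        rw [if_neg fun h => hc (by simpa [harr] using h.1), harr]
      rw [openNeighbors_congr this, show (matchState q v u (s₁ u)).arr 0 v = s.arr 0 v from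
        congrFun this v]
      by_cases h0 : s.arr 0 v = 0
      · have : ¬ (q v u = true ∧ s.arr Arr.matched u = 0) := fun h => hc ⟨h.1, h0, h.2⟩
        rw [if_pos h0, if_pos ⟨h0, this⟩]
      · simp [h0]
  refine (ENNReal.div_le_div_right (Finset.sum_le_sum fun u _ => hterm u) _).trans ?_
  by_cases h0 : s.arr 0 v = 0
  · simp only [h0, true_and, if_true]
    rw [← Finset.sum_filter, Finset.sum_const, Finset.filter_not, Finset.card_sdiff_of_subset
      (Finset.filter_subset _ _), Finset.card_range, nsmul_eq_mul, ENNReal.div_eq_inv_mul,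
      ENNReal.div_eq_inv_mul, mul_assoc]
    rfl
  · simp [h0]

/-- The probability that a vertex stays unmatched in all its trials. -/
theorem expect_trials_le (hn : 0 < n) {s : State} {v : ℕ} (hv : s.var Reg.outer = v)
    (hs : s.var Reg.vertices = n) (hr : s.var Reg.root = r) :
    expect ((rep Reg.inner Reg.root trial).sem q s)
      (fun s' => if s'.arr Arr.matched v = 0 then 1 else 0) ≤
      (((n - openNeighbors q n s v : ℕ) : ℝ≥0∞) / n) ^ r := by
  have := expect_repeatSem_le (c := Reg.inner) (k := r) (g := trial.sem q)
    (I := fun s => s.var Reg.outer = v ∧ s.var Reg.vertices = n)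
    (Φ := fun i s => if s.arr Arr.matched v = 0 then
      (((n - openNeighbors q n s v : ℕ) : ℝ≥0∞) / n) ^ i else 0) ?_ ?_
    (s := s.setVar Reg.inner r) ⟨by simpa using hv, by simpa using hs⟩
  · simp only [pow_zero] at this
    simp only [sem, hr]
    refine this.trans ?_
    split
    · exact le_rfl
    · exact zero_le
  · rintro i hi s ⟨h1, h2⟩
    have : (trial.Keeps 7) ∧ trial.Keeps 0 := by simp [trial, tryMatch, Keeps]
    intro s' hs'
    have e1 := this.1.ensures q _ s' hs'
    have e2 := this.2.ensures q _ s' hs'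
    simp only [Reg.outer, Reg.vertices] at h1 h2 ⊢
    rw [e1, e2]
    simp [h1, h2]
  · rintro i hi s ⟨h1, h2⟩
    refine (expect_trial_le (q := q) hn (s := s.setVar Reg.inner i) (v := v)
      (by simpa using h1) (by simpa using h2) fun d => (((n - d : ℕ) : ℝ≥0∞) / n) ^ i).trans ?_
    simp only [pow_succ']
    exact le_rfl

/-- Bernoulli's inequality in the form `(1 - x / n) ^ r ≤ 1 / (1 + r * x / n)`. -/
theorem sub_pow_mul_le (n x r : ℕ) : (n - x) ^ r * (n + r * x) ≤ n ^ (r + 1) := by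
  induction r with
  | zero => simp
  | succ r ih =>
    rcases le_total n x with h | h
    · simp [Nat.sub_eq_zero_of_le h]
    · obtain ⟨y, rfl⟩ := Nat.exists_eq_add_of_le h
      rw [Nat.add_sub_cancel_left] at *
      calc y ^ (r + 1) * (x + y + (r + 1) * x) = y ^ r * (y * (x + y + (r + 1) * x)) := by ring
        _ ≤ y ^ r * ((x + y + r * x) * (x + y)) := by
            refine Nat.mul_le_mul_left _ ?_
            nlinarith [Nat.zero_le (x * y), Nat.zero_le (r * x * x), Nat.zero_le (x * x)]
        _ ≤ (x + y) ^ (r + 1) * (x + y) := by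
            rw [← mul_assoc]
            exact Nat.mul_le_mul_right _ ih
        _ = (x + y) ^ (r + 1 + 1) := by ring

/-- A vertex with many unmatched neighbours is likely to be matched, and one with few of them does
not contribute much: with `r ≥ √n` trials the expected contribution is at most `r`. -/
theorem mul_pow_le (hn : 0 < n) (hr : n ≤ r * r) {x : ℕ} :
    (x : ℝ≥0∞) * (((n - x : ℕ) : ℝ≥0∞) / n) ^ r ≤ r := by
  have hr0 : 0 < r := by
    rcases Nat.eq_zero_or_pos r with rfl | h
    · omega
    · exact h
  have h1 : x * (n - x) ^ r ≤ r * n ^ r := by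
    have h2 := sub_pow_mul_le n x r
    have h3 : r * (x * (n - x) ^ r) ≤ r * (r * n ^ r) := by
      calc r * (x * (n - x) ^ r) ≤ (n - x) ^ r * (n + r * x) := by
            rw [mul_add]
            nlinarith [Nat.zero_le ((n - x) ^ r * n)]
        _ ≤ n ^ r * n := by rw [← pow_succ]; exact h2
        _ ≤ n ^ r * (r * r) := Nat.mul_le_mul_left _ hr
        _ = r * (r * n ^ r) := by ring
    exact Nat.le_of_mul_le_mul_left h3 hr0
  rw [ENNReal.div_eq_inv_mul, mul_pow, ← ENNReal.inv_pow, mul_left_comm, ← ENNReal.div_eq_inv_mul]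
  refine ENNReal.div_le_of_le_mul ?_
  exact_mod_cast h1

theorem trial_ensures_mono (s : State) : (rep Reg.inner Reg.root trial).Ensures q s fun s' =>
    ∀ u, s'.arr Arr.matched u = 0 → s.arr Arr.matched u = 0 := by
  refine ensures_rep (fun _ s' => ∀ u, s'.arr Arr.matched u = 0 → s.arr Arr.matched u = 0)
    ?_ (by simp) fun _ h => h
  intro i _ s₁ h₁ s₂ h₂ u hu
  rw [trial_sem, PMF.mem_support_map_iff] at h₂
  obtain ⟨s₃, h₃, rfl⟩ := h₂
  have : s₃.arr = s₁.arr := by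
    have h4 : (rand Reg.choice (.bin .sub (.var Reg.vertices) (.lit 1))).Ensures q
      (s₁.setVar Reg.inner i) fun s' => s'.arr = s₁.arr := by simp
    exact h4 s₃ h₃
  refine h₁ u ?_
  by_contra hne
  rw [← this] at hne
  exact matchState_matched_ne_zero hne hu

/-- The trials for one vertex leave on average at most `r` residual edges at this vertex. Residual
degrees of the other vertices can only decrease. -/
theorem expect_block_le (hn : 0 < n) (hr : n ≤ r * r) {s : State} {v : ℕ}
    (hs : s.var Reg.vertices = n) (hsr : s.var Reg.root = r) :
    expect ((rep Reg.inner Reg.root trial).sem q (s.setVar Reg.outer v))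
      (fun s' => (residualDegree q n v s' : ℝ≥0∞)) ≤ residualDegree q n (v + 1) s + r := by
  set s₁ := s.setVar Reg.outer v with hs₁
  set x := openNeighbors q n s v with hx
  have hx₁ : openNeighbors q n s₁ v = x := openNeighbors_congr rfl v
  have hpt : ∀ s' ∈ ((rep Reg.inner Reg.root trial).sem q s₁).support,
      (residualDegree q n v s' : ℝ≥0∞) ≤
        residualDegree q n (v + 1) s + x * if s'.arr Arr.matched v = 0 then 1 else 0 := by
    intro s' hs'
    have hmono : ∀ u, s'.arr Arr.matched u = 0 → s.arr Arr.matched u = 0 :=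
      trial_ensures_mono s₁ s' hs'
    have h1 : residualDegree q n v s' ≤
        residualDegree q n (v + 1) s' + x * if s'.arr Arr.matched v = 0 then 1 else 0 := by
      have hsub : ((Finset.range n).filter fun u => v ≤ u ∧ s'.arr Arr.matched u = 0) ⊆
          ((Finset.range n).filter fun u => v + 1 ≤ u ∧ s'.arr Arr.matched u = 0) ∪
            (if s'.arr Arr.matched v = 0 then {v} else ∅) := by
        intro u hu
        simp only [Finset.mem_filter, Finset.mem_union] at *
        by_cases huv : u = v
        · right
          rw [if_pos (huv ▸ hu.2.2)]
          simp [huv]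
        · left
          exact ⟨hu.1, by omega, hu.2.2⟩
      refine (Finset.sum_le_sum_of_subset hsub).trans ((Nat.le_add_right _ _).trans
        (Finset.sum_union_inter.le.trans ?_))
      refine Nat.add_le_add le_rfl ?_
      split
      · simpa using openNeighbors_mono hmono v
      · simp
    have h2 : residualDegree q n (v + 1) s' ≤ residualDegree q n (v + 1) s := by
      refine (Finset.sum_le_sum fun u _ => openNeighbors_mono hmono u).trans ?_
      refine Finset.sum_le_sum_of_subset fun u hu => ?_
      simp only [Finset.mem_filter] at *
      exact ⟨hu.1, hu.2.1, hmono u hu.2.2⟩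
    have h3 := h1.trans (Nat.add_le_add_right h2 _)
    split at h3 <;> rename_i h0
    · rw [if_pos h0]
      exact_mod_cast h3
    · rw [if_neg h0]
      simp only [mul_zero, add_zero] at h3 ⊢
      exact_mod_cast h3
  refine (expect_mono hpt).trans ?_
  rw [expect_add, expect_const, expect_const_mul]
  refine add_le_add le_rfl ?_
  have h4 := expect_trials_le (q := q) (r := r) hn (s := s₁) (v := v) (by simp [hs₁])
    (by simpa [hs₁] using hs) (by simpa [hs₁] using hsr)
  rw [hx₁] at h4
  exact (mul_le_mul_right h4 _).trans (mul_pow_le hn hr)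

/-- The graph that `greedyRandom` leaves on the unmatched vertices has expected degree sum at most
`n * r`. -/
theorem expect_residualDegree_le (hn : 0 < n) (hr : n ≤ r * r) {s : State}
    (hs : s.var Reg.vertices = n) (hsr : s.var Reg.root = r) :
    expect (greedyRandom.sem q s) (fun s' => (residualDegree q n 0 s' : ℝ≥0∞)) ≤ n * r := by
  have hkeep : (rep Reg.inner Reg.root trial).Keeps 0 ∧ (rep Reg.inner Reg.root trial).Keeps 2 := by
    simp [trial, tryMatch, Keeps]
  have := expect_repeatSem_le (c := Reg.outer) (k := n)
    (g := (rep Reg.inner Reg.root trial).sem q)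
    (I := fun s => s.var Reg.vertices = n ∧ s.var Reg.root = r)
    (Φ := fun i s => (residualDegree q n i s : ℝ≥0∞) + i * r) ?_ ?_
    (s := s.setVar Reg.outer n) ⟨by simpa using hs, by simpa using hsr⟩
  · have h0 : residualDegree q n n (s.setVar Reg.outer n) = 0 := by
      refine Finset.sum_eq_zero fun v hv => ?_
      simp only [Finset.mem_filter, Finset.mem_range] at hv
      omega
    rw [h0] at this
    simp only [Nat.cast_zero, zero_mul, add_zero, zero_add] at this
    have hsem : greedyRandom.sem q s = repeatSem Reg.outer
        ((rep Reg.inner Reg.root trial).sem q) n (s.setVar Reg.outer n) := by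
      rw [← hs]; rfl
    rw [hsem]
    exact this
  · rintro i hi s ⟨h1, h2⟩ s' hs'
    have e1 := hkeep.1.ensures q _ s' hs'
    have e2 := hkeep.2.ensures q _ s' hs'
    simp only [Reg.vertices, Reg.root] at *
    rw [e1, e2]
    simp [h1, h2]
  · rintro i - s ⟨h1, h2⟩
    rw [expect_add, expect_const]
    refine (add_le_add_left (expect_block_le hn hr h1 h2) _).trans ?_
    push_cast
    rw [add_mul, one_mul, add_comm ((i : ℝ≥0∞) * r), add_assoc]

end Residual

/-! ### Local exploration of the residual graph -/

/-- Among the edges from the vertex in `Reg.top` to unmatched vertices, find the one of smallest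
rank above the content of `Reg.low` and below the content of `Reg.high`. -/
def scan : Stmt :=
  rep Reg.scanned Reg.vertices
    (query Reg.answer (.var Reg.top) (.var Reg.scanned);;
    ite (.bin .lt (.bin .add (.cell Arr.matched (.var Reg.top))
        (.cell Arr.matched (.var Reg.scanned))) (.var Reg.answer))
      (assign Reg.index (.clamp (.bin .add
        (.bin .mul (.bin .sub (.var Reg.top) (.bin .sub (.var Reg.top) (.var Reg.scanned)))
          (.var Reg.vertices))
        (.bin .add (.var Reg.scanned) (.bin .sub (.var Reg.top) (.var Reg.scanned)))));;
      lookup Arr.ranks Reg.index Reg.maxRank Reg.scratch Reg.rank;;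
      ite (.bin .lt (.var Reg.low) (.var Reg.rank))
        (ite (.bin .lt (.var Reg.rank) (.var Reg.high))
          (assign Reg.high (.var Reg.rank);;
            assign Reg.best (.var Reg.scanned);;
            assign Reg.found (.lit 1))
          skip)
        skip)
      skip)

/-- Load the last vertex of the current walk. -/
def loadTop : Stmt :=
  assign Reg.top (.cell Arr.walk (.var Reg.depth));;
  assign Reg.low (.cell Arr.low (.var Reg.depth));;
  assign Reg.high (.cell Arr.high (.var Reg.depth));;
  assign Reg.found (.lit 0)

/-- Extend the walk by the edge that has been found. -/
def pushWalk : Stmt :=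
  store Arr.low (.var Reg.depth) (.var Reg.high);;
  assign Reg.depth (.clamp (.bin .add (.var Reg.depth) (.lit 1)));;
  store Arr.walk (.var Reg.depth) (.var Reg.best);;
  store Arr.high (.var Reg.depth) (.var Reg.high);;
  store Arr.low (.var Reg.depth) (.lit 0)

/-- Record the result of an exploration and start the next one. -/
def nextSample : Stmt :=
  ite (.bin .lt (.var Reg.sample) (.var Reg.samples))
    (assign Reg.count (.clamp (.bin .add (.var Reg.count) (.var Reg.depth)))) skip;;
  assign Reg.sample (.clamp (.bin .add (.var Reg.sample) (.lit 1)));;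
  store Arr.walk (.lit 0) (.cell Arr.starts (.var Reg.sample));;
  store Arr.low (.lit 0) (.lit 0);;
  assign Reg.depth (.lit 0)

/-- One step of the exploration. If no edge is left at the last vertex of the walk, then the last
edge is selected; this finishes an exploration at depth `0` or `1`, the depth being the result, and
takes the walk back by two edges otherwise. -/
def exploreStep : Stmt :=
  loadTop;; scan;;
  ite (.var Reg.found) pushWalk
    (ite (.bin .lt (.var Reg.depth) (.lit 2)) nextSample
      (assign Reg.depth (.bin .sub (.var Reg.depth) (.lit 2))))

/-- Prepare the first exploration. -/
def initExplore : Stmt :=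
  store Arr.walk (.lit 0) (.cell Arr.starts (.lit 0));;
  store Arr.high (.lit 0) (.clamp (.bin .add (.var Reg.maxRank) (.lit 2)));;
  store Arr.low (.lit 0) (.lit 0);;
  assign Reg.depth (.lit 0);;
  assign Reg.sample (.lit 0);;
  assign Reg.count (.lit 0)

/-- Count the sampled vertices that are matched by the greedy matching of the residual graph. -/
def explore : Stmt := initExplore;; rep Reg.clock Reg.budget exploreStep

/-- What is needed of the answers to pair queries. -/
structure IsOracle (q : ℕ → ℕ → Bool) (n : ℕ) : Prop where
  symm : ∀ {u v}, q u v = true → q v u = true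
  lt : ∀ {u v}, q u v = true → u < n

/-- The graph on the vertices that are not marked in `A`. The code of an edge is its index in the
array of ranks. -/
def residualGraph {q : ℕ → ℕ → Bool} {n cap : ℕ} (A : ℕ → ℕ) (hq : IsOracle q n)
    (hcap : n * n ≤ cap) : EdgeCode (Fin (cap + 1)) where
  adj a b := q a b = true ∧ A a = 0 ∧ A b = 0
  code a b := ⟨min (min a b * n + max a b) cap, by omega⟩
  symm h := ⟨hq.symm h.1, h.2.2, h.2.1⟩
  code_comm a b := by simp [min_comm, max_comm]
  code_inj := by
    intro a b c d h h' he
    have ha := hq.lt h.1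
    have hb := hq.lt (hq.symm h.1)
    have hc := hq.lt h'.1
    have hd := hq.lt (hq.symm h'.1)
    have bound : ∀ x y, x < n → y < n → min x y * n + max x y < n * n := by
      intro x y hx hy
      have h1 : min x y + 1 ≤ n := by omega
      have h2 : max x y < n := by omega
      nlinarith
    have h1 := bound a b ha hb
    have h2 := bound c d hc hd
    rw [Fin.mk.injEq, min_eq_left (h1.le.trans hcap), min_eq_left (h2.le.trans hcap)] at he
    have hn : 0 < n := by omega
    have h3 : max a b < n := by omega
    have h4 : max c d < n := by omega
    have hdiv := congrArg (· / n) he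
    have hmod := congrArg (· % n) he
    simp only [Nat.mul_add_mod_of_lt h3, Nat.mul_add_mod_of_lt h4] at hmod
    simp only [mul_comm _ n, Nat.mul_add_div hn, Nat.div_eq_of_lt h3, Nat.div_eq_of_lt h4,
      add_zero] at hdiv
    omega

section Explore

variable {q : ℕ → ℕ → Bool} {n cap m N : ℕ} {A V : ℕ → ℕ} {s : State}

/-- The part of the state that the exploration only reads, with all ranks drawn. -/
structure Fixed (n cap m N : ℕ) (A V : ℕ → ℕ) (f : Fin (cap + 1) → Fin (m + 1)) (s : State) :
    Prop where
  vertices : s.var Reg.vertices = n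
  capVar_eq : s.var capVar = cap
  samples : s.var Reg.samples = N
  maxRank : s.var Reg.maxRank = m
  matched : s.arr Arr.matched = A
  starts : s.arr Arr.starts = V
  ranks : ∀ e : Fin (cap + 1), s.arr Arr.ranks e = EdgeCode.tableKey f e

variable {f : Fin (cap + 1) → Fin (m + 1)}

theorem Fixed.setVar (h : Fixed n cap m N A V f s) {x v : ℕ} (h0 : x ≠ 0) (h3 : x ≠ 3)
    (h4 : x ≠ 4) (h6 : x ≠ 6) : Fixed n cap m N A V f (s.setVar x v) := by
  obtain ⟨h1, h2, h3, h4, h5, h6, h7⟩ := h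
  constructor <;> simp_all [Ne.symm]

theorem Fixed.setCell (h : Fixed n cap m N A V f s) {a i v : ℕ} (ha : 3 ≤ a) :
    Fixed n cap m N A V f (s.setCell a i v) := by
  obtain ⟨h1, h2, h3, h4, h5, h6, h7⟩ := h
  refine ⟨h1, h2, h3, h4, ?_, ?_, ?_⟩
  · rw [← h5]; funext j; simp; omega
  · rw [← h6]; funext j; simp; omega
  · intro e; rw [← h7]; simp; omega

theorem lookup_ensures {R ix mv t rk : ℕ} {Q : State → Prop} (hit : ix ≠ t)
    (h : s.arr R (s.var ix) ≠ 0) : (lookup R ix mv t rk).Ensures q s Q ↔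
      Q ((s.setVar t 0).setVar rk (s.arr R (s.var ix))) := by
  simp [lookup, Expr.eval, h, hit]

variable (hq : IsOracle q n) (hcap : n * n ≤ cap)

/-- The loop invariant of `scan`, with the vertices from `i` on already scanned. -/
structure ScanInv (f : Fin (cap + 1) → Fin (m + 1)) (N : ℕ) (A V : ℕ → ℕ) (s₀ : State) (hi₀ i : ℕ)
    (s : State) : Prop where
  fixed : Fixed n cap m N A V f s
  arr : s.arr = s₀.arr
  vars : ∀ x ∈ [Reg.top, Reg.low, Reg.depth, Reg.sample, Reg.count], s.var x = s₀.var x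
  le : ∀ y, i ≤ y → (residualGraph A hq hcap).adj (s.var Reg.top) y →
    s.var Reg.low < EdgeCode.tableKey f ((residualGraph A hq hcap).code (s.var Reg.top) y) →
    s.var Reg.high ≤ EdgeCode.tableKey f ((residualGraph A hq hcap).code (s.var Reg.top) y)
  none : s.var Reg.found = 0 → s.var Reg.high = hi₀
  some : s.var Reg.found ≠ 0 →
    (residualGraph A hq hcap).adj (s.var Reg.top) (s.var Reg.best) ∧
    s.var Reg.high =
      EdgeCode.tableKey f ((residualGraph A hq hcap).code (s.var Reg.top) (s.var Reg.best)) ∧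
    s.var Reg.low < s.var Reg.high ∧ s.var Reg.high < hi₀
  high_le : s.var Reg.high ≤ hi₀

theorem scan_ensures (hs : Fixed n cap m N A V f s) (hfound : s.var Reg.found = 0) :
    scan.Ensures q s (ScanInv hq hcap f N A V s (s.var Reg.high) 0) := by
  refine ensures_rep (ScanInv hq hcap f N A V s (s.var Reg.high)) ?_ ?_ fun _ h => h
  · intro i hi s₁ h₁
    have hn : i < n := by rw [← hs.vertices]; exact hi
    obtain ⟨hfix, harr, hvars, hle, hnone, hsome, hhigh⟩ := h₁
    simp only [Reg.top, Reg.low, Reg.depth, Reg.sample, Reg.count, List.mem_cons, forall_eq_or_imp,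
      List.not_mem_nil, false_imp_iff, implies_true, and_true] at hvars
    have hcapv : s₁.var 3 = cap := hfix.capVar_eq
    have hA : s₁.arr 0 = A := hfix.matched
    have hnv : s₁.var 0 = n := hfix.vertices
    set w := s₁.var 13 with hw
    have hadj : (residualGraph A hq hcap).adj w i ↔ q w i = true ∧ A w = 0 ∧ A i = 0 := Iff.rfl
    set e := (residualGraph A hq hcap).code w i with he
    have hidx : min ((w - (w - i)) * n + (i + (w - i))) cap = (e : ℕ) := by
      change _ = min (min w i * n + max w i) cap
      have h1 : w - (w - i) = min w i := by omega
      have h2 : i + (w - i) = max w i := by omega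
      rw [h1, h2]
    have hR : s₁.arr 1 e = EdgeCode.tableKey f e := hfix.ranks e
    have hpos : EdgeCode.tableKey f e ≠ 0 := by simp [EdgeCode.tableKey]
    -- the state after an iteration in which `i` is not chosen
    have hskip : ∀ s₂ : State, s₂.arr = s₁.arr → (∀ x, x ∉ [10, 12, 18, 19, 20] →
        s₂.var x = s₁.var x) →
        ((residualGraph A hq hcap).adj w i → s₁.var 14 < EdgeCode.tableKey f e →
          s₁.var 15 ≤ EdgeCode.tableKey f e) →
        ScanInv hq hcap f N A V s (s.var Reg.high) i s₂ := by
      intro s₂ h1 h2 h3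
      have v0 := h2 0 (by simp)
      have v3 := h2 3 (by simp)
      have v4 := h2 4 (by simp)
      have v6 := h2 6 (by simp)
      have v13 := h2 13 (by simp)
      have v14 := h2 14 (by simp)
      have v15 := h2 15 (by simp)
      have v16 := h2 16 (by simp)
      have v17 := h2 17 (by simp)
      have v21 := h2 21 (by simp)
      have v22 := h2 22 (by simp)
      have v23 := h2 23 (by simp)
      refine ⟨⟨v0.trans hfix.vertices, v3.trans hfix.capVar_eq, v4.trans hfix.samples,
        v6.trans hfix.maxRank, by rw [h1]; exact hfix.matched, by rw [h1]; exact hfix.starts,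
        by rw [h1]; exact hfix.ranks⟩, h1.trans harr, ?_, ?_, ?_, ?_, ?_⟩
      · simp only [Reg.top, Reg.low, Reg.depth, Reg.sample, Reg.count, List.mem_cons,
          forall_eq_or_imp, List.not_mem_nil, false_imp_iff, implies_true, and_true, v13, v14, v21,
          v22, v23]
        exact hvars
      · intro y hy
        simp only [Reg.top, Reg.low, Reg.high, v13, v14, v15]
        rcases hy.eq_or_lt with rfl | hy
        · exact h3
        · exact hle y hy
      · simp only [Reg.found, v16] at *
        simp only [v15]
        exact hnone
      · simp only [Reg.found, Reg.best, Reg.high, Reg.low, Reg.top, v13, v14, v15, v16, v17] at *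
        exact hsome
      · simp only [Reg.high, v15] at *
        exact hhigh
    simp only [ensures_seq, ensures_query, ensures_ite, ensures_assign, ensures_skip, Expr.eval,
      Op.eval, State.setVar_var, State.setVar_arr, Reg.scanned, Reg.top, Reg.answer, Arr.matched,
      Reg.index, Reg.vertices, Expr.eval_clamp, Reg.low, Reg.high, Reg.best, Reg.found, Reg.rank]
    norm_num only [if_true, if_false]
    rw [← hw, hA, hnv, hcapv, hidx]
    by_cases hadj' : q w i = true ∧ A w = 0 ∧ A i = 0
    · have hR' : s₁.arr 1 e ≠ 0 := by rw [hR]; exact hpos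
      simp only [hadj'.1, hadj'.2.1, hadj'.2.2, if_true]
      norm_num only [if_true, if_false]
      rw [lookup_ensures (by simp) (by simpa using hR')]
      simp only [State.setVar_var, State.setVar_arr]
      norm_num only [if_true, if_false]
      rw [hR]
      by_cases h1 : s₁.var 14 < EdgeCode.tableKey f e
      · by_cases h2 : EdgeCode.tableKey f e < s₁.var 15
        · simp only [h1, h2, if_true, ne_eq, one_ne_zero, not_false_eq_true]
          refine ⟨?_, ?_, ?_, ?_, ?_, ?_, ?_⟩
          · repeat refine Fixed.setVar ?_ (by norm_num) (by norm_num) (by norm_num) (by norm_num)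
            exact hfix
          · exact harr
          · simp only [Reg.top, Reg.low, Reg.depth, Reg.sample, Reg.count, List.mem_cons,
              forall_eq_or_imp, List.not_mem_nil, false_imp_iff, implies_true, and_true,
              State.setVar_var]
            norm_num only [if_true, if_false]
            exact hvars
          · intro y hy
            simp only [Reg.top, Reg.low, Reg.high, State.setVar_var]
            norm_num only [if_true, if_false]
            rcases hy.eq_or_lt with rfl | hy
            · exact fun _ _ => le_rfl
            · exact fun h3 h4 => h2.le.trans (hle y hy h3 h4)
          · simp [State.setVar_var]
          · intro _
            simp only [Reg.top, Reg.low, Reg.high, Reg.best, State.setVar_var]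
            norm_num only [if_true, if_false]
            exact ⟨hadj', rfl, h1, h2.trans_le hhigh⟩
          · simp only [Reg.high, State.setVar_var]
            norm_num only [if_true, if_false]
            exact h2.le.trans hhigh
        · simp only [h1, h2, if_true, if_false, ne_eq, one_ne_zero, not_false_eq_true,
            not_true_eq_false]
          refine hskip _ rfl ?_ ?_
          · intro x hx
            simp only [List.mem_cons, List.not_mem_nil, or_false, not_or] at hx
            simp [hx]
          · exact fun _ _ => not_lt.1 h2
      · simp only [h1, if_false, ne_eq, not_true_eq_false]
        refine hskip _ rfl ?_ ?_
        · intro x hx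
          simp only [List.mem_cons, List.not_mem_nil, or_false, not_or] at hx
          simp [hx]
        · exact fun _ h3 => absurd h3 h1
    · have hc : ¬ (A w + A i < if q w i = true then 1 else 0) := by
        by_cases hq' : q w i = true
        · simp only [hq', true_and, if_true] at hadj' ⊢
          omega
        · simp [hq']
      rw [if_neg hc, if_neg (by simp)]
      refine hskip _ rfl ?_ ?_
      · intro x hx
        simp only [List.mem_cons, List.not_mem_nil, or_false, not_or] at hx
        simp [hx]
      · exact fun h => absurd h hadj'
  · refine ⟨hs.setVar (by simp) (by simp) (by simp) (by simp), rfl, ?_, ?_, ?_, ?_, ?_⟩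
    · simp
    · rintro y hy ⟨h1, -, -⟩
      have h2 := hq.lt (hq.symm h1)
      have h3 := hs.vertices
      simp only [Reg.vertices] at h3 hy
      omega
    · simp
    · simp only [Reg.found] at hfound
      simp [hfound]
    · simp

end Explore

/-! ### Correctness of the local exploration -/

/-- The arrays `W`, `B`, `L` contain a walk from its first vertex on, with the keys of its edges:
`B` at their ends, `L` at their starts, and the bound `top` at the first vertex. -/
def WalkStored {E : Type*} (S : EdgeCode E) (key : E → ℕ) (top : ℕ) (W B L : ℕ → ℕ) : List ℕ → Prop
  | [] => False
  | [v] => W 0 = v ∧ B 0 = top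
  | x :: w :: l => W (l.length + 1) = x ∧ B (l.length + 1) = key (S.code w x) ∧
      L l.length = key (S.code w x) ∧ WalkStored S key top W B L (w :: l)

section WalkStored

variable {E : Type*} {S : EdgeCode E} {key : E → ℕ} {top : ℕ} {W B L W' B' L' : ℕ → ℕ}

theorem WalkStored.congr {l : List ℕ} (h : WalkStored S key top W B L l)
    (hW : ∀ i < l.length, W' i = W i)
    (hB : ∀ i < l.length, B' i = B i) (hL : ∀ i, i + 1 < l.length → L' i = L i) :
    WalkStored S key top W' B' L' l := by
  match l with
  | [] => exact h
  | [v] => exact ⟨(hW 0 (by simp)).trans h.1, (hB 0 (by simp)).trans h.2⟩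
  | x :: w :: l =>
    refine ⟨(hW _ (by simp)).trans h.1, (hB _ (by simp)).trans h.2.1,
      (hL _ (by simp)).trans h.2.2.1, h.2.2.2.congr ?_ ?_ ?_⟩
    · intro i hi
      exact hW i (by simp at hi ⊢; omega)
    · intro i hi
      exact hB i (by simp at hi ⊢; omega)
    · intro i hi
      exact hL i (by simp at hi ⊢; omega)

theorem WalkStored.head {w : ℕ} {l : List ℕ} (h : WalkStored S key top W B L (w :: l)) :
    W l.length = w := by
  cases l with
  | nil => exact h.1
  | cons u l => exact h.1

theorem WalkStored.bound_zero {l : List ℕ} (h : WalkStored S key top W B L l) : B 0 = top := by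
  match l with
  | [] => exact h.elim
  | [v] => exact h.2
  | x :: w :: l => exact h.2.2.2.bound_zero

end WalkStored

section Explore

variable {q : ℕ → ℕ → Bool} {n cap m N : ℕ} {A V : ℕ → ℕ} {s : State}
  (hq : IsOracle q n) (hcap : n * n ≤ cap) {f : Fin (cap + 1) → Fin (m + 1)}

open Classical in
/-- Whether the greedy matching of the residual graph matches `v`. -/
noncomputable def matchedIndicator (A : ℕ → ℕ) (f : Fin (cap + 1) → Fin (m + 1)) (v : ℕ) : ℕ :=
  if (residualGraph A hq hcap).IsMatched (EdgeCode.tableKey f) v then 1 else 0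

/-- The number of edges that the exploration from `v` looks at. -/
noncomputable def walkCount (A : ℕ → ℕ) (f : Fin (cap + 1) → Fin (m + 1)) (v : ℕ) : ℕ :=
  ((residualGraph A hq hcap).queryWalks (EdgeCode.tableKey f) v).ncard

theorem matchedIndicator_le_one (v : ℕ) : matchedIndicator hq hcap A f v ≤ 1 := by
  rw [matchedIndicator]
  split <;> omega

/-- The state after `t` steps, while an exploration goes on: every step but the last one of an
exploration either visits a new query walk or takes the current walk back by two edges. -/
structure Exploring (f : Fin (cap + 1) → Fin (m + 1)) (N : ℕ) (A V : ℕ → ℕ) (t : ℕ) (s : State)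
    (Vis : Finset (List ℕ)) (l : List ℕ) (pops : ℕ) : Prop where
  lt : s.var Reg.sample < N
  count : s.var Reg.count =
    ∑ i ∈ Finset.range (s.var Reg.sample), matchedIndicator hq hcap A f (V i)
  walk : EdgeCode.Exploration (residualGraph A hq hcap) (EdgeCode.tableKey f)
    (V (s.var Reg.sample)) Vis l (s.arr Arr.low (s.var Reg.depth))
  stored : WalkStored (residualGraph A hq hcap) (EdgeCode.tableKey f) (m + 2) (s.arr Arr.walk)
    (s.arr Arr.high) (s.arr Arr.low) l
  length : l.length = s.var Reg.depth + 1
  card : l.length + 2 * pops = Vis.card + 1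
  time : t ≤ ∑ i ∈ Finset.range (s.var Reg.sample), (2 * walkCount hq hcap A f (V i) + 1) +
    Vis.card + pops
  depth_le : s.var Reg.depth ≤ t

/-- The state after `t` steps: either an exploration goes on or all explorations are finished. -/
structure ExploreInv (f : Fin (cap + 1) → Fin (m + 1)) (N : ℕ) (A V : ℕ → ℕ) (t : ℕ) (s : State) :
    Prop where
  fixed : Fixed n cap m N A V f s
  cases : (∃ Vis l pops, Exploring hq hcap f N A V t s Vis l pops) ∨
    N ≤ s.var Reg.sample ∧
      s.var Reg.count = ∑ i ∈ Finset.range N, matchedIndicator hq hcap A f (V i)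

theorem tableKey_pos (e : Fin (cap + 1)) : 0 < EdgeCode.tableKey f e := Nat.succ_pos _

theorem tableKey_lt (e : Fin (cap + 1)) : EdgeCode.tableKey f e < m + 2 := by
  have := (f e).isLt
  simp only [EdgeCode.tableKey]
  omega

theorem adj_lt (a b : ℕ) (h : (residualGraph A hq hcap).adj a b) : a < n ∧ b < n :=
  ⟨hq.lt h.1, hq.lt (hq.symm h.1)⟩

/-- Extending the walk visits a new query walk. -/
theorem pushWalk_ensures {t : ℕ} (h : ExploreInv hq hcap f N A V t s) (ht : t < cap)
    (hadj : (residualGraph A hq hcap).adj (s.arr Arr.walk (s.var Reg.depth)) (s.var Reg.best))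
    (hkey : s.var Reg.high = EdgeCode.tableKey f
      ((residualGraph A hq hcap).code (s.arr Arr.walk (s.var Reg.depth)) (s.var Reg.best)))
    (hlo : s.arr Arr.low (s.var Reg.depth) < s.var Reg.high)
    (hhi : s.var Reg.high < s.arr Arr.high (s.var Reg.depth))
    (hmin : ∀ y, (residualGraph A hq hcap).adj (s.arr Arr.walk (s.var Reg.depth)) y →
      s.arr Arr.low (s.var Reg.depth) < EdgeCode.tableKey f
        ((residualGraph A hq hcap).code (s.arr Arr.walk (s.var Reg.depth)) y) →
      s.var Reg.high ≤ EdgeCode.tableKey f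
        ((residualGraph A hq hcap).code (s.arr Arr.walk (s.var Reg.depth)) y)) :
    pushWalk.Ensures q s (ExploreInv hq hcap f N A V (t + 1)) := by
  have hc : s.var 3 = cap := h.fixed.capVar_eq
  simp only [pushWalk, ensures_seq, ensures_store, ensures_assign]
  refine ⟨?_, ?_⟩
  · refine Fixed.setCell (Fixed.setCell (Fixed.setCell (Fixed.setVar (Fixed.setCell h.fixed ?_)
      ?_ ?_ ?_ ?_) ?_) ?_) ?_ <;> simp
  · rcases h.cases with ⟨Vis, l, pops, h1⟩ | h1
    · left
      obtain ⟨w, l, rfl⟩ : ∃ w l', l = w :: l' := by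
        cases l with
        | nil => exact h1.stored.elim
        | cons w l => exact ⟨w, l, rfl⟩
      have hlen : l.length = s.var 21 := by simpa using h1.length
      have hw : s.arr Arr.walk (s.var Reg.depth) = w := by
        rw [← h1.stored.head, hlen]
      rw [hw] at hadj hkey hmin
      have hdle : s.var 21 ≤ t := h1.depth_le
      have hmin1 : min (s.var 21 + 1) cap = s.var 21 + 1 := by omega
      obtain ⟨hnew, hexp⟩ := h1.walk.push tableKey_pos hadj (by rw [← hkey]; exact hlo)
        (by
          intro u hu
          rw [← hkey]
          refine hhi.trans_eq ?_
          cases l with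
          | nil => simp at hu
          | cons u' l =>
            obtain rfl : u' = u := by simpa using hu
            have := h1.stored.2.1
            simp only [List.length_cons] at hlen
            rwa [hlen] at this)
        (by
          intro y hy hlt
          by_contra hgt
          have := hmin y hy (by omega)
          omega)
      refine ⟨insert (s.var Reg.best :: w :: l) Vis, s.var Reg.best :: w :: l, pops,
        ?_, ?_, ?_, ?_, ?_, ?_, ?_, ?_⟩
      · exact h1.lt
      · exact h1.count
      · simpa [Expr.eval, Op.eval] using hexp
      · simp only [Expr.eval, Op.eval, Expr.eval_clamp, State.setVar_var, State.setCell_var,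
          Reg.depth, Reg.high, Reg.best, capVar, if_true, hc, hmin1]
        norm_num only [if_true, if_false]
        refine ⟨?_, ?_, ?_, h1.stored.congr ?_ ?_ ?_⟩
        · simp [hlen]
        · simp only [Reg.high] at hkey
          simp [hlen, hkey]
        · simp only [Reg.high] at hkey
          simp [hlen, hkey]
        · intro i hi
          simp only [List.length_cons] at hi
          simp; omega
        · intro i hi
          simp only [List.length_cons] at hi
          simp; omega
        · intro i hi
          simp only [List.length_cons] at hi
          have h2 : i ≠ s.var 21 + 1 := by omega
          have h3 : i ≠ s.var 21 := by omega
          simp [h2, h3]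
      · simp [Expr.eval, Op.eval, hc, hmin1, hlen]
      · rw [Finset.card_insert_of_notMem hnew]
        have := h1.card
        simp only [List.length_cons] at this ⊢
        omega
      · rw [Finset.card_insert_of_notMem hnew]
        have := h1.time
        simp only [Reg.sample, State.setCell_var, State.setVar_var] at this ⊢
        norm_num only [if_false]
        omega
      · simp [Expr.eval, Op.eval, hc]
        omega
    · right
      exact h1

/-- When no edge is left at depth `0`, no edge at the sampled vertex is selected; at depth `1` the
only edge of the walk is selected. So the depth is the indicator of a matched vertex. -/
theorem nextSample_ensures {t : ℕ} (hinj : Set.InjOn (EdgeCode.tableKey f)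
      (residualGraph A hq hcap).edgeCodes) (h : ExploreInv hq hcap f N A V t s) (hN : N ≤ cap)
    (hdepth : s.var Reg.depth < 2)
    (hfail : ∀ y, (residualGraph A hq hcap).adj (s.arr Arr.walk (s.var Reg.depth)) y →
      EdgeCode.tableKey f ((residualGraph A hq hcap).code (s.arr Arr.walk (s.var Reg.depth)) y) <
        s.arr Arr.high (s.var Reg.depth) →
      EdgeCode.tableKey f ((residualGraph A hq hcap).code (s.arr Arr.walk (s.var Reg.depth)) y) ≤
        s.arr Arr.low (s.var Reg.depth)) :
    nextSample.Ensures q s (ExploreInv hq hcap f N A V (t + 1)) := by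
  have hc : s.var 3 = cap := h.fixed.capVar_eq
  have hsN : s.var 4 = N := h.fixed.samples
  have hV : s.arr 2 = V := h.fixed.starts
  simp only [nextSample, ensures_seq, ensures_ite, ensures_store, ensures_assign, ensures_skip]
  rcases h.cases with ⟨Vis, l, pops, h1⟩ | ⟨h1, h2⟩
  · have hlt : s.var 22 < N := h1.lt
    have hcount : s.var 23 = _ := h1.count
    have hres : s.var Reg.depth = matchedIndicator hq hcap A f (V (s.var Reg.sample)) := by
      have hlen := h1.length
      have hst := h1.stored
      have hwalk := h1.walk
      match l with
      | [] => exact hst.elim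
      | [w] =>
        have hd : s.var Reg.depth = 0 := by simpa using hlen
        rw [hd] at hfail hwalk ⊢
        rw [hst.1, hst.2] at hfail
        rw [matchedIndicator, if_neg (hwalk.not_isMatched fun y hy =>
          hfail y hy (tableKey_lt _))]
      | [w, u] =>
        have hd : s.var Reg.depth = 1 := by simpa using hlen.symm
        rw [hd] at hfail hwalk ⊢
        have e1 : s.arr Arr.walk 1 = w := hst.1
        have e2 : s.arr Arr.high 1 = _ := hst.2.1
        rw [e1, e2] at hfail
        rw [matchedIndicator, if_pos (hwalk.isMatched hfail)]
      | _ :: _ :: _ :: _ =>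
        simp only [List.length_cons] at hlen
        omega
    have hle : s.var 23 ≤ s.var 22 := by
      rw [hcount]
      refine (Finset.sum_le_card_nsmul _ _ 1 fun i _ => matchedIndicator_le_one hq hcap _).trans ?_
      simp
    have hI := matchedIndicator_le_one hq hcap (A := A) (f := f) (V (s.var Reg.sample))
    have hres' : s.var 21 = matchedIndicator hq hcap A f (V (s.var 22)) := hres
    have hmin1 : min (s.var 23 + s.var 21) cap = s.var 23 + s.var 21 := by
      simp only [Reg.sample] at hI
      omega
    have hmin2 : min (s.var 22 + 1) cap = s.var 22 + 1 := by omega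
    have hsum : s.var 23 + s.var 21 =
        ∑ i ∈ Finset.range (s.var 22 + 1), matchedIndicator hq hcap A f (V i) := by
      rw [Finset.sum_range_succ, ← hres', hcount]
    have hcond : Expr.eval s (.bin .lt (.var Reg.sample) (.var Reg.samples)) ≠ 0 := by
      simp [Expr.eval, Op.eval, hsN, hlt]
    rw [if_pos hcond]
    refine ⟨?_, ?_⟩
    · refine Fixed.setVar (Fixed.setCell (Fixed.setCell (Fixed.setVar (Fixed.setVar h.fixed
        ?_ ?_ ?_ ?_) ?_ ?_ ?_ ?_) ?_) ?_) ?_ ?_ ?_ ?_ <;> simp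
    · rcases Nat.lt_or_ge (s.var 22 + 1) N with hlt' | hge
      · left
        refine ⟨∅, [V (s.var 22 + 1)], 0, ?_, ?_, ?_, ?_, ?_, ?_, ?_, ?_⟩
        · simpa [Expr.eval, Op.eval, hc, hmin2] using hlt'
        · simpa [Expr.eval, Op.eval, hc, hmin2, hmin1] using hsum
        · simpa [Expr.eval, Op.eval, hc, hmin2] using EdgeCode.exploration_start tableKey_pos
        · have h0 : s.arr 4 0 = m + 2 := h1.stored.bound_zero
          refine ⟨?_, ?_⟩
          · simp [Expr.eval, Op.eval, hc, hmin2, hV]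
          · simpa using h0
        · simp [Expr.eval]
        · simp
        · have h3 := h1.time
          have h4 := h1.card
          have h5 := h1.length
          have h6 := h1.walk.card_le (EdgeCode.finite_queryWalks (adj_lt hq hcap) hinj _)
          simp only [Reg.sample] at h3 h6
          simp [Expr.eval, Op.eval, hc, hmin2, Finset.sum_range_succ (n := s.var 22)]
          rw [← walkCount] at h6
          omega
        · simp [Expr.eval]
      · right
        have hjN : s.var 22 + 1 = N := by omega
        refine ⟨?_, ?_⟩
        · simpa [Expr.eval, Op.eval, hc, hmin2] using hge
        · rw [← hjN]
          simpa [Expr.eval, Op.eval, hc, hmin2, hmin1] using hsum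
  · have h1' : N ≤ s.var 22 := h1
    have hcond : ¬ Expr.eval s (.bin .lt (.var Reg.sample) (.var Reg.samples)) ≠ 0 := by
      simp [Expr.eval, Op.eval, hsN, h1']
    rw [if_neg hcond]
    refine ⟨?_, Or.inr ⟨?_, ?_⟩⟩
    · refine Fixed.setVar (Fixed.setCell (Fixed.setCell (Fixed.setVar h.fixed
        ?_ ?_ ?_ ?_) ?_) ?_) ?_ ?_ ?_ ?_ <;> simp
    · simp [Expr.eval, Op.eval, hc]
      omega
    · exact h2

/-- The array of lower bounds still holds the key of the first of the two edges that are taken back,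
so the search resumes with larger keys. -/
theorem pop_ensures {t : ℕ} (hinj : Set.InjOn (EdgeCode.tableKey f)
      (residualGraph A hq hcap).edgeCodes) (h : ExploreInv hq hcap f N A V t s)
    (hdepth : ¬ s.var Reg.depth < 2)
    (hfail : ∀ y, (residualGraph A hq hcap).adj (s.arr Arr.walk (s.var Reg.depth)) y →
      EdgeCode.tableKey f ((residualGraph A hq hcap).code (s.arr Arr.walk (s.var Reg.depth)) y) <
        s.arr Arr.high (s.var Reg.depth) →
      EdgeCode.tableKey f ((residualGraph A hq hcap).code (s.arr Arr.walk (s.var Reg.depth)) y) ≤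
        s.arr Arr.low (s.var Reg.depth)) :
    ExploreInv hq hcap f N A V (t + 1) (s.setVar Reg.depth (s.var Reg.depth - 2)) := by
  refine ⟨h.fixed.setVar (by simp) (by simp) (by simp) (by simp), ?_⟩
  rcases h.cases with ⟨Vis, l, pops, h1⟩ | h1
  · left
    have hlen := h1.length
    match l with
    | [] => exact h1.stored.elim
    | [_] => simp only [List.length_cons, List.length_nil] at hlen; omega
    | [_, _] => simp only [List.length_cons, List.length_nil] at hlen; omega
    | x :: w :: u :: l =>
      simp only [List.length_cons] at hlen
      have hd : s.var Reg.depth = l.length + 2 := by omega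
      have hst := h1.stored
      have e1 : s.arr Arr.walk (s.var Reg.depth) = x := by rw [hd]; exact hst.1
      have e2 : s.arr Arr.high (s.var Reg.depth) =
          EdgeCode.tableKey f ((residualGraph A hq hcap).code w x) := by
        rw [hd]
        exact hst.2.1
      have e3 : s.arr Arr.low l.length = _ := hst.2.2.2.2.2.1
      rw [e1, e2] at hfail
      have hpop := h1.walk.pop hinj hfail
      refine ⟨Vis, u :: l, pops + 1, h1.lt, h1.count, ?_, ?_, ?_, ?_, ?_, ?_⟩
      · simp only [State.setVar_var, State.setVar_arr, if_true, hd, Nat.add_sub_cancel]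
        rw [e3]
        exact hpop
      · exact hst.2.2.2.2.2.2
      · simp only [State.setVar_var, if_true, hd, Nat.add_sub_cancel, List.length_cons]
      · have := h1.card
        simp only [List.length_cons] at this ⊢
        omega
      · have := h1.time
        simp only [Reg.sample, Reg.depth, State.setVar_var] at this ⊢
        norm_num only [if_false]
        omega
      · have := h1.depth_le
        simp only [Reg.depth, State.setVar_var, if_true] at this ⊢
        omega
  · exact Or.inr h1

theorem exploreStep_ensures {t : ℕ} (hinj : Set.InjOn (EdgeCode.tableKey f)
      (residualGraph A hq hcap).edgeCodes) (h : ExploreInv hq hcap f N A V t s) (ht : t < cap)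
    (hN : N ≤ cap) : exploreStep.Ensures q s (ExploreInv hq hcap f N A V (t + 1)) := by
  simp only [exploreStep, loadTop, ensures_seq, ensures_assign, Expr.eval, State.setVar_var,
    State.setVar_arr, Reg.top, Reg.low, Reg.high, Reg.found, Reg.depth, Arr.walk, Arr.low,
    Arr.high]
  norm_num only [if_false]
  set s₁ := (((s.setVar 13 (s.arr 3 (s.var 21))).setVar 14 (s.arr 5 (s.var 21))).setVar 15
    (s.arr 4 (s.var 21))).setVar 16 0 with hs₁
  have hfix₁ : Fixed n cap m N A V f s₁ := by
    refine Fixed.setVar (Fixed.setVar (Fixed.setVar (Fixed.setVar h.fixed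
      ?_ ?_ ?_ ?_) ?_ ?_ ?_ ?_) ?_ ?_ ?_ ?_) ?_ ?_ ?_ ?_ <;> simp
  refine (scan_ensures hq hcap hfix₁ (by simp [hs₁])).mono fun s₂ h₂ => ?_
  have harr : s₂.arr = s.arr := h₂.arr
  have hvars := h₂.vars
  simp only [Reg.top, Reg.low, Reg.depth, Reg.sample, Reg.count, List.mem_cons, forall_eq_or_imp,
    List.not_mem_nil, false_imp_iff, implies_true, and_true, hs₁, State.setVar_var] at hvars
  norm_num only [if_true, if_false] at hvars
  obtain ⟨v13, v14, v21, v22, v23⟩ := hvars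
  have hinv : ExploreInv hq hcap f N A V t s₂ := by
    refine ⟨h₂.fixed, ?_⟩
    rcases h.cases with ⟨Vis, l, pops, h1⟩ | h1
    · refine Or.inl ⟨Vis, l, pops, ?_, ?_, ?_, ?_, ?_, h1.card, ?_, ?_⟩
      · simpa [v22] using h1.lt
      · simpa [v22, v23] using h1.count
      · simpa [v22, v21, harr] using h1.walk
      · simpa [harr] using h1.stored
      · simpa [v21] using h1.length
      · simpa [v22] using h1.time
      · simpa [v21] using h1.depth_le
    · right
      simpa [v22, v23] using h1
  have e13 : s₂.var Reg.top = s₂.arr Arr.walk (s₂.var Reg.depth) := by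
    simp only [Reg.top, Reg.depth, Arr.walk, harr, v13, v21]
  have e14 : s₂.var Reg.low = s₂.arr Arr.low (s₂.var Reg.depth) := by
    simp only [Reg.low, Reg.depth, Arr.low, harr, v14, v21]
  have e15 : s₁.var Reg.high = s₂.arr Arr.high (s₂.var Reg.depth) := by
    simp [hs₁, harr, v21]
  have hle := h₂.le
  rw [e13, e14] at hle
  rw [ensures_ite]
  by_cases hf : s₂.var Reg.found = 0
  · have hhi := (h₂.none hf).trans e15
    have hfail : ∀ y, (residualGraph A hq hcap).adj (s₂.arr Arr.walk (s₂.var Reg.depth)) y →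
        EdgeCode.tableKey f
          ((residualGraph A hq hcap).code (s₂.arr Arr.walk (s₂.var Reg.depth)) y) <
          s₂.arr Arr.high (s₂.var Reg.depth) →
        EdgeCode.tableKey f
          ((residualGraph A hq hcap).code (s₂.arr Arr.walk (s₂.var Reg.depth)) y) ≤
          s₂.arr Arr.low (s₂.var Reg.depth) := by
      intro y hy hlt
      by_contra hgt
      have := hle y (Nat.zero_le _) hy (not_le.1 hgt)
      omega
    rw [if_neg (by simpa [Expr.eval] using hf), ensures_ite]
    by_cases hd : s₂.var Reg.depth < 2
    · rw [if_pos (by simpa [Expr.eval, Op.eval] using hd)]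
      exact nextSample_ensures hq hcap hinj hinv hN hd hfail
    · rw [if_neg (by simpa [Expr.eval, Op.eval] using hd), ensures_assign]
      exact pop_ensures hq hcap hinj hinv hd hfail
  · obtain ⟨h3, h4, h5, h6⟩ := h₂.some hf
    rw [e13] at h3 h4
    rw [e14] at h5
    rw [e15] at h6
    rw [if_pos (by simpa [Expr.eval] using hf)]
    exact pushWalk_ensures hq hcap hinv ht h3 h4 h5 h6 fun y hy => hle y (Nat.zero_le _) hy

/-- If the budget suffices, the exploration counts the matched vertices among the samples. -/
theorem explore_ensures (hinj : Set.InjOn (EdgeCode.tableKey f)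
      (residualGraph A hq hcap).edgeCodes) (hs : Fixed n cap m N A V f s) (hN : N ≤ cap)
    (hN0 : 0 < N) (hm : m + 2 ≤ cap) (hQ : s.var Reg.budget ≤ cap)
    (hbudget : ∑ i ∈ Finset.range N, (2 * walkCount hq hcap A f (V i) + 1) ≤ s.var Reg.budget) :
    explore.Ensures q s fun s' =>
      s'.var Reg.count = ∑ i ∈ Finset.range N, matchedIndicator hq hcap A f (V i) := by
  have hc : s.var 3 = cap := hs.capVar_eq
  have hm' : s.var 6 = m := hs.maxRank
  have hV : s.arr 2 = V := hs.starts
  simp only [explore, initExplore, ensures_seq, ensures_assign, ensures_store]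
  generalize hs₁ : State.setVar _ Reg.count _ = s₁
  have hQ₁ : s₁.var Reg.budget = s.var Reg.budget := by simp [← hs₁]
  have hinv : ExploreInv hq hcap f N A V 0 s₁ := by
    subst hs₁
    refine ⟨?_, Or.inl ⟨∅, [V 0], 0, ?_, ?_, ?_, ?_, ?_, ?_, ?_, ?_⟩⟩
    · refine Fixed.setVar (Fixed.setVar (Fixed.setVar (Fixed.setCell (Fixed.setCell (Fixed.setCell
        hs ?_) ?_) ?_) ?_ ?_ ?_ ?_) ?_ ?_ ?_ ?_) ?_ ?_ ?_ ?_ <;> simp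
    · simpa [Expr.eval] using hN0
    · simp [Expr.eval]
    · simpa [Expr.eval] using EdgeCode.exploration_start tableKey_pos
    · refine ⟨by simp [Expr.eval, hV], ?_⟩
      simp [Expr.eval, Op.eval, hc, hm', hm]
    · simp [Expr.eval]
    · simp
    · simp
    · simp [Expr.eval]
  rw [← hQ₁] at hbudget hQ
  refine ensures_rep (fun i s' => ExploreInv hq hcap f N A V (s₁.var Reg.budget - i) s') ?_ ?_ ?_
  · intro i hi s' h'
    have e : s₁.var Reg.budget - i = s₁.var Reg.budget - (i + 1) + 1 := by omega
    rw [e]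
    refine exploreStep_ensures hq hcap hinj ?_ (by omega) hN
    refine ⟨h'.fixed.setVar (by simp) (by simp) (by simp) (by simp), ?_⟩
    rcases h'.cases with ⟨Vis, l, pops, h1⟩ | h1
    · exact Or.inl ⟨Vis, l, pops, h1.lt, h1.count, h1.walk, h1.stored, h1.length, h1.card, h1.time,
        h1.depth_le⟩
    · exact Or.inr h1
  · simp only [Nat.sub_self]
    refine ⟨hinv.fixed.setVar (by simp) (by simp) (by simp) (by simp), ?_⟩
    rcases hinv.cases with ⟨Vis, l, pops, h1⟩ | h1
    · exact Or.inl ⟨Vis, l, pops, h1.lt, h1.count, h1.walk, h1.stored, h1.length, h1.card, h1.time,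
        h1.depth_le⟩
    · exact Or.inr h1
  · intro s' h'
    rcases h'.cases with ⟨Vis, l, pops, h1⟩ | h1
    · exfalso
      have h3 := h1.time
      have h4 := h1.card
      have h5 := h1.length
      have h6 := h1.walk.card_le (EdgeCode.finite_queryWalks (adj_lt hq hcap) hinj _)
      rw [← walkCount] at h6
      have h7 : ∑ i ∈ Finset.range (s'.var Reg.sample + 1),
          (2 * walkCount hq hcap A f (V i) + 1) ≤
          ∑ i ∈ Finset.range N, (2 * walkCount hq hcap A f (V i) + 1) :=
        Finset.sum_le_sum_of_subset (Finset.range_mono h1.lt)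
      rw [Finset.sum_range_succ] at h7
      omega
    · exact h1.2

end Explore

/-! ### Sampling vertices -/

/-- Draw one vertex from which the greedy matching is explored. -/
def drawStart : Stmt :=
  rand Reg.choice (.bin .sub (.var Reg.vertices) (.lit 1));;
    store Arr.starts (.var Reg.outer) (.var Reg.choice)

/-- Draw the vertices from which the greedy matching is explored. -/
def drawStarts : Stmt := rep Reg.outer Reg.samples drawStart

/-- Scale the number of matched samples to an estimate for the size of the matching. -/
def finalize : Stmt :=
  assign Reg.size (.clamp (.bin .add (.var Reg.size)
    (.bin .div (.bin .mul (.var Reg.vertices) (.var Reg.count))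
      (.bin .mul (.lit 2) (.var Reg.samples)))))

/-- Add an estimate for the size of the greedy matching of the residual graph to `Reg.size`. -/
def estimate : Stmt := drawStarts;; explore;; finalize

section Sampling

variable {q : ℕ → ℕ → Bool} {n N : ℕ} {s : State}

theorem expect_drawStart (hn : 0 < n) (hs : s.var Reg.vertices = n) {i : ℕ}
    (g : State → ℝ≥0∞) :
    expect (drawStart.sem q (s.setVar Reg.outer i)) g =
      (∑ v ∈ Finset.range n,
        g (((s.setVar Reg.outer i).setVar Reg.choice v).setCell Arr.starts i v)) / n := by
  simp only [Reg.vertices] at hs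
  rw [drawStart, sem, expect_bind, expect_rand hn (by simp [Expr.eval, Op.eval, hs])]
  congr 1
  refine Finset.sum_congr rfl fun v _ => ?_
  simp [sem, Expr.eval]

theorem drawStart_vertices {i : ℕ} (s₁ : State) (h : s₁.var Reg.vertices = n) :
    ∀ s' ∈ (drawStart.sem q (s₁.setVar Reg.outer i)).support,
      s'.var Reg.vertices = n := by
  have hk : drawStart.Keeps 0 := by simp [drawStart, Keeps]
  intro s' hs'
  have := hk.ensures q _ s' hs'
  simp only [Reg.vertices] at *
  rw [this]
  simpa using h

/-- The loop counter counts down, so the entries from `i + 1` on are drawn before entry `i`. -/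
theorem sum_Ico_setCell {β : Type*} [AddCommMonoid β] (w : ℕ → β) (s : State) {i v : ℕ}
    (hi : i < N) :
    ∑ j ∈ Finset.Ico i N, w ((s.setCell Arr.starts i v).arr Arr.starts j) =
      w v + ∑ j ∈ Finset.Ico (i + 1) N, w (s.arr Arr.starts j) := by
  rw [Finset.sum_eq_sum_Ico_succ_bot hi]
  congr 1
  · simp
  · refine Finset.sum_congr rfl fun j hj => ?_
    have : j ≠ i := by simp at hj; omega
    simp [this]

theorem expect_drawStarts_sum_le (hn : 0 < n) (hs : s.var Reg.vertices = n)
    (hN : s.var Reg.samples = N) (w : ℕ → ℝ≥0∞) :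
    expect (drawStarts.sem q s) (fun s' => ∑ i ∈ Finset.range N, w (s'.arr Arr.starts i)) ≤
      N * ((∑ v ∈ Finset.range n, w v) / n) := by
  have := expect_repeatSem_le (c := Reg.outer) (k := N)
    (g := drawStart.sem q)
    (I := fun s => s.var Reg.vertices = n)
    (Φ := fun k s => ∑ i ∈ Finset.Ico k N, w (s.arr Arr.starts i) +
      k * ((∑ v ∈ Finset.range n, w v) / n))
    (fun i _ s h => drawStart_vertices s h) ?_ (s := s.setVar Reg.outer N) (by simpa using hs)
  · simp only [Finset.Ico_self, Finset.sum_empty, zero_add, Nat.cast_zero, zero_mul, add_zero,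
      ← Finset.range_eq_Ico] at this
    simp only [drawStarts]
    rw [sem, hN]
    exact this
  · intro i hi s hs
    rw [expect_drawStart hn hs]
    simp only [sum_Ico_setCell w _ hi, State.setVar_arr]
    simp only [add_assoc, Finset.sum_add_distrib, Finset.sum_const, Finset.card_range,
      nsmul_eq_mul]
    have hn0 : (n : ℝ≥0∞) ≠ 0 := by exact_mod_cast hn.ne'
    have hcancel : ∀ a : ℝ≥0∞, (n : ℝ≥0∞) * a / n = a := fun a => by
      rw [mul_comm, ENNReal.mul_div_cancel_right hn0 (ENNReal.natCast_ne_top n)]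
    rw [ENNReal.add_div, ENNReal.add_div, hcancel, hcancel]
    push_cast
    rw [add_mul, one_mul, add_left_comm, add_comm ((∑ v ∈ Finset.range n, w v) / (n : ℝ≥0∞))]

/-- The second moment of a sum of independent centred samples. -/
theorem expect_drawStarts_sq_le (hn : 0 < n) (hs : s.var Reg.vertices = n)
    (hN : s.var Reg.samples = N) (z : ℕ → ℝ) {B : ℝ} (hz : ∑ v ∈ Finset.range n, z v = 0)
    (hB : ∀ v, z v ^ 2 ≤ B) :
    expect (drawStarts.sem q s)
      (fun s' => ENNReal.ofReal ((∑ i ∈ Finset.range N, z (s'.arr Arr.starts i)) ^ 2)) ≤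
      ENNReal.ofReal (N * B) := by
  have hB0 : 0 ≤ B := (sq_nonneg _).trans (hB 0)
  have := expect_repeatSem_le (c := Reg.outer) (k := N)
    (g := drawStart.sem q)
    (I := fun s => s.var Reg.vertices = n)
    (Φ := fun k s => ENNReal.ofReal ((∑ i ∈ Finset.Ico k N, z (s.arr Arr.starts i)) ^ 2 + k * B))
    (fun i _ s h => drawStart_vertices s h) ?_ (s := s.setVar Reg.outer N) (by simpa using hs)
  · simp only [Finset.Ico_self, Finset.sum_empty, Nat.cast_zero, zero_mul, add_zero,
      ← Finset.range_eq_Ico] at this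
    simp only [drawStarts]
    rw [sem, hN]
    refine this.trans_eq ?_
    norm_num
  · intro i hi s hs
    rw [expect_drawStart hn hs]
    simp only [sum_Ico_setCell z _ hi, State.setVar_arr]
    set a := ∑ j ∈ Finset.Ico (i + 1) N, z (s.arr Arr.starts j)
    rw [← ENNReal.ofReal_sum_of_nonneg fun v _ => by positivity]
    refine ENNReal.div_le_of_le_mul ?_
    rw [← ENNReal.ofReal_natCast n, ← ENNReal.ofReal_mul (by positivity)]
    refine ENNReal.ofReal_le_ofReal ?_
    have h1 : ∑ v ∈ Finset.range n, ((z v + a) ^ 2 + i * B) =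
        ∑ v ∈ Finset.range n, z v ^ 2 + 2 * a * ∑ v ∈ Finset.range n, z v +
          n * (a ^ 2 + i * B) := by
      rw [Finset.mul_sum, ← Finset.sum_add_distrib]
      rw [show (n : ℝ) * (a ^ 2 + i * B) = ∑ v ∈ Finset.range n, (a ^ 2 + i * B) by
          rw [Finset.sum_const, Finset.card_range, nsmul_eq_mul],
        ← Finset.sum_add_distrib]
      exact Finset.sum_congr rfl fun v _ => by ring
    have h2 : ∑ v ∈ Finset.range n, z v ^ 2 ≤ n * B := by
      refine (Finset.sum_le_card_nsmul _ _ B fun v _ => hB v).trans ?_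
      simp
    rw [h1, hz]
    push_cast
    linarith

end Sampling

/-! ### Ranks are distinct -/

theorem expect_eq_entries {J m : ℕ} {i j : Fin J} (hij : i ≠ j) :
    expect (PMF.uniformOfFintype (Fin J → Fin (m + 1))) (fun f => if f i = f j then 1 else 0) =
      ((m + 1 : ℕ) : ℝ≥0∞)⁻¹ := by
  rw [← uniform_update i]
  have h : ∀ v : Fin (m + 1), (PMF.uniformOfFintype (Fin J → Fin (m + 1))).map
      (fun f => Function.update f i v) = (PMF.uniformOfFintype (Fin J → Fin (m + 1))).bind
      fun f => PMF.pure (Function.update f i v) := fun v => (PMF.bind_pure_comp _ _).symm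
  simp only [h]
  rw [PMF.bind_comm]
  simp only [expect_bind, expect_pure, Function.update_self, Function.update_of_ne hij.symm]
  rw [show ((m + 1 : ℕ) : ℝ≥0∞)⁻¹ = expect (PMF.uniformOfFintype (Fin J → Fin (m + 1)))
    fun _ => ((m + 1 : ℕ) : ℝ≥0∞)⁻¹ from (expect_const _ _).symm]
  refine expect_congr fun f _ => ?_
  rw [expect_uniformOfFintype]
  simp

section Estimate

variable {q : ℕ → ℕ → Bool} {n cap m N : ℕ} {A : ℕ → ℕ}
  (hq : IsOracle q n) (hcap : n * n ≤ cap)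

open Classical in
/-- Ranks are distinct with high probability, by a union bound over pairs of edges. -/
theorem expect_not_injOn_le :
    expect (PMF.uniformOfFintype (Fin (cap + 1) → Fin (m + 1))) (fun f =>
      if Set.InjOn (EdgeCode.tableKey f) (residualGraph A hq hcap).edgeCodes then 0 else 1) ≤
      (n ^ 4 : ℕ) / (m + 1 : ℕ) := by
  set S := residualGraph A hq hcap
  set T := (Finset.range n ×ˢ Finset.range n) ×ˢ (Finset.range n ×ˢ Finset.range n) with hT
  let h : (ℕ × ℕ) × (ℕ × ℕ) → (Fin (cap + 1) → Fin (m + 1)) → ℝ≥0∞ := fun p f =>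
    if S.code p.1.1 p.1.2 ≠ S.code p.2.1 p.2.2 ∧
      f (S.code p.1.1 p.1.2) = f (S.code p.2.1 p.2.2) then 1 else 0
  have hle : ∀ f : Fin (cap + 1) → Fin (m + 1),
      (if Set.InjOn (EdgeCode.tableKey f) S.edgeCodes then 0 else 1) ≤ ∑ p ∈ T, h p f := by
    intro f
    split
    · exact zero_le
    · rename_i hinj
      simp only [Set.InjOn, not_forall] at hinj
      obtain ⟨_, ⟨a, b, hab, rfl⟩, _, ⟨c, d, hcd, rfl⟩, he, hne⟩ := hinj
      have h1 : h ((a, b), (c, d)) f = 1 := by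
        simp only [h]
        rw [if_pos]
        refine ⟨hne, ?_⟩
        simpa [EdgeCode.tableKey, Fin.ext_iff] using he
      rw [← h1]
      have h2 := adj_lt hq hcap a b hab
      have h3 := adj_lt hq hcap c d hcd
      exact Finset.single_le_sum (f := fun p => h p f) (fun _ _ => zero_le)
        (by simp [hT, h2, h3])
  refine (expect_mono fun f _ => hle f).trans ?_
  have hsum : ∀ T' : Finset ((ℕ × ℕ) × (ℕ × ℕ)),
      expect (PMF.uniformOfFintype (Fin (cap + 1) → Fin (m + 1))) (fun f => ∑ p ∈ T', h p f) =
        ∑ p ∈ T', expect (PMF.uniformOfFintype (Fin (cap + 1) → Fin (m + 1))) (h p) := by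
    intro T'
    induction T' using Finset.induction_on with
    | empty => simp
    | insert p T' hp ih =>
      simp only [Finset.sum_insert hp]
      rw [expect_add, ih]
  rw [hsum]
  have hp : ∀ p ∈ T, expect (PMF.uniformOfFintype (Fin (cap + 1) → Fin (m + 1))) (h p) ≤
      ((m + 1 : ℕ) : ℝ≥0∞)⁻¹ := by
    intro p _
    by_cases hne : S.code p.1.1 p.1.2 = S.code p.2.1 p.2.2
    · simp only [h, hne, ne_eq, not_true_eq_false, false_and, if_false, expect_const]
      exact zero_le
    · simp only [h, hne, ne_eq, not_false_eq_true, true_and]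
      exact (expect_eq_entries hne).le
  refine (Finset.sum_le_card_nsmul T _ _ hp).trans ?_
  have hcard : T.card = n ^ 4 := by
    simp only [hT, Finset.card_product, Finset.card_range]
    ring
  rw [hcard, nsmul_eq_mul, ← div_eq_mul_inv]

/-- The number of oriented edges of the residual graph is its degree sum. -/
theorem card_darts (s : State) (hA : s.arr Arr.matched = A) :
    ((residualGraph A hq hcap).darts n).card = residualDegree q n 0 s := by
  classical
  rw [EdgeCode.darts, Finset.card_filter, Finset.sum_product, residualDegree, Finset.sum_filter]
  refine Finset.sum_congr rfl fun v _ => ?_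
  rw [hA, openNeighbors, Finset.card_filter, hA]
  by_cases hv : A v = 0
  · simp [residualGraph, hv]
  · simp [residualGraph, hv]

open Classical in
/-- The expected number of edges that the explorations from all vertices look at. -/
theorem expect_walkCount_le (s : State) (hA : s.arr Arr.matched = A) :
    expect (PMF.uniformOfFintype (Fin (cap + 1) → Fin (m + 1))) (fun f =>
      if Set.InjOn (EdgeCode.tableKey f) (residualGraph A hq hcap).edgeCodes then
        ∑ v ∈ Finset.range n, (walkCount hq hcap A f v : ℝ≥0∞) else 0) ≤
      residualDegree q n 0 s := by
  have h := EdgeCode.sum_ncard_queryWalks_le (S := residualGraph A hq hcap) (M := m + 1)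
    (adj_lt hq hcap)
  rw [card_darts hq hcap s hA] at h
  rw [expect_uniformOfFintype, ← Finset.sum_filter]
  refine ENNReal.div_le_of_le_mul ?_
  rw [mul_comm]
  exact_mod_cast h

/-- Deviation of the indicator of matched vertices from its mean, times `n`. -/
noncomputable def deviation (A : ℕ → ℕ) (f : Fin (cap + 1) → Fin (m + 1)) (v : ℕ) : ℝ :=
  n * matchedIndicator hq hcap A f v -
    ∑ u ∈ Finset.range n, (matchedIndicator hq hcap A f u : ℝ)

theorem sum_deviation (f : Fin (cap + 1) → Fin (m + 1)) :
    ∑ v ∈ Finset.range n, deviation hq hcap A f v = 0 := by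
  simp only [deviation, Finset.sum_sub_distrib, ← Finset.mul_sum, Finset.sum_const,
    Finset.card_range, nsmul_eq_mul, sub_self]

theorem deviation_sq_le (f : Fin (cap + 1) → Fin (m + 1)) (v : ℕ) :
    deviation hq hcap A f v ^ 2 ≤ (n : ℝ) ^ 2 := by
  have h1 : ∀ u, (matchedIndicator hq hcap A f u : ℝ) ≤ 1 := fun u => by
    exact_mod_cast matchedIndicator_le_one hq hcap u
  have h2 : ∑ u ∈ Finset.range n, (matchedIndicator hq hcap A f u : ℝ) ≤ n := by
    refine (Finset.sum_le_card_nsmul _ _ 1 fun u _ => h1 u).trans ?_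
    simp
  have h3 : 0 ≤ ∑ u ∈ Finset.range n, (matchedIndicator hq hcap A f u : ℝ) :=
    Finset.sum_nonneg fun u _ => Nat.cast_nonneg _
  have h4 : (n : ℝ) * matchedIndicator hq hcap A f v ≤ n :=
    mul_le_of_le_one_right (Nat.cast_nonneg n) (h1 v)
  have h5 : 0 ≤ (n : ℝ) * matchedIndicator hq hcap A f v := by positivity
  rw [sq_le_sq, abs_of_nonneg (a := (n : ℝ)) (Nat.cast_nonneg n), abs_le, deviation]
  constructor <;> linarith

end Estimate

/-! ### The failure probability of the estimate -/

section EstimateBound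

variable {q : ℕ → ℕ → Bool} {n cap m N : ℕ} {κ : ℕ → Option ℕ} {s : State}

theorem scan_commutes (hcap : 1 ≤ cap) (hsafe : scan.Safe cap κ) (hm : κ Reg.maxRank = some m)
    (hmcap : m + 1 ≤ cap) (hs : Within cap κ s) :
    scan.Commutes q Arr.ranks (cap + 1) m s := by
  refine commutes_rep hcap hsafe (fun s₁ h₁ => ?_) hs
  have hbody := hsafe.2.2.2.2
  refine commutes_seq (Avoids.commutes (by simp [Avoids, Expr.Avoids]) _) fun s₂ hs₂ => ?_
  have h₂ := hbody.1.ensures hcap h₁ s₂ hs₂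
  have hbody := hbody.2.2.1
  refine commutes_ite (by simp [Expr.Avoids]) (fun _ => ?_)
    (fun _ => Avoids.commutes (by simp [Avoids]) _)
  refine commutes_seq (Avoids.commutes (by simp [Avoids, Expr.Avoids]) _) fun s₃ hs₃ => ?_
  have h₃ := hbody.1.ensures hcap h₂ s₃ hs₃
  exact commutes_seq
    (lookup_commutes (by simp) (by simp) h₃ (Nat.lt_succ_self cap) (h₃.const _ _ hm) hmcap)
    fun s₄ _ => Avoids.commutes (by simp [Avoids, Expr.Avoids]) _

theorem estimate_commutes (hcap : 1 ≤ cap) (hsafe : estimate.Safe cap κ)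
    (hm : κ Reg.maxRank = some m) (hmcap : m + 1 ≤ cap) (hs : Within cap κ s) :
    estimate.Commutes q Arr.ranks (cap + 1) m s := by
  refine commutes_seq (Avoids.commutes (by simp [drawStarts, drawStart, Avoids, Expr.Avoids]) _)
    fun s₁ hs₁ => ?_
  have h₁ := hsafe.1.ensures hcap hs s₁ hs₁
  refine commutes_seq ?_ fun s₂ _ => Avoids.commutes (by simp [finalize, Avoids, Expr.Avoids]) _
  have hexp : explore.Safe cap κ := hsafe.2.1
  refine commutes_seq (Avoids.commutes (by simp [initExplore, Avoids, Expr.Avoids]) _)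
    fun s₂ hs₂ => ?_
  refine commutes_rep hcap hexp.2 (fun s₃ h₃ => ?_) (hexp.1.ensures hcap h₁ s₂ hs₂)
  have hstep : exploreStep.Safe cap κ := hexp.2.2.2.2.2
  refine commutes_seq (Avoids.commutes (by simp [loadTop, Avoids, Expr.Avoids]) _)
    fun s₄ hs₄ => ?_
  have h₄ := hstep.1.ensures hcap h₃ s₄ hs₄
  exact commutes_seq (scan_commutes hcap hstep.2.1 hm hmcap h₄) fun s₅ _ =>
    Avoids.commutes (by simp [pushWalk, nextSample, Avoids, Expr.Avoids]) _

variable (hq : IsOracle q n) (hcap : n * n ≤ cap) {A : ℕ → ℕ} {r L : ℕ}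

/-- The number returned by `estimate` for given ranks and given samples. -/
noncomputable def estimateValue (A : ℕ → ℕ) (f : Fin (cap + 1) → Fin (m + 1)) (N size : ℕ)
    (V : ℕ → ℕ) : ℕ :=
  min (size + n * (∑ i ∈ Finset.range N, matchedIndicator hq hcap A f (V i)) / (2 * N)) cap

/-- The assumptions on the state in which `estimate` is started. -/
structure EstimateStart (n cap m N r : ℕ) (A : ℕ → ℕ) (s : State) : Prop where
  vertices : s.var Reg.vertices = n
  capVar_eq : s.var capVar = cap
  samples : s.var Reg.samples = N
  budget : s.var Reg.budget = 30 * N * r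
  maxRank : s.var Reg.maxRank = m
  matched : s.arr Arr.matched = A
  samples_le : N ≤ cap
  maxRank_le : m + 2 ≤ cap
  budget_le : 30 * N * r ≤ cap

open Classical in
/-- For fixed distinct ranks, the estimate fails only if the explorations exceed their budget, which
is unlikely by Markov's inequality, or if the samples are not representative, which is unlikely by
Chebyshev's inequality. -/
theorem expect_estimate_le_of_injOn (hn : 0 < n) (hN : 0 < N) (hr : 0 < r)
    (hs : EstimateStart n cap m N r A s) {f : Fin (cap + 1) → Fin (m + 1)}
    (hranks : ∀ e : Fin (cap + 1), s.arr Arr.ranks e = EdgeCode.tableKey f e)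
    (hinj : Set.InjOn (EdgeCode.tableKey f) (residualGraph A hq hcap).edgeCodes)
    {good : ℕ → Prop}
    (hgood : ∀ V : ℕ → ℕ,
      L * (∑ i ∈ Finset.range N, deviation hq hcap A f (V i)) ^ 2 ≤ (n : ℝ) ^ 2 * N ^ 2 →
      good (estimateValue hq hcap A f N (s.var Reg.size) V)) :
    expect (estimate.sem q s) (fun s' => if good (s'.var Reg.size) then 0 else 1) ≤
      (∑ v ∈ Finset.range n, (walkCount hq hcap A f v : ℝ≥0∞)) * ((10 * n * r : ℕ) : ℝ≥0∞)⁻¹ +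
        L / N := by
  have hn0 : (n : ℝ≥0∞) ≠ 0 := by exact_mod_cast hn.ne'
  have hN0 : (N : ℝ≥0∞) ≠ 0 := by exact_mod_cast hN.ne'
  have hr0 : (r : ℝ≥0∞) ≠ 0 := by exact_mod_cast hr.ne'
  set w : ℕ → ℝ≥0∞ := fun v => (walkCount hq hcap A f v : ℝ≥0∞) with hw
  set z := deviation hq hcap A f with hz
  -- bound the failure indicator by a multiple of the effort plus a multiple of the squared error
  have hpoint : ∀ s₁ ∈ (drawStarts.sem q s).support,
      expect ((explore;; finalize).sem q s₁) (fun s' => if good (s'.var Reg.size) then 0 else 1) ≤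
        ((10 * N * r : ℕ) : ℝ≥0∞)⁻¹ * ∑ i ∈ Finset.range N, w (s₁.arr Arr.starts i) +
        (L / ((n : ℝ≥0∞) ^ 2 * N ^ 2)) *
          ENNReal.ofReal ((∑ i ∈ Finset.range N, z (s₁.arr Arr.starts i)) ^ 2) := by
    intro s₁ hs₁
    set V := s₁.arr Arr.starts with hV
    have hle1 : expect ((explore;; finalize).sem q s₁)
        (fun s' => if good (s'.var Reg.size) then 0 else 1) ≤ 1 :=
      expect_le_of_le fun s' _ => by split <;> simp
    by_cases h1 : ∑ i ∈ Finset.range N, walkCount hq hcap A f (V i) ≤ 10 * N * r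
    · by_cases h2 : L * (∑ i ∈ Finset.range N, z (V i)) ^ 2 ≤ (n : ℝ) ^ 2 * N ^ 2
      · refine (expect_le_of_le (c := 0) ?_).trans zero_le
        have hkv : ∀ x, x ≠ Reg.outer → x ≠ Reg.choice → s₁.var x = s.var x := fun x h h' =>
          Keeps.ensures (P := drawStarts)
            (by simpa [drawStarts, drawStart, Keeps] using ⟨h.symm, h'.symm⟩) q s s₁ hs₁
        have hka : ∀ a, a ≠ Arr.starts → s₁.arr a = s.arr a := fun a h =>
          KeepsArr.ensures (P := drawStarts)
            (by simpa [drawStarts, drawStart, KeepsArr] using h.symm) q s s₁ hs₁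
        have hfix : Fixed n cap m N A V f s₁ := by
          refine ⟨?_, ?_, ?_, ?_, ?_, rfl, ?_⟩
          · rw [hkv _ (by simp) (by simp), hs.vertices]
          · rw [hkv _ (by simp) (by simp), hs.capVar_eq]
          · rw [hkv _ (by simp) (by simp), hs.samples]
          · rw [hkv _ (by simp) (by simp), hs.maxRank]
          · rw [hka _ (by simp), hs.matched]
          · rw [hka _ (by simp)]
            exact hranks
        have hbud : s₁.var Reg.budget = 30 * N * r := by
          rw [hkv _ (by simp) (by simp), hs.budget]
        have hexp := explore_ensures hq hcap hinj hfix hs.samples_le hN hs.maxRank_le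
          (hbud ▸ hs.budget_le) (by
            rw [hbud, Finset.sum_add_distrib, ← Finset.mul_sum]
            simp only [Finset.sum_const, Finset.card_range, smul_eq_mul, mul_one]
            have : N ≤ N * r := Nat.le_mul_of_pos_right N hr
            nlinarith)
        have hkeep : ∀ x ∈ [0, 1, 3, 4], explore.Keeps x := by
          intro x hx
          simp only [List.mem_cons, List.not_mem_nil, or_false] at hx
          rcases hx with rfl | rfl | rfl | rfl <;>
            simp [explore, initExplore, exploreStep, loadTop, scan, pushWalk, nextSample, lookup,
              Keeps]
        have hfin : (explore;; finalize).Ensures q s₁ fun s' => good (s'.var Reg.size) := by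
          rw [ensures_seq]
          intro s₂ hs₂
          have e0 := (hkeep 0 (by simp)).ensures q s₁ s₂ hs₂
          have e1 := (hkeep 1 (by simp)).ensures q s₁ s₂ hs₂
          have e3 := (hkeep 3 (by simp)).ensures q s₁ s₂ hs₂
          have e4 := (hkeep 4 (by simp)).ensures q s₁ s₂ hs₂
          have e5 := hexp s₂ hs₂
          have e6 := hkv 1 (by simp) (by simp)
          have f0 : s₁.var 0 = n := hfix.vertices
          have f3 : s₁.var 3 = cap := hfix.capVar_eq
          have f4 : s₁.var 4 = N := hfix.samples
          have := hgood V h2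
          simp only [Reg.count] at e5
          simp only [estimateValue, Reg.size] at this
          simpa [finalize, Expr.eval, Op.eval, e0, e1, e3, e4, e5, e6, f0, f3, f4] using this
        intro s' hs'
        rw [if_pos (hfin s' hs')]
      · refine hle1.trans (le_trans ?_ le_add_self)
        push Not at h2
        rw [ENNReal.div_eq_inv_mul, mul_assoc, ← ENNReal.ofReal_natCast L,
          ← ENNReal.ofReal_mul (Nat.cast_nonneg L), mul_comm, ← div_eq_mul_inv,
          ENNReal.le_div_iff_mul_le (Or.inl (by positivity)) (Or.inl (by finiteness)), one_mul,
          ← ENNReal.ofReal_natCast n, ← ENNReal.ofReal_natCast N,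
          ← ENNReal.ofReal_pow (Nat.cast_nonneg n), ← ENNReal.ofReal_pow (Nat.cast_nonneg N),
          ← ENNReal.ofReal_mul (by positivity)]
        exact ENNReal.ofReal_le_ofReal h2.le
    · refine hle1.trans (le_trans ?_ le_self_add)
      push Not at h1
      have h10 : ((10 * N * r : ℕ) : ℝ≥0∞) ≠ 0 := by
        exact_mod_cast (by positivity : 10 * N * r ≠ 0)
      rw [mul_comm, ← div_eq_mul_inv, ENNReal.le_div_iff_mul_le (Or.inl h10)
        (Or.inl (ENNReal.natCast_ne_top _)), one_mul]
      simp only [hw]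
      exact_mod_cast h1.le
  rw [estimate, sem, expect_bind]
  refine (expect_mono hpoint).trans ?_
  rw [expect_add, expect_const_mul, expect_const_mul]
  refine add_le_add ?_ ?_
  · refine (mul_le_mul_right (expect_drawStarts_sum_le hn hs.vertices hs.samples w) _).trans ?_
    push_cast
    rw [ENNReal.mul_inv (by simp) (Or.inr hr0), ENNReal.mul_inv (by simp) (by simp),
      ENNReal.mul_inv (by simp) (Or.inr hr0), ENNReal.mul_inv (by simp) (by simp), div_eq_mul_inv]
    calc (10 : ℝ≥0∞)⁻¹ * (N : ℝ≥0∞)⁻¹ * (r : ℝ≥0∞)⁻¹ *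
          (N * ((∑ v ∈ Finset.range n, w v) * (n : ℝ≥0∞)⁻¹))
        = ((N : ℝ≥0∞) * (N : ℝ≥0∞)⁻¹) * ((∑ v ∈ Finset.range n, w v) *
          ((10 : ℝ≥0∞)⁻¹ * (n : ℝ≥0∞)⁻¹ * (r : ℝ≥0∞)⁻¹)) := by ring
      _ = _ := by rw [ENNReal.mul_inv_cancel hN0 (ENNReal.natCast_ne_top N), one_mul]
      _ ≤ _ := le_rfl
  · refine (mul_le_mul_right (expect_drawStarts_sq_le hn hs.vertices hs.samples z
      (sum_deviation hq hcap f) (deviation_sq_le hq hcap f)) _).trans ?_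
    rw [ENNReal.ofReal_mul (Nat.cast_nonneg N), ENNReal.ofReal_pow (Nat.cast_nonneg n),
      ENNReal.ofReal_natCast, ENNReal.ofReal_natCast, div_eq_mul_inv, div_eq_mul_inv,
      ENNReal.mul_inv (by simp) (by simp)]
    have h1 := ENNReal.mul_inv_cancel (a := (n : ℝ≥0∞) ^ 2) (by positivity) (by finiteness)
    have h2 := ENNReal.mul_inv_cancel hN0 (ENNReal.natCast_ne_top N)
    have h3 : ((N : ℝ≥0∞) ^ 2)⁻¹ = (N : ℝ≥0∞)⁻¹ * (N : ℝ≥0∞)⁻¹ := by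
      rw [sq, ENNReal.mul_inv (by simp) (by simp)]
    rw [h3]
    calc (L : ℝ≥0∞) * (((n : ℝ≥0∞) ^ 2)⁻¹ * ((N : ℝ≥0∞)⁻¹ * (N : ℝ≥0∞)⁻¹)) *
          (N * (n : ℝ≥0∞) ^ 2)
        = ((n : ℝ≥0∞) ^ 2 * ((n : ℝ≥0∞) ^ 2)⁻¹) * ((N : ℝ≥0∞) * (N : ℝ≥0∞)⁻¹) *
          (L * (N : ℝ≥0∞)⁻¹) := by ring
      _ = _ := by rw [h1, h2, one_mul, one_mul]
      _ ≤ _ := le_rfl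

open Classical in
/-- The ranks may be taken to be drawn in advance, so that the failure probability is the average of
the failure probabilities for fixed ranks. -/
theorem expect_estimate_le (hn : 0 < n) (hN : 0 < N) (hr : 0 < r)
    (hs : EstimateStart n cap m N r A s) (hw : Within cap κ s) (hsafe : estimate.Safe cap κ)
    (hm : κ Reg.maxRank = some m) (hranks : ∀ i, s.arr Arr.ranks i = 0) {good : ℕ → Prop}
    (hgood : ∀ f : Fin (cap + 1) → Fin (m + 1),
      Set.InjOn (EdgeCode.tableKey f) (residualGraph A hq hcap).edgeCodes → ∀ V : ℕ → ℕ,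
      L * (∑ i ∈ Finset.range N, deviation hq hcap A f (V i)) ^ 2 ≤ (n : ℝ) ^ 2 * N ^ 2 →
      good (estimateValue hq hcap A f N (s.var Reg.size) V)) :
    expect (estimate.sem q s) (fun s' => if good (s'.var Reg.size) then 0 else 1) ≤
      (n ^ 4 : ℕ) / (m + 1 : ℕ) +
        (residualDegree q n 0 s : ℝ≥0∞) * ((10 * n * r : ℕ) : ℝ≥0∞)⁻¹ + L / N := by
  have hcap1 : 1 ≤ cap := hN.trans_le hs.samples_le
  rw [(estimate_commutes hcap1 hsafe hm (by have := hs.maxRank_le; omega) hw).expect_eq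
    (fun f s' => rfl), ← expect_uniformOfFintype (α := Fin (cap + 1) → Fin (m + 1))
      (fun f => expect (estimate.sem q (fillTable Arr.ranks f s)) _)]
  have hle : ∀ f : Fin (cap + 1) → Fin (m + 1),
      expect (estimate.sem q (fillTable Arr.ranks f s))
        (fun s' => if good (s'.var Reg.size) then 0 else 1) ≤
      (if Set.InjOn (EdgeCode.tableKey f) (residualGraph A hq hcap).edgeCodes then 0 else 1) +
        ((10 * n * r : ℕ) : ℝ≥0∞)⁻¹ *
          (if Set.InjOn (EdgeCode.tableKey f) (residualGraph A hq hcap).edgeCodes then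
            ∑ v ∈ Finset.range n, (walkCount hq hcap A f v : ℝ≥0∞) else 0) + L / N := by
    intro f
    by_cases hinj : Set.InjOn (EdgeCode.tableKey f) (residualGraph A hq hcap).edgeCodes
    · rw [if_pos hinj, if_pos hinj, zero_add, mul_comm]
      refine expect_estimate_le_of_injOn hq hcap hn hN hr ?_ ?_ hinj (hgood f hinj)
      · obtain ⟨h1, h2, h3, h4, h5, h6, h7, h8, h9⟩ := hs
        exact ⟨h1, h2, h3, h4, h5, (fillTable_arr_of_ne (by simp) f s).trans h6, h7, h8, h9⟩
      · intro e
        rw [fillTable_arr_self, if_pos (hranks _), dif_pos e.isLt]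
        rfl
    · rw [if_neg hinj, if_neg hinj, mul_zero, add_zero]
      exact (expect_le_of_le fun s' _ => by split <;> simp).trans le_self_add
  refine (expect_mono fun f _ => hle f).trans ?_
  rw [expect_add, expect_add, expect_const_mul, expect_const,
    mul_comm (residualDegree q n 0 s : ℝ≥0∞)]
  gcongr
  · exact expect_not_injOn_le hq hcap
  · exact expect_walkCount_le hq hcap s hs.matched

end EstimateBound

/-! ### A good estimate is close to the size of a maximal matching -/

theorem isOracle_pairOracle {n : ℕ} (G : SimpleGraph (Fin n)) : IsOracle (pairOracle G) n where
  symm := pairOracle_comm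
  lt h := (pairOracle_eq_true.1 h).1

section Accuracy

variable {n cap m N : ℕ} {G : SimpleGraph (Fin n)} {s : State}

/-- The greedy matching of the residual graph, as a subgraph. -/
def greedySubgraph (G : SimpleGraph (Fin n)) (hcap : n * n ≤ cap) (A : ℕ → ℕ)
    (f : Fin (cap + 1) → Fin (m + 1)) : G.Subgraph where
  verts := {v | (residualGraph A (isOracle_pairOracle G) hcap).IsMatched (EdgeCode.tableKey f) v}
  Adj a b := (residualGraph A (isOracle_pairOracle G) hcap).adj a b ∧
    (residualGraph A (isOracle_pairOracle G) hcap).Selected (EdgeCode.tableKey f) a b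
  adj_sub h := by
    obtain ⟨_, _, h⟩ := pairOracle_eq_true.1 h.1.1
    exact h
  edge_vert h := ⟨_, h⟩
  symm := ⟨fun _ _ h => ⟨EdgeCode.symm _ h.1, EdgeCode.selected_comm.1 h.2⟩⟩

theorem greedySubgraph_isMatching (hcap : n * n ≤ cap) {A : ℕ → ℕ}
    {f : Fin (cap + 1) → Fin (m + 1)} (hinj : Set.InjOn (EdgeCode.tableKey f)
      (residualGraph A (isOracle_pairOracle G) hcap).edgeCodes) :
    (greedySubgraph G hcap A f).IsMatching := by
  rintro v ⟨y, hy, hs⟩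
  refine ⟨⟨y, (adj_lt _ hcap _ _ hy).2⟩, ⟨hy, hs⟩, fun w hw => Fin.ext ?_⟩
  exact EdgeCode.Selected.eq_of_adj hinj hw.1 hy hw.2 hs

/-- The matching that has been built and the greedy matching of the residual graph form a maximal
matching. -/
theorem Represents.exists_isMaximalMatching (h : Represents s G) (hcap : n * n ≤ cap)
    {f : Fin (cap + 1) → Fin (m + 1)} (hinj : Set.InjOn (EdgeCode.tableKey f)
      (residualGraph (s.arr Arr.matched) (isOracle_pairOracle G) hcap).edgeCodes) :
    ∃ M : G.Subgraph, IsMaximalMatching M ∧ 2 * M.edgeSet.ncard = 2 * s.var Reg.size +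
      ∑ v ∈ Finset.range n,
        matchedIndicator (isOracle_pairOracle G) hcap (s.arr Arr.matched) f v := by
  classical
  obtain ⟨M, hM, hverts, hsize⟩ := h
  set A := s.arr Arr.matched
  set M' := greedySubgraph G hcap A f with hM'def
  have hM' : M'.IsMatching := greedySubgraph_isMatching hcap hinj
  have hdisj : Disjoint M.verts M'.verts := by
    rw [Set.disjoint_left]
    rintro v hv ⟨y, hy, -⟩
    exact (hverts v).1 hv hy.2.1
  obtain ⟨h1, h2⟩ := hM.sup_of_disjoint hM' hdisj
  refine ⟨M ⊔ M', isMaximalMatching_of_forall_adj h1 fun a b hab => ?_, ?_⟩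
  · simp only [SimpleGraph.Subgraph.verts_sup, Set.mem_union]
    by_cases ha : A a = 0
    · by_cases hb : A b = 0
      · have hadj : (residualGraph A (isOracle_pairOracle G) hcap).adj a b :=
          ⟨pairOracle_eq_true.2 ⟨a.isLt, b.isLt, hab⟩, ha, hb⟩
        obtain ⟨y, hy | hy⟩ := EdgeCode.exists_selected_of_adj (EdgeCode.tableKey f) hadj
        · exact Or.inl (Or.inr ⟨y, hy⟩)
        · exact Or.inr (Or.inr ⟨y, hy⟩)
      · exact Or.inr (Or.inl ((hverts b).2 hb))
    · exact Or.inl (Or.inl ((hverts a).2 ha))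
  · have h3 : M'.verts.ncard = ∑ v ∈ Finset.range n,
        matchedIndicator (isOracle_pairOracle G) hcap A f v := by
      rw [Finset.sum_range]
      simp only [matchedIndicator]
      rw [← Finset.card_filter, ← Set.ncard_coe_finset]
      congr 1
      ext v
      simp [hM'def, greedySubgraph]
    rw [h2, mul_add, hM'.two_mul_ncard_edgeSet, h3, hsize]

theorem Represents.two_mul_size_le (h : Represents s G) : 2 * s.var Reg.size ≤ n := by
  obtain ⟨M, hM, -, hsize⟩ := h
  rw [hsize]
  exact hM.two_mul_ncard_edgeSet_le

/-- Representative samples give an accurate estimate. -/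
theorem Represents.exists_abs_sub_le (h : Represents s G) (hcap : n * n ≤ cap)
    {f : Fin (cap + 1) → Fin (m + 1)} (hinj : Set.InjOn (EdgeCode.tableKey f)
      (residualGraph (s.arr Arr.matched) (isOracle_pairOracle G) hcap).edgeCodes)
    {ε : ℝ} (hε : 0 < ε) {L : ℕ} (hL : 1 ≤ ε ^ 2 * L) (hLn : L ≤ n) (hn : 4 ≤ n) (hN : 0 < N)
    {V : ℕ → ℕ} (hV : L * (∑ i ∈ Finset.range N, deviation (isOracle_pairOracle G) hcap
      (s.arr Arr.matched) f (V i)) ^ 2 ≤ (n : ℝ) ^ 2 * N ^ 2) :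
    ∃ M : G.Subgraph, IsMaximalMatching M ∧
      |(estimateValue (isOracle_pairOracle G) hcap (s.arr Arr.matched) f N (s.var Reg.size) V : ℝ) -
        (M.edgeSet.ncard : ℝ)| ≤ ε * n := by
  obtain ⟨M, hM, hcard⟩ := h.exists_isMaximalMatching hcap hinj
  refine ⟨M, hM, ?_⟩
  have hsize := h.two_mul_size_le
  set X := ∑ i ∈ Finset.range N,
    matchedIndicator (isOracle_pairOracle G) hcap (s.arr Arr.matched) f (V i) with hX
  set Y := ∑ v ∈ Finset.range n,
    matchedIndicator (isOracle_pairOracle G) hcap (s.arr Arr.matched) f v with hY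
  have hXN : X ≤ N := by
    refine (Finset.sum_le_card_nsmul _ _ 1 fun i _ => matchedIndicator_le_one _ hcap _).trans ?_
    simp
  have hsum : ∑ i ∈ Finset.range N, deviation (isOracle_pairOracle G) hcap
      (s.arr Arr.matched) f (V i) = n * X - N * Y := by
    simp only [deviation, Finset.sum_sub_distrib, ← Finset.mul_sum, Finset.sum_const,
      Finset.card_range, nsmul_eq_mul, hX, hY]
    push_cast
    ring
  rw [hsum] at hV
  -- the floor changes the estimate by less than one
  set D := n * X / (2 * N) with hD
  have hD1 : D * (2 * N) ≤ n * X := Nat.div_mul_le_self _ _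
  have hD2 : n * X < (D + 1) * (2 * N) := by
    have := Nat.lt_mul_div_succ (n * X) (b := 2 * N) (by omega)
    rw [← hD] at this
    linarith
  have hDn : 2 * D ≤ n := by
    have : D * 2 * N ≤ n * N := by
      have := Nat.mul_le_mul_left n hXN
      nlinarith
    have := Nat.le_of_mul_le_mul_right this hN
    omega
  have hval : estimateValue (isOracle_pairOracle G) hcap (s.arr Arr.matched) f N
      (s.var Reg.size) V = s.var Reg.size + D := by
    simp only [estimateValue]
    rw [← hX, ← hD]
    refine min_eq_left ?_
    nlinarith
  rw [hval]
  have hNR : (0 : ℝ) < N := by exact_mod_cast hN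
  have hnR : (4 : ℝ) ≤ n := by exact_mod_cast hn
  have hLnR : (L : ℝ) ≤ n := by exact_mod_cast hLn
  have hD1R : (D : ℝ) * (2 * N) ≤ n * X := by exact_mod_cast hD1
  have hD2R : (n : ℝ) * X < (D + 1) * (2 * N) := by exact_mod_cast hD2
  have hcardR : 2 * (M.edgeSet.ncard : ℝ) = 2 * (s.var Reg.size : ℝ) + Y := by exact_mod_cast hcard
  have hdev : |(n : ℝ) * X - N * Y| ≤ ε * n * N := by
    refine abs_le_of_sq_le_sq ?_ (by positivity)
    have h1 : ((n : ℝ) * X - N * Y) ^ 2 ≤ ε ^ 2 * L * ((n : ℝ) * X - N * Y) ^ 2 :=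
      le_mul_of_one_le_left (sq_nonneg _) hL
    calc ((n : ℝ) * X - N * Y) ^ 2 ≤ ε ^ 2 * (L * ((n : ℝ) * X - N * Y) ^ 2) := by linarith
      _ ≤ ε ^ 2 * ((n : ℝ) ^ 2 * N ^ 2) := by gcongr
      _ = (ε * n * N) ^ 2 := by ring
  have hεn : 2 ≤ ε * n := by
    refine le_of_sq_le_sq ?_ (by positivity)
    have h1 : ε ^ 2 * L ≤ ε ^ 2 * n := by gcongr
    have h2 : 1 * (n : ℝ) ≤ ε ^ 2 * n * n := by gcongr; linarith
    nlinarith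
  rw [abs_le] at hdev ⊢
  push_cast
  constructor
  · refine le_of_mul_le_mul_right ?_ (mul_pos two_pos hNR)
    nlinarith [mul_le_mul_of_nonneg_right hεn hNR.le]
  · refine le_of_mul_le_mul_right ?_ (mul_pos two_pos hNR)
    nlinarith [mul_le_mul_of_nonneg_right hεn hNR.le]

end Accuracy

/-! ### The sublinear program -/

/-- The square of the number of vertices. -/
def sqVertices : Expr := .bin .mul (.var Reg.vertices) (.var Reg.vertices)

/-- Compute the parameters; `Reg.root` is increased until its square is at least `n`. The expected
number of edges that the explorations look at is at most the product of the number of samples and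
`Reg.root`. The budget allows for ten times as many, two steps for each, and one more step for each
sample. There are `n ^ 6` ranks, against at most `n ^ 4` pairs of edges that might get equal
ones. -/
def setup (L : ℕ) : Stmt :=
  rep Reg.outer Reg.vertices
    (ite (.bin .lt (.bin .mul (.var Reg.root) (.var Reg.root)) (.var Reg.vertices))
      (assign Reg.root (.clamp (.bin .add (.var Reg.root) (.lit 1)))) skip);;
  assign Reg.samples (.lit (10 * L));;
  assign Reg.budget (.clamp (.bin .mul (.bin .mul (.lit 30) (.var Reg.samples)) (.var Reg.root)));;
  assign Reg.maxRank (.clamp (.bin .sub (.bin .mul (.bin .mul sqVertices sqVertices) sqVertices)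
    (.lit 1)))

/-- Build a matching from random pairs, so that the graph on the unmatched vertices is sparse, and
estimate the size of a greedy matching of this graph. -/
def approximate (L : ℕ) : Stmt := setup L;; greedyRandom;; estimate

/-- The constants during the computation of the parameters. -/
def setupConst (n : ℕ) : ℕ → Option ℕ
  | 0 => some n
  | _ => none

/-- The constants after the computation of the parameters. -/
def mainConst (n r N Q m : ℕ) : ℕ → Option ℕ
  | 0 => some n
  | 2 => some r
  | 4 => some N
  | 5 => some Q
  | 6 => some m
  | _ => none


theorem setup_safe {n L cap : ℕ} (h1 : 30 ≤ cap) (h2 : 10 * L ≤ cap) :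
    (setup L).Safe cap (setupConst n) := by
  have : 1 ≤ cap := by omega
  simp [setup, Safe, setupConst, Keeps, Expr.LitsLe, Expr.Capped, sqVertices, *]

theorem greedyAll_safe {n cap : ℕ} (h : 1 ≤ cap) : greedyAll.Safe cap (setupConst n) := by
  simp [greedyAll, tryMatch, Safe, setupConst, Keeps, Expr.LitsLe, Expr.Capped, *]

theorem greedyRandom_safe {n r N Q m cap : ℕ} (h : 1 ≤ cap) :
    greedyRandom.Safe cap (mainConst n r N Q m) := by
  simp [greedyRandom, tryMatch, Safe, mainConst, Keeps, Expr.LitsLe, Expr.Capped, *]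

theorem estimate_safe {n r N Q m cap : ℕ} (h : 2 ≤ cap) :
    estimate.Safe cap (mainConst n r N Q m) := by
  have : 1 ≤ cap := by omega
  simp [estimate, explore, drawStarts, drawStart, finalize, initExplore, exploreStep, loadTop,
    scan, pushWalk, nextSample, lookup, Safe, mainConst, Keeps, Expr.LitsLe, Expr.Capped, *]

theorem setup_time_le {n L : ℕ} (hn : 1 ≤ n) : (setup L).time (setupConst n) ≤ 200 * n := by
  simp only [setup, Stmt.time, setupConst, Expr.weight, Expr.leaves, sqVertices, Expr.clamp,
    Option.getD_some]
  linarith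

theorem greedyAll_time_le {n : ℕ} (hn : 1 ≤ n) :
    greedyAll.time (setupConst n) ≤ 61 * (n * n) := by
  simp only [greedyAll, tryMatch, Stmt.time, setupConst, Expr.weight, Expr.leaves, Expr.clamp,
    Option.getD_some]
  nlinarith [Nat.le_mul_self n]

theorem greedyRandom_time_le {n r N Q m : ℕ} (hn : 1 ≤ n) (hr : 1 ≤ r) :
    greedyRandom.time (mainConst n r N Q m) ≤ 66 * (n * r) := by
  simp only [greedyRandom, tryMatch, Stmt.time, mainConst, Expr.weight, Expr.leaves, Expr.clamp,
    Option.getD_some]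
  nlinarith [Nat.le_mul_of_pos_right n hr]

theorem estimate_time_le {n r N Q m : ℕ} (hn : 1 ≤ n) (hN : 1 ≤ N) (hQ : N ≤ Q) :
    estimate.time (mainConst n r N Q m) ≤ 376 * (Q * n) := by
  simp only [estimate, explore, drawStarts, drawStart, finalize, initExplore, exploreStep,
    loadTop, scan, pushWalk, nextSample, lookup, Stmt.time, mainConst, Expr.weight, Expr.leaves,
    Expr.clamp, Option.getD_some]
  nlinarith [Nat.le_mul_of_pos_right Q hn]

/-- The square root of `n`, rounded to an integer that is large enough. -/
def rootOf (n : ℕ) : ℕ := Nat.sqrt (n - 1) + 1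

theorem le_rootOf_mul_self (n : ℕ) : n ≤ rootOf n * rootOf n := by
  have := Nat.lt_succ_sqrt (n - 1)
  simp only [rootOf, Nat.succ_eq_add_one] at *
  omega

theorem rootOf_le {n : ℕ} (hn : 1 ≤ n) : rootOf n ≤ n := by
  have := Nat.sqrt_le_self (n - 1)
  simp only [rootOf]
  omega

theorem setup_ensures {q : ℕ → ℕ → Bool} {n cap L : ℕ} {s : State} (hn : 1 ≤ n)
    (hs : s.var Reg.vertices = n) (hroot : s.var Reg.root = 0) (hc : s.var capVar = cap)
    (hncap : n ^ 6 ≤ cap) (hL : 300 * L * rootOf n ≤ cap) :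
    (setup L).Ensures q s fun s' => s'.var Reg.vertices = n ∧ s'.var capVar = cap ∧
      s'.var Reg.root = rootOf n ∧ s'.var Reg.samples = 10 * L ∧
      s'.var Reg.budget = 30 * (10 * L) * rootOf n ∧ s'.var Reg.maxRank = n ^ 6 - 1 := by
  have hncap' : n ≤ cap := (Nat.le_self_pow (by norm_num) n).trans hncap
  simp only [Reg.vertices, capVar, Reg.root] at hs hc hroot
  rw [setup, ensures_seq]
  refine ensures_rep (fun i s' => s'.var 0 = n ∧ s'.var 3 = cap ∧ s'.var 2 = min (n - i) (rootOf n))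
    ?_ (by simp [hs, hc, hroot]) ?_
  · rintro i hi s₁ ⟨h0, h3, h2⟩
    simp only [Reg.vertices, hs] at hi
    have hkey : s₁.var 2 * s₁.var 2 < n ↔ s₁.var 2 < rootOf n := by
      rw [rootOf, Nat.lt_succ_iff, Nat.le_sqrt]
      omega
    rw [ensures_ite]
    simp only [Expr.eval, Op.eval, Reg.root, Reg.vertices, Reg.outer, State.setVar_var]
    norm_num only [if_true, if_false]
    rw [h0]
    have hle := rootOf_le hn
    by_cases h : s₁.var 2 < rootOf n
    · simp only [hkey.2 h, if_true, ne_eq, one_ne_zero, not_false_eq_true, ensures_assign,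
        State.setVar_var, Expr.eval_clamp, Expr.eval, Op.eval]
      norm_num only [if_true, if_false]
      refine ⟨h0, h3, ?_⟩
      omega
    · simp only [mt hkey.1 h, if_false, ne_eq, not_true_eq_false, ensures_skip, State.setVar_var]
      norm_num only [if_true, if_false]
      refine ⟨h0, h3, ?_⟩
      omega
  · rintro s₁ ⟨h0, h3, h2⟩
    rw [Nat.sub_zero, min_eq_right (rootOf_le hn)] at h2
    simp only [ensures_seq, ensures_assign, State.setVar_var, Expr.eval_clamp, Expr.eval, Op.eval,
      sqVertices, Reg.vertices, Reg.root, Reg.samples, Reg.budget, Reg.maxRank, capVar]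
    norm_num only [if_true, if_false]
    rw [h0, h2, h3]
    refine ⟨rfl, rfl, rfl, trivial, min_eq_left ?_, ?_⟩
    · linarith
    · rw [show n * n * (n * n) * (n * n) = n ^ 6 by ring]
      omega

/-! ### Success probability -/

/-- The state after the largest number has been stored in `capVar`. -/
def prepared (n : ℕ) : State := (initial n).setVar capVar (n ^ 8)

theorem prepared_within (n : ℕ) : Within (n ^ 8) (setupConst n) (prepared n) where
  var_le x := by
    have : n ≤ n ^ 8 := Nat.le_self_pow (by norm_num) n
    simp only [prepared, initial, State.setVar_var]
    split
    · exact le_rfl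
    · split <;> omega
  arr_le a i := Nat.zero_le _
  const x k h := by
    rcases x with _ | x
    · simpa [setupConst, prepared, initial] using h
    · simp [setupConst] at h
  var_cap := by simp [prepared]

theorem prepared_represents {n : ℕ} (G : SimpleGraph (Fin n)) : Represents (prepared n) G :=
  ⟨⊥, fun v hv => by simp at hv, by simp [prepared, initial], by simp [prepared, initial]⟩

/-- The number `x` differs from the size of some maximal matching by at most `ε * n`. -/
def IsEstimate {n : ℕ} (G : SimpleGraph (Fin n)) (ε : ℝ) (x : ℕ) : Prop :=
  ∃ M : G.Subgraph, IsMaximalMatching M ∧ |(x : ℝ) - (M.edgeSet.ncard : ℝ)| ≤ ε * n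

section Success

variable {n L : ℕ} {G : SimpleGraph (Fin n)} {ε : ℝ}

theorem approximate_setup_ensures (q : ℕ → ℕ → Bool) (hn : 26 ≤ n) (hLn : L ≤ n) :
    (setup L).Ensures q (prepared n) fun s =>
      Within (n ^ 8) (mainConst n (rootOf n) (10 * L) (30 * (10 * L) * rootOf n) (n ^ 6 - 1)) s ∧
        s.arr = (prepared n).arr ∧ s.var Reg.size = 0 := by
  have hn1 : 1 ≤ n := by omega
  have h300 : 300 ≤ n ^ 6 :=
    (by norm_num : 300 ≤ 26 ^ 6).trans (Nat.pow_le_pow_left hn 6)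
  have hcap : n ^ 8 = n ^ 6 * (n * n) := by ring
  have hLr : L * rootOf n ≤ n * n := Nat.mul_le_mul hLn (rootOf_le hn1)
  have hbud : 300 * L * rootOf n ≤ n ^ 8 := by
    rw [hcap, mul_assoc]
    exact Nat.mul_le_mul h300 hLr
  have h68 : n ^ 6 ≤ n ^ 8 := Nat.pow_le_pow_right hn1 (by norm_num)
  have h10 : 10 * L ≤ n ^ 8 := by
    have : L ≤ L * rootOf n := Nat.le_mul_of_pos_right L (Nat.succ_pos _)
    linarith
  intro s hs
  have hsafe := setup_safe (n := n) (L := L) (cap := n ^ 8) (by omega) h10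
  have hw := hsafe.ensures (by omega) (prepared_within n) s hs
  obtain ⟨h0, -, h2, h4, h5, h6⟩ := setup_ensures (s := prepared n) (cap := n ^ 8) hn1
    (by simp [prepared, initial]) (by simp [prepared, initial]) (by simp [prepared, initial])
    h68 hbud s hs
  refine ⟨⟨hw.var_le, hw.arr_le, ?_, hw.var_cap⟩, ?_, ?_⟩
  · intro x k h
    simp only [Reg.vertices, Reg.root, Reg.samples, Reg.budget, Reg.maxRank] at h0 h2 h4 h5 h6
    simp only [mainConst] at h
    split at h <;> simp_all
  · funext a
    exact KeepsArr.ensures (P := setup L) (by simp [setup, KeepsArr]) q _ s hs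
  · rw [Keeps.ensures (P := setup L) (x := Reg.size) (by simp [setup, Keeps]) q _ s hs]
    simp [prepared, initial]

open Classical in
/-- Equal ranks, an exhausted budget, and unrepresentative samples each contribute at most `1 / 10`
to the failure probability. -/
theorem expect_approximate_le (hε : 0 < ε) (hL : 1 ≤ ε ^ 2 * L) (hL0 : 0 < L) (hLn : L ≤ n)
    (hn : 26 ≤ n) :
    expect ((approximate L).sem (pairOracle G) (prepared n)) (fun s =>
      if IsEstimate G ε (s.var Reg.size) then 0 else 1) ≤ 3⁻¹ := by
  have hn1 : 1 ≤ n := by omega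
  obtain ⟨cap, hcapdef⟩ : ∃ cap, cap = n ^ 8 := ⟨_, rfl⟩
  obtain ⟨r, hr⟩ : ∃ r, r = rootOf n := ⟨_, rfl⟩
  obtain ⟨m, hm⟩ : ∃ m, m = n ^ 6 - 1 := ⟨_, rfl⟩
  set κ := mainConst n r (10 * L) (30 * (10 * L) * r) m with hκ
  have h6 : 26 ≤ n ^ 6 := hn.trans (Nat.le_self_pow (by norm_num) n)
  have hcap6 : cap = n ^ 6 * (n * n) := by rw [hcapdef]; ring
  have hnn : n * n ≤ cap := by
    rw [hcap6]
    exact Nat.le_mul_of_pos_left _ (by omega)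
  have hm2 : m + 2 ≤ cap := by
    rw [hcap6]
    have : n ^ 6 * 2 ≤ n ^ 6 * (n * n) := Nat.mul_le_mul_left _ (by nlinarith)
    omega
  have hn0 : (n : ℝ≥0∞) ≠ 0 := by exact_mod_cast (by omega : n ≠ 0)
  have hrpos : 0 < r := hr ▸ Nat.succ_pos _
  have hr0 : (r : ℝ≥0∞) ≠ 0 := by exact_mod_cast hrpos.ne'
  have hL0' : (L : ℝ≥0∞) ≠ 0 := by exact_mod_cast hL0.ne'
  rw [approximate, sem, expect_bind]
  refine expect_le_of_le fun s₁ hs₁ => ?_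
  obtain ⟨hw, harr, hsize⟩ := approximate_setup_ensures (pairOracle G) hn hLn s₁ hs₁
  rw [← hcapdef, ← hr, ← hm, ← hκ] at hw
  have hrep : Represents s₁ G := by
    obtain ⟨M, h1, h2, h3⟩ := prepared_represents G
    refine ⟨M, h1, by rw [harr]; exact h2, ?_⟩
    rw [hsize, ← h3]
    simp [prepared, initial]
  rw [sem, expect_bind]
  have hbound : ∀ s₂ ∈ (greedyRandom.sem (pairOracle G) s₁).support,
      expect (estimate.sem (pairOracle G) s₂) (fun s =>
        if IsEstimate G ε (s.var Reg.size) then 0 else 1) ≤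
      (n ^ 4 : ℕ) / (m + 1 : ℕ) + ((10 * n * r : ℕ) : ℝ≥0∞)⁻¹ *
        (residualDegree (pairOracle G) n 0 s₂ : ℝ≥0∞) + L / (10 * L : ℕ) := by
    intro s₂ hs₂
    have hw₂ : Within cap κ s₂ := (greedyRandom_safe (by omega)).ensures (by omega) hw s₂ hs₂
    have hrep₂ : Represents s₂ G :=
      greedyRandom_ensures hrep (by rw [hw.var_cap]; nlinarith) s₂ hs₂
    have hcell := KeepsArr.ensures (P := greedyRandom) (a := Arr.ranks)
      (by simp [greedyRandom, tryMatch, KeepsArr]) (pairOracle G) s₁ s₂ hs₂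
    rw [mul_comm _ (residualDegree (pairOracle G) n 0 s₂ : ℝ≥0∞)]
    have e4 : s₂.var Reg.samples = 10 * L := hw₂.const _ _ rfl
    have e5 : s₂.var Reg.budget = 30 * (10 * L) * r := hw₂.const _ _ rfl
    have hstart : EstimateStart n cap m (10 * L) r (s₂.arr Arr.matched) s₂ :=
      ⟨hw₂.const _ _ rfl, hw₂.var_cap, e4, e5, hw₂.const _ _ rfl, rfl, e4 ▸ hw₂.var_le _, hm2,
        e5 ▸ hw₂.var_le _⟩
    have h1 : ∀ i, s₂.arr Arr.ranks i = 0 := by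
      intro i
      rw [hcell, harr]
      simp [prepared, initial]
    exact expect_estimate_le (L := L) (isOracle_pairOracle G) hnn (by omega) (by omega) hrpos
      hstart hw₂ (estimate_safe (by omega)) rfl h1 (good := IsEstimate G ε)
      fun f hinj V hV =>
        hrep₂.exists_abs_sub_le hnn hinj hε hL hLn (by omega) (by omega) hV
  refine (expect_mono hbound).trans ?_
  rw [expect_add, expect_add, expect_const, expect_const, expect_const_mul]
  have hres := expect_residualDegree_le (q := pairOracle G) (r := r) (by omega : 0 < n)
    (hr ▸ le_rootOf_mul_self n) (hw.const _ _ rfl : s₁.var Reg.vertices = n) (hw.const _ _ rfl)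
  have b1 : ((n ^ 4 : ℕ) : ℝ≥0∞) / (m + 1 : ℕ) ≤ 10⁻¹ := by
    have e : m + 1 = n ^ 4 * (n * n) := by
      rw [hm, Nat.sub_add_cancel (by omega)]
      ring
    rw [e]
    push_cast
    rw [ENNReal.div_le_iff (by positivity) (by finiteness), ← mul_assoc, mul_comm (10⁻¹ : ℝ≥0∞),
      mul_assoc]
    refine le_mul_of_one_le_right zero_le ?_
    rw [← ENNReal.div_eq_inv_mul, ENNReal.le_div_iff_mul_le (by simp) (by simp), one_mul]
    exact_mod_cast (by nlinarith : 10 ≤ n * n)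
  have b2 : ((10 * n * r : ℕ) : ℝ≥0∞)⁻¹ *
      expect (greedyRandom.sem (pairOracle G) s₁) (fun s₂ =>
        (residualDegree (pairOracle G) n 0 s₂ : ℝ≥0∞)) ≤ 10⁻¹ := by
    refine (mul_le_mul_right hres _).trans ?_
    rw [← ENNReal.div_eq_inv_mul]
    push_cast
    rw [ENNReal.div_le_iff (by positivity) (by finiteness), mul_assoc, ← mul_assoc (10⁻¹ : ℝ≥0∞),
      ENNReal.inv_mul_cancel (by simp) (by simp), one_mul]
  have b3 : (L : ℝ≥0∞) / (10 * L : ℕ) ≤ 10⁻¹ := by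
    push_cast
    rw [ENNReal.div_le_iff (by positivity) (by finiteness), ← mul_assoc,
      ENNReal.inv_mul_cancel (by simp) (by simp), one_mul]
  refine (add_le_add (add_le_add b1 b2) b3).trans ?_
  rw [ENNReal.le_inv_iff_mul_le, show (10⁻¹ + 10⁻¹ + 10⁻¹ : ℝ≥0∞) * 3 = 9 / 10 by
    rw [div_eq_mul_inv]; ring]
  exact ENNReal.div_le_of_le_mul (by norm_num)

open Classical in
theorem expect_greedyAll_eq_zero (hε : 0 < ε) (hn : 1 ≤ n) :
    expect (greedyAll.sem (pairOracle G) (prepared n)) (fun s =>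
      if IsEstimate G ε (s.var Reg.size) then 0 else 1) = 0 := by
  refine le_antisymm (expect_le_of_le fun s hs => ?_) zero_le
  obtain ⟨⟨M, hM, hverts, hsize⟩, hcov⟩ := greedyAll_ensures (prepared_represents G)
    (by simp [prepared, initial])
    (by rw [(prepared_within n).var_cap]; exact Nat.le_self_pow (by norm_num) n) s hs
  rw [if_pos]
  refine ⟨M, isMaximalMatching_of_forall_adj hM fun a b hab => ?_, ?_⟩
  · rw [hverts, hverts]
    exact hcov a b (pairOracle_eq_true.2 ⟨a.isLt, b.isLt, hab⟩)
  · rw [hsize, sub_self, abs_zero]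
    positivity

end Success

/-! ### The complete program and its running time -/

/-- The eighth power of the number of vertices. -/
def eighthPower : Expr :=
  .bin .mul (.bin .mul sqVertices sqVertices) (.bin .mul sqVertices sqVertices)

/-- If the number of vertices is at most `L * L`, then all pairs are treated; otherwise the size of
a maximal matching is estimated. For `n = 0`, where the time bound does not depend on `ε`, the
literal `L * L` is not evaluated. -/
def program (L : ℕ) : Prog :=
  .ite (.var Reg.vertices)
    (.seq (.assign capVar eighthPower)
      (.ite (.bin .lt (.lit (L * L)) (.var Reg.vertices)) (approximate L).compile
        greedyAll.compile))
    .skip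

/-- Distribution of the final state of the program for a graph with at least one vertex. -/
noncomputable def programSem {n : ℕ} (G : SimpleGraph (Fin n)) (L : ℕ) : PMF State :=
  if L * L < n then (approximate L).sem (pairOracle G) (prepared n)
  else greedyAll.sem (pairOracle G) (prepared n)

theorem implements_finish_andThen {s : State} {f : State → PMF Outcome} {ν : PMF State}
    {t T T' : ℕ} (h : Implements (f s) ν T) (ht : t ≤ T') :
    Implements (andThen (finish t s) f) ν (T' + T) := by
  have := (implements_finish ht s).andThen (g := fun _ => ν) (T' := T) (f := f) (by simpa using h)
  rwa [PMF.pure_bind] at this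

section Time

variable {n L : ℕ} {G : SimpleGraph (Fin n)}

theorem approximate_implements (q : ℕ → ℕ → Bool) (hn : 26 ≤ n) (hL : 0 < L) (hLn : L ≤ n) :
    Implements ((approximate L).compile.exec q (n ^ 8) (prepared n))
      ((approximate L).sem q (prepared n)) (113066 * (L * rootOf n * n) * ((n ^ 8).size + 1)) := by
  have hn1 : 1 ≤ n := by omega
  have h1 : n ≤ n ^ 8 := Nat.le_self_pow (by norm_num) n
  have h2 : 900 ≤ n ^ 8 := (by norm_num : 900 ≤ 26 ^ 8).trans (Nat.pow_le_pow_left hn 8)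
  have h10 : 10 * L ≤ n ^ 8 := by
    have : n * 10 ≤ n * n ^ 7 :=
      Nat.mul_le_mul_left n ((by norm_num : 10 ≤ 26 ^ 7).trans (Nat.pow_le_pow_left hn 7))
    have e : n ^ 8 = n * n ^ 7 := by ring
    omega
  have hr : 1 ≤ rootOf n := Nat.succ_pos _
  have hN : 10 * L ≤ 30 * (10 * L) * rootOf n := by nlinarith [Nat.mul_le_mul_left L hr]
  refine (((setup_safe (by omega) h10).implements (by omega) le_rfl (prepared_within n)).andThen
    fun s hs => (show Stmt.Safe _ _ (greedyRandom;; estimate) from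
      ⟨greedyRandom_safe (by omega), estimate_safe (by omega)⟩).implements (by omega) le_rfl
        (approximate_setup_ensures q hn hLn s hs).1).mono ?_
  rw [← add_mul]
  refine Nat.mul_le_mul_right _ ?_
  have t1 := setup_time_le (L := L) hn1
  have t2 := greedyRandom_time_le (N := 10 * L) (Q := 30 * (10 * L) * rootOf n) (m := n ^ 6 - 1)
    hn1 hr
  have t3 := estimate_time_le (r := rootOf n) (m := n ^ 6 - 1) hn1 (by omega : 1 ≤ 10 * L) hN
  simp only [Stmt.time]
  have h3 : n ≤ rootOf n * n := Nat.le_mul_of_pos_left n hr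
  have h4 : rootOf n * n ≤ L * (rootOf n * n) := Nat.le_mul_of_pos_left _ hL
  nlinarith

theorem greedyAll_implements (q : ℕ → ℕ → Bool) (hn : 1 ≤ n) :
    Implements (greedyAll.compile.exec q (n ^ 8) (prepared n)) (greedyAll.sem q (prepared n))
      (61 * (n * n) * ((n ^ 8).size + 1)) := by
  have hcap : 1 ≤ n ^ 8 := Nat.one_le_pow _ _ hn
  exact ((greedyAll_safe hcap).implements hcap le_rfl (prepared_within n)).mono
    (Nat.mul_le_mul_right _ (greedyAll_time_le hn))

theorem size_mul_self_le (L : ℕ) : (L * L).size ≤ 2 * L := by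
  rw [Nat.size_le, two_mul, pow_add]
  exact Nat.mul_lt_mul'' Nat.lt_two_pow_self Nat.lt_two_pow_self

theorem program_implements (hn : 1 ≤ n) (hL : 5 ≤ L) {T : ℕ}
    (happ : L * L < n → 113066 * (L * rootOf n * n) ≤ T) (hall : n ≤ L * L → 61 * (n * n) ≤ T) :
    Implements ((program L).run G (n ^ 8)) (programSem G L)
      ((T + 2 * L + 50) * ((n ^ 8).size + 1)) := by
  set B := (n ^ 8).size + 1 with hB
  have hcap : 1 ≤ n ^ 8 := Nat.one_le_pow _ _ hn
  have hsize : n.size + 1 ≤ B := by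
    have := Nat.size_le_size (Nat.le_self_pow (by norm_num : 8 ≠ 0) n)
    omega
  have hw := prepared_within n
  have c0 : Expr.cost (initial n) (.var Reg.vertices) + 1 ≤ 2 * B := by
    simp only [Expr.cost, initial, Reg.vertices, if_true]
    omega
  have c1 : Expr.cost (initial n) eighthPower + 1 ≤ 33 * B := by
    have h := Expr.cost_le hcap (e := eighthPower)
      (by simp [eighthPower, sqVertices, Expr.LitsLe]) hw
    have e : Expr.cost (prepared n) eighthPower = Expr.cost (initial n) eighthPower := by
      simp [eighthPower, sqVertices, Expr.cost, prepared, Expr.eval]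
    have e' : eighthPower.weight = 32 := by rfl
    rw [e, e'] at h
    omega
  have c2 : Expr.cost (prepared n) (.bin .lt (.lit (L * L)) (.var Reg.vertices)) + 1 ≤
      2 * L + 5 * B := by
    have h1 := size_mul_self_le L
    have h2 : (if L * L < n then 1 else 0 : ℕ).size ≤ 1 := by split <;> simp
    have h3 : (prepared n).var 0 = n := by simp [prepared, initial]
    simp only [Expr.cost, Expr.eval, Op.eval, Reg.vertices, h3]
    omega
  have hbranch : Implements (if Expr.eval (prepared n) (.bin .lt (.lit (L * L)) (.var Reg.vertices))
      ≠ 0 then (approximate L).compile.exec (pairOracle G) (n ^ 8) (prepared n)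
      else greedyAll.compile.exec (pairOracle G) (n ^ 8) (prepared n)) (programSem G L)
      (T * B) := by
    have h3 : (prepared n).var 0 = n := by simp [prepared, initial]
    simp only [Expr.eval, Op.eval, Reg.vertices, h3, programSem]
    by_cases h : L * L < n
    · simp only [h, if_true, ne_eq, one_ne_zero, not_false_eq_true]
      exact (approximate_implements (pairOracle G) (by nlinarith) (by omega) (by nlinarith)).mono
        (Nat.mul_le_mul_right _ (happ h))
    · simp only [h, if_false, ne_eq, not_true_eq_false]
      exact (greedyAll_implements (pairOracle G) hn).mono
        (Nat.mul_le_mul_right _ (hall (not_lt.1 h)))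
  have hassign : (initial n).setVar capVar (Expr.eval (initial n) eighthPower) = prepared n := by
    have : Expr.eval (initial n) eighthPower = n ^ 8 := by
      simp only [eighthPower, sqVertices, Expr.eval, Op.eval, initial, Reg.vertices, if_true]
      ring
    rw [this, prepared]
  have hrun : Implements ((program L).run G (n ^ 8)) (programSem G L)
      (2 * B + (33 * B + ((2 * L + 5 * B) + T * B))) := by
    refine implements_finish_andThen ?_ c0
    rw [if_pos (by simp only [Expr.eval, initial, Reg.vertices, if_true]; omega)]
    refine implements_finish_andThen ?_ c1
    rw [hassign]
    exact implements_finish_andThen hbranch c2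
  refine hrun.mono ?_
  have : 2 * L ≤ 2 * L * B := Nat.le_mul_of_pos_right _ (by omega)
  nlinarith

end Time

section Solves

open Classical in
/-- A program solves its task if the distribution of its final state makes failure unlikely. -/
theorem Implements.solves {P : Prog} {n : ℕ} {G : SimpleGraph (Fin n)} {fuel T : ℕ} {ν : PMF State}
    {t : ℝ} {good : ℕ → Prop} (h : Implements (P.run G fuel) ν T) (hT : (T : ℝ) ≤ t)
    (hgood : expect ν (fun s => if good (s.var Reg.size) then 0 else 1) ≤ 3⁻¹) :
    P.Solves G t (2 / 3) good := by
  refine ⟨fuel, fun r hr => ?_, ?_⟩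
  · obtain ⟨s, t', rfl, ht'⟩ := h.2 r hr
    exact ⟨s, t', rfl, (Nat.cast_le.2 ht').trans hT⟩
  · have h1 : (P.run G fuel).toOuterMeasure {r | ∃ s t, r = some (s, t) ∧ good s.output} =
        expect ν fun s => if good (s.var Reg.size) then 1 else 0 := by
      have h2 : expect ((P.run G fuel).map (Option.map Prod.fst))
          (fun o => if ∃ s, o = some s ∧ good s.output then 1 else 0) =
          expect (ν.map some) (fun o => if ∃ s, o = some s ∧ good s.output then 1 else 0) := by
        rw [h.1]
      rw [expect_map, expect_map] at h2
      rw [toOuterMeasure_eq_expect]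
      refine (expect_congr fun r hr => ?_).trans (h2.trans (expect_congr fun s _ => ?_))
      · obtain ⟨s, t', rfl, -⟩ := h.2 r hr
        simp [Set.indicator_apply]
      · simp [State.output]
    have h3 : expect ν (fun s => if good (s.var Reg.size) then 1 else 0) +
        expect ν (fun s => if good (s.var Reg.size) then 0 else 1) = 1 := by
      rw [← expect_add, ← expect_const ν 1]
      refine expect_congr fun s _ => ?_
      split <;> simp
    rw [h1]
    have h4 : (2 / 3 : ℝ≥0∞) + 3⁻¹ = 1 := by
      rw [div_eq_mul_inv, ← add_one_mul, show (2 + 1 : ℝ≥0∞) = 3 by norm_num]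
      exact ENNReal.mul_inv_cancel (by norm_num) (by norm_num)
    refine (ENNReal.add_le_add_iff_right (by norm_num : (3⁻¹ : ℝ≥0∞) ≠ ∞)).1 ?_
    rw [h4]
    exact h3.ge.trans (add_le_add_right hgood _)

theorem log_two_le_log (n : ℕ) : Real.log 2 ≤ Real.log (n + 2) :=
  Real.log_le_log two_pos (by linarith [n.cast_nonneg (α := ℝ)])

theorem size_pow_eight_le {n : ℕ} (hn : 1 ≤ n) :
    (((n ^ 8).size + 1 : ℕ) : ℝ) ≤ 21 * Real.log (n + 2) := by
  have hn' : (1 : ℝ) ≤ n := by exact_mod_cast hn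
  have h1 : n ^ 8 ≠ 0 := (Nat.pow_pos hn).ne'
  have h2 : 2 ^ ((n ^ 8).size - 1) ≤ n ^ 8 := by
    have : (n ^ 8).size - 1 < (n ^ 8).size := by
      have := Nat.size_pos.2 (Nat.pos_of_ne_zero h1)
      omega
    exact Nat.lt_size.1 this
  have h3 : (((n ^ 8).size : ℝ) - 1) * Real.log 2 ≤ 8 * Real.log (n + 2) := by
    have h4 : Real.log ((2 : ℝ) ^ ((n ^ 8).size - 1)) ≤ Real.log (((n : ℝ) + 2) ^ 8) := by
      refine Real.log_le_log (by positivity) ?_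
      have h5 : (2 : ℝ) ^ ((n ^ 8).size - 1) ≤ (n : ℝ) ^ 8 := by exact_mod_cast h2
      exact h5.trans (by gcongr; linarith)
    rw [Real.log_pow, Real.log_pow] at h4
    have h6 : (((n ^ 8).size - 1 : ℕ) : ℝ) = ((n ^ 8).size : ℝ) - 1 := by
      have := Nat.size_pos.2 (Nat.pos_of_ne_zero h1)
      push_cast [Nat.cast_sub (show 1 ≤ (n ^ 8).size from this)]
      ring
    rw [h6] at h4
    exact_mod_cast h4
  have hlog2 := Real.log_two_gt_d9
  have hlog : 1 ≤ Real.log (n + 2) := by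
    rw [Real.le_log_iff_exp_le (by linarith)]
    have := Real.exp_one_lt_d9
    linarith
  push_cast
  have h7 : (((n ^ 8).size : ℝ) - 1) * 0.69 ≤ 8 * Real.log (n + 2) := by
    have : 0 ≤ ((n ^ 8).size : ℝ) - 1 := by
      have := Nat.size_pos.2 (Nat.pos_of_ne_zero h1)
      have : (1 : ℝ) ≤ (n ^ 8).size := by exact_mod_cast this
      linarith
    nlinarith
  linarith

/-- Both branches of the program stay below a multiple of `L * n ^ (3 / 2)`: the first one because
the root is at most `2 * √n`, the second one because `√n` is at most `L`. -/
theorem exists_steps_le {n L : ℕ} (hn : 1 ≤ n) (hL : 1 ≤ L) :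
    ∃ T : ℕ, (L * L < n → 113066 * (L * rootOf n * n) ≤ T) ∧ (n ≤ L * L → 61 * (n * n) ≤ T) ∧
      ((T + 2 * L + 50 : ℕ) : ℝ) ≤ 226200 * (L * (n : ℝ) ^ (3 / 2 : ℝ)) := by
  have hn' : (1 : ℝ) ≤ n := by exact_mod_cast hn
  have hL' : (1 : ℝ) ≤ L := by exact_mod_cast hL
  have hpow : (n : ℝ) ^ (3 / 2 : ℝ) = n * √n := by
    rw [Real.sqrt_eq_rpow, show (3 / 2 : ℝ) = 1 + 1 / 2 by norm_num,
      Real.rpow_add (by linarith), Real.rpow_one]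
  rw [hpow]
  have hsqrt : 1 ≤ √(n : ℝ) := Real.one_le_sqrt.2 hn'
  have hss : √(n : ℝ) * √(n : ℝ) = n := Real.mul_self_sqrt (by linarith)
  have hroot : (rootOf n : ℝ) ≤ 2 * √n := by
    have h1 : Nat.sqrt (n - 1) * Nat.sqrt (n - 1) ≤ n := (Nat.sqrt_le _).trans (Nat.sub_le _ _)
    have h2 : (Nat.sqrt (n - 1) : ℝ) ≤ √n := by
      refine Real.le_sqrt_of_sq_le ?_
      rw [sq]
      exact_mod_cast h1
    rw [rootOf]
    push_cast
    linarith
  have hW : 1 ≤ (n : ℝ) * √n := one_le_mul_of_one_le_of_one_le hn' hsqrt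
  have hLW : (L : ℝ) ≤ L * (n * √n) := le_mul_of_one_le_right (by linarith) hW
  by_cases h : L * L < n
  · refine ⟨113066 * (L * rootOf n * n), fun _ => le_rfl, fun h' => by omega, ?_⟩
    have h3 : (L : ℝ) * rootOf n * n ≤ L * (2 * √n) * n := by gcongr
    push_cast
    linarith
  · refine ⟨61 * (n * n), fun h' => by omega, fun _ => le_rfl, ?_⟩
    have h3 : √(n : ℝ) ≤ L := Real.sqrt_le_iff.2 ⟨by linarith, by
      rw [sq]
      exact_mod_cast not_lt.1 h⟩
    have h4 : (n : ℝ) * n ≤ L * (n * √n) := by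
      calc (n : ℝ) * n = √n * (n * √n) := by linear_combination (-n : ℝ) * hss
        _ ≤ L * (n * √n) := by gcongr
    push_cast
    linarith

theorem exists_isMaximalMatching_ncard_le {n : ℕ} (G : SimpleGraph (Fin n)) :
    ∃ M : G.Subgraph, IsMaximalMatching M ∧ 2 * M.edgeSet.ncard ≤ n := by
  obtain ⟨M, hM⟩ := exists_isMaximalMatching G
  exact ⟨M, hM, hM.1.two_mul_ncard_edgeSet_le⟩

/-- The initial content of the output variable is good enough if `n = 0` or if `ε ≥ 1 / 2`. -/
theorem isEstimate_zero {n : ℕ} (G : SimpleGraph (Fin n)) {ε : ℝ} (h : n ≤ 2 * (ε * n)) :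
    IsEstimate G ε 0 := by
  obtain ⟨M, hM, hle⟩ := exists_isMaximalMatching_ncard_le G
  refine ⟨M, hM, ?_⟩
  have : 2 * (M.edgeSet.ncard : ℝ) ≤ n := by exact_mod_cast hle
  rw [Nat.cast_zero, zero_sub, abs_neg, abs_of_nonneg (Nat.cast_nonneg _)]
  linarith

theorem expect_programSem_le {n L : ℕ} {G : SimpleGraph (Fin n)} {ε : ℝ}
    [DecidablePred (IsEstimate G ε)] (hε : 0 < ε) (hL : 1 ≤ ε ^ 2 * L) (hL5 : 5 ≤ L) (hn : 1 ≤ n) :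
    expect (programSem G L) (fun s => if IsEstimate G ε (s.var Reg.size) then 0 else 1) ≤ 3⁻¹ := by
  rw [programSem]
  split
  · convert expect_approximate_le hε hL (by omega) (by nlinarith) (by nlinarith)
  · refine le_of_eq_of_le ?_ zero_le
    convert expect_greedyAll_eq_zero hε hn

end Solves
end PairQuery

theorem mainTheorem8 :
    ∃ (C : ℝ) (k : ℕ), ∀ ε : ℝ, 0 < ε →
      ∃ P : PairQuery.Prog, ∀ (n : ℕ) (G : SimpleGraph (Fin n)),
        P.Solves G
          (C * ((n : ℝ) ^ (3 / 2 : ℝ) / ε ^ 2 + 1) * Real.log ((n : ℝ) + 2) ^ k)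
          (2 / 3)
          (fun x => ∃ M : G.Subgraph, PairQuery.IsMaximalMatching M ∧
            |(x : ℝ) - (M.edgeSet.ncard : ℝ)| ≤ ε * (n : ℝ)) := by
  classical
  refine ⟨10 ^ 7, 1, fun ε hε => ?_⟩
  have hconst : ∀ n : ℕ, (3 : ℝ) ≤
      10 ^ 7 * ((n : ℝ) ^ (3 / 2 : ℝ) / ε ^ 2 + 1) * Real.log ((n : ℝ) + 2) ^ 1 := by
    intro n
    have h1 := PairQuery.log_two_le_log n
    have h2 := Real.log_two_gt_d9
    have h3 : 0 ≤ (n : ℝ) ^ (3 / 2 : ℝ) / ε ^ 2 := by positivity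
    rw [pow_one]
    calc (3 : ℝ) ≤ 10 ^ 7 * (0 + 1) * 0.69 := by norm_num
      _ ≤ _ := by gcongr; linarith
  rcases le_or_gt (1 / 2) ε with h | h
  · refine ⟨.skip, fun n G => ?_⟩
    have him : PairQuery.Implements (PairQuery.Prog.run .skip G 0)
        (PMF.pure (PairQuery.initial n)) 1 := PairQuery.implements_finish le_rfl _
    refine him.solves (good := PairQuery.IsEstimate G ε) ((by norm_num : ((1 : ℕ) : ℝ) ≤ 3).trans
      (hconst n)) ?_
    rw [PairQuery.expect_pure, if_pos]
    · exact zero_le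
    · refine PairQuery.isEstimate_zero G ?_
      have : (0 : ℝ) ≤ n := Nat.cast_nonneg n
      nlinarith
  · set L := ⌈1 / ε ^ 2⌉₊ with hLdef
    have hε2 : 0 < ε ^ 2 := by positivity
    have hL : 1 ≤ ε ^ 2 * L := by
      have := Nat.le_ceil (1 / ε ^ 2)
      rwa [← hLdef, div_le_iff₀' hε2] at this
    have hL5 : 5 ≤ L := by
      refine Nat.lt_ceil.2 ?_
      rw [lt_div_iff₀ hε2]
      push_cast
      nlinarith
    have hL2 : (L : ℝ) ≤ 2 / ε ^ 2 := by
      have h1 := (Nat.ceil_lt_add_one (by positivity : 0 ≤ 1 / ε ^ 2)).le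
      have h2 : 1 ≤ 1 / ε ^ 2 := by
        rw [le_div_iff₀ hε2]
        nlinarith
      rw [← hLdef] at h1
      calc (L : ℝ) ≤ 1 / ε ^ 2 + 1 / ε ^ 2 := by linarith
        _ = 2 / ε ^ 2 := by ring
    refine ⟨PairQuery.program L, fun n G => ?_⟩
    rcases Nat.eq_zero_or_pos n with rfl | hn
    · have him : PairQuery.Implements ((PairQuery.program L).run G 0)
          (PMF.pure (PairQuery.initial 0)) (2 + 1) := by
        refine PairQuery.implements_finish_andThen ?_
          (by simp [PairQuery.Expr.cost, PairQuery.initial])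
        exact PairQuery.implements_finish le_rfl _
      refine him.solves (good := PairQuery.IsEstimate G ε)
        ((by norm_num : ((2 + 1 : ℕ) : ℝ) ≤ 3).trans (hconst 0)) ?_
      rw [PairQuery.expect_pure, if_pos]
      · exact zero_le
      · exact PairQuery.isEstimate_zero G (by simp)
    · obtain ⟨T, hT1, hT2, hT3⟩ := PairQuery.exists_steps_le (n := n) (L := L) hn (by omega)
      refine (PairQuery.program_implements (G := G) hn hL5 hT1 hT2).solves
        (good := PairQuery.IsEstimate G ε) ?_ (PairQuery.expect_programSem_le hε hL hL5 hn)
      have hlog := PairQuery.size_pow_eight_le hn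
      have hlog0 : 0 ≤ Real.log ((n : ℝ) + 2) := by
        have := (Nat.cast_nonneg _).trans hlog
        linarith
      rw [Nat.cast_mul, pow_one]
      set W := (n : ℝ) ^ (3 / 2 : ℝ)
      have hW : 0 ≤ W := by positivity
      calc ((T + 2 * L + 50 : ℕ) : ℝ) * (((n ^ 8).size + 1 : ℕ) : ℝ)
          ≤ (226200 * (2 / ε ^ 2 * W)) * (21 * Real.log ((n : ℝ) + 2)) := by
            refine mul_le_mul (hT3.trans ?_) hlog (Nat.cast_nonneg _) (by positivity)
            gcongr
        _ = 9500400 * (W / ε ^ 2) * Real.log ((n : ℝ) + 2) := by ring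
        _ ≤ 10 ^ 7 * (W / ε ^ 2 + 1) * Real.log ((n : ℝ) + 2) := by
            refine mul_le_mul_of_nonneg_right ?_ hlog0
            have : 0 ≤ W / ε ^ 2 := by positivity
            linarith
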